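/- **Embeddings.** Let $G$ be a finite connected graph with at least one edge and $T$ a spanning tree of $G$. A $T$-rotation system of $G$ is a choice, at each vertex, of a cyclic permutation of the incident edges, together with a label $0$ (untwisted) or $1$ (twisted) on each edge, where all edges of $T$ have label $0$. It determines, by face tracing, a cellular embedding of $G$ into a closed surface with Euler characteristic $\chi=|V|-|E|+|F|$; the Euler-genus of the surface is $2-\chi$ (that is, $2j$ for the orientable surface with $j$ handles and $k$ for the non-orientable surface with $k$ crosscaps). Let $\varepsilon_G(i)$ be the number of $T$-rotation systems of $G$ whose surface has Euler-genus $i$ (the number of equivalence classes of embeddings), and let $\mathcal E_G(z)=\sum_{i\ge 0}\varepsilon_G(i)z^i$ be the Euler-genus polynomial. **Graphs.** Draw a path $u_0v_1v_2\cdots v_\ell u_{\ell+1}$ ($\ell\ge 1$) horizontally and attach to each $v_i$ $(1\le i\le \ell)$ an edge $v_iu_i$ to a new leaf $u_i$, drawn vertically up or down. This is a plane caterpillar $T$. Adding the cycle $C$ that passes through $u_0$, the upper leaves from left to right, $u_{\ell+1}$, and the lower leaves from right to left gives a cubic caterpillar-Halin graph $T\cup C$; its embeddings are counted with respect to the spanning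 tree $T$. For $k\ge 1$, $m_1,\dots,m_{k-1}\ge 1$ and $m_k\ge 0$ ($m_1\ge 1$ if $k=1$), let $H_{m_1,\dots,m_k}$ be this graph when the numbers of consecutive up or down edges, alternately up and down, from left to right, are $m_1,\,m_2+1,\,\dots,\,m_{k-1}+1,\,m_k$ (just $m_1$ if $k=1$), where a last run of length $m_k=0$ is empty. Let $\mathcal E_{m_1,\dots,m_k}(z)$ be its Euler-genus polynomial. **Matrices.** Let $k\ge 2$ and $m_1,\dots,m_k\ge 1$. Consider the symmetric matrices over $\mathbb Z_2$ whose rows and columns are indexed by symbols $e_i$ $(1\le i\le k)$ and $e_{i,a}$ $(1\le i\le k,\ 1\le a\le m_i)$, whose entries are arbitrary on the diagonal and at the pairs $\{e_i,e_{i+1}\}$, $\{e_i,e_{i,a}\}$, $\{e_{i,a},e_{i,a+1}\}$, $\{e_{i+1},e_{i,m_i}\}$, $\{e_i,e_{i+1,1}\}$, and whose other entries are all $0$. Those among them in which moreover the row and the column of $e_k$ are zero are said to be of the form $\Lambda_{m_1,\dots,m_k}$ (they are the overlap matrices of $H_{m_1,\dots,m_k}-e_k$, with a zero row and column kept for $e_k$).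 Let $\lambda_{m_1,\dots,m_k}(z)=\sum_j \lambda_{m_1,\dots,m_k}[j]\,z^j$, where $\lambda_{m_1,\dots,m_k}[j]$ is the number of matrices of the form $\Lambda_{m_1,\dots,m_k}$ of rank $j$. **Theorem.** For all $k\ge 2$, $m_1,\dots,m_{k-1}\ge 1$ and $m_k\ge 2$, $$\mathcal E_{m_1,\dots,m_k}(z)=(1+4z)\,\mathcal E_{m_1,\dots,m_{k-1},m_k-1}(z)+16z^2\,\mathcal E_{m_1,\dots,m_{k-1},m_k-2}(z)+2^{m_k+3}z^2\,\lambda_{m_1,\dots,m_{k-1},m_k-1}(z).$$ The initial conditions are, for $k\ge 3$ and $m_1,\dots,m_{k-1}\ge 1$, $$\mathcal E_{m_1,\dots,m_{k-1},0}(z)=\mathcal E_{m_1,\dots,m_{k-2},m_{k-1}+1}(z),\qquad \mathcal E_{m_1,\dots,m_{k-1},1}(z)=\mathcal E_{m_1,\dots,m_{k-2},m_{k-1}+2}(z),$$ and, for $k=2$ and $m_1\ge 1$, $$\mathcal E_{m_1,0}(z)=\mathcal E_{m_1}(z),\qquad \mathcal E_{m_1,1}(z)=\mathcal E_{m_1+1}(z).$$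 -/

import Mathlib

open Polynomial

/-! ### Rotation systems and the Euler-genus polynomial -/

namespace CatHalin

universe u

/-- A pure rotation system of a graph, with the cyclic permutations at the separate vertices
assembled into one permutation of the darts (a dart is an edge together with one of its ends,
`d.fst`): it permutes the darts at each vertex `v` among themselves, in one single cycle. -/
structure PureRotation {V : Type u} (G : SimpleGraph V) where
  rot : Equiv.Perm G.Dart
  fst_rot : ∀ d : G.Dart, (rot d).fst = d.fst
  sameCycle : ∀ d d' : G.Dart, d.fst = d'.fst → rot.SameCycle d d'

/-- A general rotation system: a pure rotation system and a `0/1` label on every edge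
(`0` is untwisted, `1` is twisted). -/
structure RotationSystem {V : Type u} (G : SimpleGraph V) extends PureRotation G where
  twist : G.edgeSet → ZMod 2

namespace RotationSystem

variable {V : Type u} {G : SimpleGraph V}

/-- The label of the edge underlying a dart. -/
def dartTwist (R : RotationSystem G) (d : G.Dart) : ZMod 2 :=
  R.twist ⟨d.edge, d.edge_mem⟩

/-- Face tracing. The pair `(d, s)` is the side `s` of the edge of `d`, seen from the end `d.fst`:
side `0` faces the next dart `rot d` in the rotation at that vertex, side `1` faces the previous
dart. Two such pairs are consecutive on the boundary of a face when they are

* the two ends of the same side of an edge: on an untwisted edge the side `s` seen from one end is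
  the side `s + 1` seen from the other end, on a twisted edge it is the side `s`;
* the two sides of the corner between a dart `d` and the next dart `rot d` at the same vertex. -/
inductive FaceStep (R : RotationSystem G) : G.Dart × ZMod 2 → G.Dart × ZMod 2 → Prop
  | edge (d : G.Dart) (s : ZMod 2) : FaceStep R (d, s) (d.symm, s + 1 + R.dartTwist d)
  | corner (d : G.Dart) : FaceStep R (d, 0) (R.rot d, 1)

/-- The faces of the embedding: the classes of the equivalence relation generated by
`FaceStep`. -/
def Face (R : RotationSystem G) : Type u := Quot R.FaceStep

/-- The Euler characteristic `|V| - |E| + |F|` of the surface of the embedding (of a connected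
graph with at least one edge). -/
noncomputable def eulerChar (R : RotationSystem G) : ℤ :=
  (Nat.card V : ℤ) - (Nat.card G.edgeSet : ℤ) + (Nat.card R.Face : ℤ)

/-- The Euler-genus of the surface of the embedding. The orientable surface with `j` handles has
Euler characteristic `2 - 2 j`, the non-orientable surface with `k` crosscaps has `2 - k`, so in
both cases the Euler-genus is `2` minus the Euler characteristic. -/
noncomputable def eulerGenus (R : RotationSystem G) : ℤ := 2 - R.eulerChar

end RotationSystem

/-- The `T`-rotation systems of `G`: the edges of the spanning tree `T` are untwisted. -/
def TRotationSystem {V : Type u} (G T : SimpleGraph V) : Type u :=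
  {R : RotationSystem G // ∀ e : G.edgeSet, e.1 ∈ T.edgeSet → R.twist e = 0}

/-- The number of equivalence classes of embeddings of `G` into the surface of Euler-genus `i`;
a class is represented by a unique `T`-rotation system. -/
noncomputable def embeddingCount {V : Type u} (G T : SimpleGraph V) (i : ℕ) : ℕ :=
  Nat.card {R : TRotationSystem G T // R.1.eulerGenus = (i : ℤ)}

/-- The Euler-genus polynomial `∑ᵢ εᵢ zⁱ`; see `coeff_eulerGenusPolynomial`. -/
noncomputable def eulerGenusPolynomial {V : Type u} (G T : SimpleGraph V) : ℤ[X] :=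
  ∑ᶠ i : ℕ, C (embeddingCount G T i : ℤ) * X ^ i

instance finite_TRotationSystem {V : Type u} [Finite V] (G T : SimpleGraph V) :
    Finite (TRotationSystem G T) := by
  classical
  have := Fintype.ofFinite V
  have hinj : Function.Injective
      (fun R : TRotationSystem G T => (R.1.rot, R.1.twist)) := by
    rintro ⟨⟨⟨r, _, _⟩, t⟩, _⟩ ⟨⟨⟨r', _, _⟩, t'⟩, _⟩ h
    simp only [Prod.mk.injEq] at h
    obtain ⟨h1, h2⟩ := h
    subst h1
    subst h2
    rfl
  exact Finite.of_injective _ hinj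

theorem finite_support_embeddingCount {V : Type u} [Finite V] (G T : SimpleGraph V) :
    (Function.support (fun i : ℕ => C (embeddingCount G T i : ℤ) * X ^ i)).Finite := by
  refine (Set.finite_range
    (fun R : TRotationSystem G T => R.1.eulerGenus.toNat)).subset ?_
  intro i hi
  by_contra hne
  apply hi
  have hempty : IsEmpty {R : TRotationSystem G T // R.1.eulerGenus = (i : ℤ)} := by
    refine ⟨fun R => hne ⟨R.1, ?_⟩⟩
    simp [R.2]
  simp [embeddingCount, Nat.card_of_isEmpty]

theorem coeff_eulerGenusPolynomial {V : Type u} [Finite V] (G T : SimpleGraph V) (i : ℕ) :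
    (eulerGenusPolynomial G T).coeff i = (embeddingCount G T i : ℤ) := by
  have h := finite_support_embeddingCount G T
  rw [eulerGenusPolynomial, finsum_eq_sum _ h, finsetSum_coeff]
  simp only [coeff_C_mul, coeff_X_pow, mul_ite, mul_one, mul_zero]
  rw [Finset.sum_ite_eq]
  split_ifs with hi
  · rfl
  · by_contra hc
    apply hi
    rw [Set.Finite.mem_toFinset, Function.mem_support]
    intro h0
    apply hc
    have h1 := congrArg (fun p : ℤ[X] => p.coeff i) h0
    simp at h1
    simp [h1]

/-! ### Cubic caterpillar-Halin graphs -/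

/-- Vertices: the spine `v₁, …, v_ℓ` (`inl i` is `v_{i+1}`) and the leaves `u₀, …, u_{ℓ+1}`
(`inr j` is `u_j`). -/
abbrev CatVertex (l : ℕ) : Type := Fin l ⊕ Fin (l + 2)

/-- The edges `v_i v_{i+1}` and `v_i u_i`, and the edges `v₁ u₀` and `v_ℓ u_{ℓ+1}`. -/
def treeRel (l : ℕ) : CatVertex l → CatVertex l → Prop
  | .inl i, .inl j => i.val + 1 = j.val
  | .inl i, .inr j =>
      j.val = i.val + 1 ∨ (i.val = 0 ∧ j.val = 0) ∨ (i.val + 1 = l ∧ j.val = l + 1)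
  | .inr _, _ => False

/-- The caterpillar with spine `v₁, …, v_ℓ`. -/
def caterpillar (l : ℕ) : SimpleGraph (CatVertex l) := SimpleGraph.fromRel (treeRel l)

/-- The word `w` says on which side (up is `true`, down is `false`) of the horizontal path
`u₀ v₁ … v_ℓ u_{ℓ+1}` the edges `v_i u_i` are drawn. The leaf `u_a` is visible from the side `s`
if it is drawn on this side or is one of the two ends of the path. -/
def OnSide (w : List Bool) (s : Bool) (a : Fin (w.length + 2)) : Prop :=
  a.val = 0 ∨ a.val = w.length + 1 ∨ ∃ i : Fin w.length, a.val = i.val + 1 ∧ w.get i = s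

/-- Two leaves follow each other, from left to right, on the boundary cycle of the drawing if they
are both visible from one side and no leaf between them is. -/
def leafRel (w : List Bool) : CatVertex w.length → CatVertex w.length → Prop
  | .inr a, .inr b => a < b ∧ ∃ s : Bool, OnSide w s a ∧ OnSide w s b ∧
      ∀ c : Fin (w.length + 2), a < c → c < b → ¬ OnSide w s c
  | _, _ => False

/-- The boundary cycle through the leaves: `u₀`, the up leaves from left to right, `u_{ℓ+1}`,
the down leaves from right to left. -/
def leafCycle (w : List Bool) : SimpleGraph (CatVertex w.length) :=
  SimpleGraph.fromRel (leafRel w)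

/-- The cubic caterpillar-Halin graph of the plane caterpillar described by `w`. -/
def halin (w : List Bool) : SimpleGraph (CatVertex w.length) :=
  caterpillar w.length ⊔ leafCycle w

/-- `m₂, …, m_k ↦ m₂ + 1, …, m_{k-1} + 1, m_k`. -/
def laterRuns : List ℕ → List ℕ
  | [] => []
  | [a] => [a]
  | a :: b :: t => (a + 1) :: laterRuns (b :: t)

/-- `m₁, …, m_k ↦ m₁, m₂ + 1, …, m_{k-1} + 1, m_k`. -/
def runs : List ℕ → List ℕ
  | [] => []
  | a :: t => a :: laterRuns t

/-- The word whose consecutive runs, alternately `s` and `!s`, have the given lengths. -/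
def runWord : Bool → List ℕ → List Bool
  | _, [] => []
  | s, a :: t => List.replicate a s ++ runWord (!s) t

/-- The Euler-genus polynomial of `H_{m₁,…,m_k}`, the cubic caterpillar-Halin graph for which the
numbers of consecutive up or down edges are `m₁, m₂ + 1, …, m_{k-1} + 1, m_k`. The spanning tree is
the characteristic tree, so that the co-tree edges are those of the boundary cycle. -/
noncomputable def eulerH (m : List ℕ) : ℤ[X] :=
  eulerGenusPolynomial (halin (runWord true (runs m)))
    (caterpillar (runWord true (runs m)).length)

/-! ### The matrices `Δ` and `Λ` -/

/-- Rows and columns: `inl i` stands for the co-tree edge `e_{i+1}`, `inr ⟨i, a⟩` stands for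
`e_{i+1,a+1}`. -/
abbrev MatIndex (m : List ℕ) : Type :=
  Fin m.length ⊕ (Σ i : Fin m.length, Fin (m.get i))

/-- Entries of the symmetric tridiagonal matrix with diagonal `a` and off-diagonal `b`. -/
def tridiag (a b : ℕ → ZMod 2) (i j : ℕ) : ZMod 2 :=
  if i = j then a i else if i + 1 = j then b i else if j + 1 = i then b j else 0

/-- The entry of the block `M_i` in the row of `e_{i,a}` and the column of `e_j`. The first index of
`z` and the index `a` count from `0`, the second index of `z` runs through `0, …, m_i + 1`. -/
def blockM (m : List ℕ) (z : ℕ → ℕ → ZMod 2) (p : Σ i : Fin m.length, Fin (m.get i))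
    (j : Fin m.length) : ZMod 2 :=
  if j = p.1 then z p.1.val (p.2.val + 1)
  else if j.val = p.1.val + 1 ∧ p.2.val + 1 = m.get p.1 then z j.val 0
  else if j.val + 1 = p.1.val ∧ p.2.val = 0 then z j.val (m.get j + 1)
  else 0

/-- The matrix `Δ_{m₁,…,m_k}^{X,Y,Z}` for `X = (x₀, x)`, `Y = (y₀, y)`, `Z = z`. -/
def Delta (m : List ℕ) (x₀ y₀ : ℕ → ZMod 2) (x y z : ℕ → ℕ → ZMod 2) :
    Matrix (MatIndex m) (MatIndex m) (ZMod 2)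
  | .inl i, .inl j => tridiag x₀ y₀ i.val j.val
  | .inr p, .inl j => blockM m z p j
  | .inl i, .inr q => blockM m z q i
  | .inr p, .inr q =>
      if p.1 = q.1 then tridiag (x p.1.val) (y p.1.val) p.2.val q.2.val else 0

/-- The matrices of the form `Λ_{m₁,…,m_k}`: those of the form `Δ_{m₁,…,m_k}` whose `k`-th row and
`k`-th column (those of `e_k`) are zero. -/
def LambdaSet (m : List ℕ) : Set (Matrix (MatIndex m) (MatIndex m) (ZMod 2)) :=
  {M | (∃ (x₀ y₀ : ℕ → ZMod 2) (x y z : ℕ → ℕ → ZMod 2), M = Delta m x₀ y₀ x y z) ∧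
    ∀ i : Fin m.length, i.val + 1 = m.length →
      ∀ q : MatIndex m, M (Sum.inl i) q = 0 ∧ M q (Sum.inl i) = 0}

/-- The polynomial `λ_{m₁,…,m_k}(z)`: its coefficient at `zʲ` is the number of matrices of the form
`Λ_{m₁,…,m_k}` of rank `j`. -/
noncomputable def lambdaPoly (m : List ℕ) : ℤ[X] :=
  ∑ j ∈ Finset.range (m.length + m.sum + 1),
    C (Nat.card {M : Matrix (MatIndex m) (MatIndex m) (ZMod 2) //
      M ∈ LambdaSet m ∧ M.rank = j} : ℤ) * X ^ j

end CatHalin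

/-! Draw the graph in the plane. Each co-tree edge lies on the unbounded face and on one bounded
face, which indexes it; each tree edge separates two bounded faces. Relative to the drawing, a
`T`-rotation system amounts to a rotation at one root vertex and an arbitrary relative twist `θ` on
every edge (`PlaneTree.edgeTwist_bijective`). A `ZMod 2`-valued function on the faces of the
embedding is the sum of a function `a` on the bounded faces of the drawing and a function `c` on the
vertices, where the coboundary of `c` is `θ` times the jump of `a`. Such a `c` exists exactly when
`a` lies in the kernel of `matOf θ`, whose `(f, g)` entry sums `θ` over the edges common to the
boundaries of `f` and `g`. Hence the Euler-genus is the rank of this matrix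
(`PlaneTree.eulerGenus_eq`). Its off-diagonal entries are the twists of the tree edges and its row
sums those of the co-tree edges, so it runs exactly once through the symmetric matrices supported on
the adjacency of bounded faces. The Euler-genus polynomial is therefore twice a rank generating
function (`eulerGenusPolynomial_halin`).

From left to right the bounded faces form a triangulated strip: a face is joined to the last earlier
face on either side. The last face `n + 1` is joined to `n` and to `b`, the last face opposite to
`n`. Let `d` be its diagonal entry and `s`, `q` its entries at `n` and `b`. Pivoting gives the
recurrence (`rankSum_ext_ext`): `d = 1` gives `4 X` times the strip with one face less; `d = s = q =
0` gives that strip itself; `d = 0`, `s = 1` eliminates `n` as well and gives `16 X ^ 2` times the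
strip with two faces less; `d = s = 0`, `q = 1` eliminates the row of `b` and leaves matrices of the
form `Λ`, each counted `2` to the size of the closed neighbourhood of `b`. Here `b` is `e_k`, this
size is `m_k + 2`, and the factor two for the root gives `2 ^ (m_k + 3)`.

The initial conditions hold because the words coincide or differ in their last letter only, and the
side of the last face does not affect the strip (`stripSet_last`). -/

namespace CatHalin

/-! ### Ranks of bordered symmetric matrices over the field with two elements -/

section LinearAlgebra

variable {ι κ : Type*} [Fintype ι] [Fintype κ]

/-- Number of vectors in the kernel. -/
noncomputable def kerCard (M : Matrix ι ι (ZMod 2)) : ℕ :=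
  Nat.card {x : ι → ZMod 2 // M.mulVec x = 0}

theorem kerCard_mul (M : Matrix ι ι (ZMod 2)) :
    kerCard M * 2 ^ M.rank = 2 ^ Fintype.card ι := by
  classical
  have h1 := LinearMap.finrank_range_add_finrank_ker M.mulVecLin
  have h2 : kerCard M = 2 ^ Module.finrank (ZMod 2) (LinearMap.ker M.mulVecLin) := by
    have h3 := Module.card_eq_pow_finrank (K := ZMod 2) (V := LinearMap.ker M.mulVecLin)
    rw [ZMod.card, ← Nat.card_eq_fintype_card] at h3
    rw [← h3]
    rfl
  rw [h2, ← pow_add, Matrix.rank, add_comm, h1]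
  simp

/-- Ranks are compared through kernels: a bijection of kernels, up to free coordinates counted by
`a` and `b`, becomes an equation of ranks by rank-nullity. -/
theorem rank_eq_of_kerCard (M : Matrix ι ι (ZMod 2)) (N : Matrix κ κ (ZMod 2)) (a b c : ℕ)
    (hk : 2 ^ a * kerCard M = 2 ^ b * kerCard N)
    (hc : Fintype.card ι + a = Fintype.card κ + b + c) : M.rank = N.rank + c := by
  have h1 := kerCard_mul M
  have h2 := kerCard_mul N
  have hN : 0 < kerCard N := by
    rcases Nat.eq_zero_or_pos (kerCard N) with h | h
    · rw [h] at h2; simp at h2; exact absurd h2.symm (by positivity)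
    · exact h
  have h3 : 2 ^ b * kerCard N * 2 ^ M.rank = 2 ^ b * kerCard N * 2 ^ (N.rank + c) := by
    rw [← hk, mul_assoc, h1, hk, pow_add, mul_assoc, ← mul_assoc (kerCard N), h2, ← pow_add,
      ← pow_add, ← pow_add]
    congr 1
    omega
  exact Nat.pow_right_injective le_rfl (Nat.eq_of_mul_eq_mul_left (by positivity) h3)

theorem zmod2_cases (x : ZMod 2) : x = 0 ∨ x = 1 := by
  revert x; decide

theorem zmod2_add_eq_zero {x y : ZMod 2} : x + y = 0 ↔ x = y := by
  revert x y; decide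

theorem zmod2_add_self (x : ZMod 2) : x + x = 0 := by
  revert x; decide

theorem sum_zmod2 {R : Type*} [AddCommMonoid R] (f : ZMod 2 → R) : ∑ x, f x = f 0 + f 1 :=
  Fin.sum_univ_two f

/-- A symmetric matrix bordered by one row and one column. -/
def bord (d : ZMod 2) (v : ι → ZMod 2) (M : Matrix ι ι (ZMod 2)) :
    Matrix (Option ι) (Option ι) (ZMod 2)
  | none, none => d
  | none, some j => v j
  | some i, none => v i
  | some i, some j => M i j

theorem bord_mulVec_none (d : ZMod 2) (v : ι → ZMod 2) (M : Matrix ι ι (ZMod 2))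
    (x : Option ι → ZMod 2) :
    (bord d v M).mulVec x none = d * x none + v ⬝ᵥ (fun i => x (some i)) := by
  simp [Matrix.mulVec, dotProduct, Fintype.sum_option, bord]

theorem bord_mulVec_some (d : ZMod 2) (v : ι → ZMod 2) (M : Matrix ι ι (ZMod 2))
    (x : Option ι → ZMod 2) (i : ι) :
    (bord d v M).mulVec x (some i) = v i * x none + M.mulVec (fun i => x (some i)) i := by
  simp [Matrix.mulVec, dotProduct, Fintype.sum_option, bord]

theorem bord_mulVec_eq_zero (d : ZMod 2) (v : ι → ZMod 2) (M : Matrix ι ι (ZMod 2))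
    (x : Option ι → ZMod 2) :
    (bord d v M).mulVec x = 0 ↔ d * x none + v ⬝ᵥ (fun i => x (some i)) = 0 ∧
      ∀ i, v i * x none + M.mulVec (fun i => x (some i)) i = 0 := by
  rw [funext_iff, Option.forall, bord_mulVec_none]
  simp only [bord_mulVec_some, Pi.zero_apply]

/-- Pivoting on the diagonal entry `1` leaves the Schur complement: the border coordinate of a
kernel vector must be `v ⬝ᵥ x`. -/
theorem rank_bord_one (v : ι → ZMod 2) (M : Matrix ι ι (ZMod 2)) :
    (bord 1 v M).rank = (M + Matrix.vecMulVec v v).rank + 1 := by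
  refine rank_eq_of_kerCard _ _ 0 0 1 ?_ (by simp)
  simp only [pow_zero, one_mul]
  have key (x : ι → ZMod 2) (i : ι) :
      (M + Matrix.vecMulVec v v).mulVec x i = v i * (v ⬝ᵥ x) + M.mulVec x i := by
    rw [Matrix.add_mulVec, Pi.add_apply, Matrix.vecMulVec_mulVec]
    simp
    ring
  refine Nat.card_congr
    { toFun := fun x => ⟨fun i => x.1 (some i), ?_⟩
      invFun := fun x => ⟨fun o => o.elim (v ⬝ᵥ x.1) x.1, ?_⟩
      left_inv := ?_
      right_inv := ?_ }
  · obtain ⟨h1, h2⟩ := (bord_mulVec_eq_zero _ _ _ _).1 x.2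
    rw [one_mul, zmod2_add_eq_zero] at h1
    funext i
    rw [key, ← h1]
    exact h2 i
  · rw [bord_mulVec_eq_zero]
    refine ⟨by simp [zmod2_add_self], fun i => ?_⟩
    have := congrFun x.2 i
    rwa [key] at this
  · intro x
    obtain ⟨h1, h2⟩ := (bord_mulVec_eq_zero _ _ _ _).1 x.2
    rw [one_mul, zmod2_add_eq_zero] at h1
    ext o
    cases o <;> simp [h1]
  · intro x
    rfl

theorem rank_bord_zero (M : Matrix ι ι (ZMod 2)) : (bord 0 0 M).rank = M.rank := by
  refine rank_eq_of_kerCard _ _ 0 1 0 ?_ (by simp)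
  rw [pow_zero, one_mul, pow_one]
  have : 2 * kerCard M = Nat.card (ZMod 2 × {x : ι → ZMod 2 // M.mulVec x = 0}) := by
    rw [Nat.card_prod, Nat.card_zmod]; rfl
  rw [this]
  refine Nat.card_congr
    { toFun := fun x => ⟨x.1 none, fun i => x.1 (some i), ?_⟩
      invFun := fun x => ⟨fun o => o.elim x.1 x.2.1, ?_⟩
      left_inv := ?_
      right_inv := ?_ }
  · obtain ⟨h1, h2⟩ := (bord_mulVec_eq_zero _ _ _ _).1 x.2
    funext i
    simpa using h2 i
  · rw [bord_mulVec_eq_zero]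
    refine ⟨by simp, fun i => ?_⟩
    simpa using congrFun x.2.2 i
  · intro x
    ext o
    cases o <;> simp
  · intro x
    rfl

/-- The pivot is the invertible block with rows `(0, 1)` and `(1, d)` on the two border indices, and
the right side is its Schur complement. -/
theorem rank_bord_bord (d : ZMod 2) (u v : ι → ZMod 2) (M : Matrix ι ι (ZMod 2)) :
    (bord 0 (fun o => o.elim 1 u) (bord d v M)).rank =
      (M + d • Matrix.vecMulVec u u + Matrix.vecMulVec u v + Matrix.vecMulVec v u).rank + 2 := by
  refine rank_eq_of_kerCard _ _ 0 0 2 ?_ (by simp)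
  simp only [pow_zero, one_mul]
  have key (x : ι → ZMod 2) (i : ι) :
      (M + d • Matrix.vecMulVec u u + Matrix.vecMulVec u v + Matrix.vecMulVec v u).mulVec x i =
        u i * (d * (u ⬝ᵥ x) + v ⬝ᵥ x) + (v i * (u ⬝ᵥ x) + M.mulVec x i) := by
    simp only [Matrix.add_mulVec, Pi.add_apply, Matrix.vecMulVec_mulVec, Matrix.smul_mulVec]
    simp
    ring
  have ker (x : Option (Option ι) → ZMod 2) :
      (bord 0 (fun o => o.elim 1 u) (bord d v M)).mulVec x = 0 ↔
        x (some none) = u ⬝ᵥ (fun i => x (some (some i))) ∧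
        x none = d * x (some none) + v ⬝ᵥ (fun i => x (some (some i))) ∧
        ∀ i, u i * x none + (v i * x (some none) + M.mulVec (fun i => x (some (some i))) i) = 0 := by
    rw [bord_mulVec_eq_zero, Option.forall, bord_mulVec_none]
    simp only [bord_mulVec_some, dotProduct, Fintype.sum_option, Option.elim, one_mul, zero_mul,
      zero_add, zmod2_add_eq_zero]
  refine Nat.card_congr
    { toFun := fun x => ⟨fun i => x.1 (some (some i)), ?_⟩
      invFun := fun x => ⟨fun o => o.elim (d * (u ⬝ᵥ x.1) + v ⬝ᵥ x.1)
        (fun o => o.elim (u ⬝ᵥ x.1) x.1), ?_⟩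
      left_inv := ?_
      right_inv := ?_ }
  · obtain ⟨h1, h2, h3⟩ := (ker _).1 x.2
    funext i
    rw [key, ← h1, ← h2]
    exact h3 i
  · rw [ker]
    refine ⟨rfl, rfl, fun i => ?_⟩
    have := congrFun x.2 i
    rwa [key] at this
  · intro x
    obtain ⟨h1, h2, h3⟩ := (ker _).1 x.2
    ext o
    rcases o with _ | _ | o
    · simp [h1, h2]
    · simp [h1]
    · rfl
  · intro x
    rfl

/-- The matrix with the row and the column of `b` replaced by zero. -/
def zeroAt [DecidableEq ι] (b : ι) (M : Matrix ι ι (ZMod 2)) : Matrix ι ι (ZMod 2) :=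
  fun i j => if i = b ∨ j = b then 0 else M i j

/-- The border equation forces `x b = 0` and the equation in row `b` fixes the border coordinate, so
row and column `b` drop out. In `zeroAt b M` the coordinate at `b` is free instead, which doubles
the kernel. -/
theorem rank_bord_single [DecidableEq ι] (b : ι) (M : Matrix ι ι (ZMod 2)) :
    (bord 0 (Pi.single b 1) M).rank = (zeroAt b M).rank + 2 := by
  refine rank_eq_of_kerCard _ _ 1 0 2 ?_ (by simp)
  rw [pow_zero, one_mul, pow_one]
  have : 2 * kerCard (bord 0 (Pi.single b 1) M) =
      Nat.card (ZMod 2 × {x : Option ι → ZMod 2 // (bord 0 (Pi.single b 1) M).mulVec x = 0}) := by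
    rw [Nat.card_prod, Nat.card_zmod]; rfl
  rw [this]
  have key (x : ι → ZMod 2) (i : ι) (hi : i ≠ b) :
      (zeroAt b M).mulVec x i = M.mulVec (Function.update x b 0) i := by
    simp only [Matrix.mulVec, dotProduct]
    refine Finset.sum_congr rfl fun j _ => ?_
    by_cases hj : j = b
    · subst hj; simp [zeroAt]
    · simp [zeroAt, hi, hj]
  have keyb (x : ι → ZMod 2) : (zeroAt b M).mulVec x b = 0 := by
    simp [Matrix.mulVec, dotProduct, zeroAt]
  have ker (x : Option ι → ZMod 2) : (bord 0 (Pi.single b 1) M).mulVec x = 0 ↔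
      x (some b) = 0 ∧ x none = M.mulVec (fun i => x (some i)) b ∧
        ∀ i, i ≠ b → M.mulVec (fun i => x (some i)) i = 0 := by
    rw [bord_mulVec_eq_zero]
    simp only [zero_mul, zero_add, single_dotProduct, one_mul]
    refine and_congr_right fun _ => ⟨fun h => ⟨?_, fun i hi => ?_⟩, fun h i => ?_⟩
    · simpa [zmod2_add_eq_zero] using h b
    · simpa [hi] using h i
    · by_cases hi : i = b
      · subst hi; simp [h.1, zmod2_add_self]
      · simp [hi, h.2 i hi]
  refine Nat.card_congr
    { toFun := fun x => ⟨Function.update (fun i => x.2.1 (some i)) b x.1, ?_⟩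
      invFun := fun x => ⟨x.1 b, fun o => o.elim (M.mulVec (Function.update x.1 b 0) b)
        (Function.update x.1 b 0), ?_⟩
      left_inv := ?_
      right_inv := ?_ }
  · obtain ⟨h1, h2, h3⟩ := (ker _).1 x.2.2
    funext i
    by_cases hi : i = b
    · subst hi; exact keyb _
    · rw [key _ _ hi, Function.update_idem, Function.update_eq_self_iff.2 h1.symm]
      exact h3 i hi
  · rw [ker]
    refine ⟨by simp, rfl, fun i hi => ?_⟩
    have := congrFun x.2 i
    rwa [key _ _ hi] at this
  · rintro ⟨c, x, hx⟩
    obtain ⟨h1, h2, h3⟩ := (ker _).1 hx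
    refine Prod.ext (by simp) (Subtype.ext (funext fun o => ?_))
    have h4 : Function.update (fun i => x (some i)) b 0 = fun i => x (some i) :=
      Function.update_eq_self_iff.2 h1.symm
    cases o with
    | none => simp [h4, h2]
    | some i => simpa using congrFun h4 i
  · intro x
    ext i
    simp

end LinearAlgebra

/-! ### Counting supported symmetric matrices by rank -/

section RankSum

variable {ι κ : Type*}

/-- The symmetric matrices whose entries off the diagonal are supported on `A`. -/
def suppSet (A : ι → ι → Prop) : Set (Matrix ι ι (ZMod 2)) :=
  {M | M.IsSymm ∧ ∀ i j, i ≠ j → ¬ A i j → M i j = 0}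

/-- Those among them with zero row and column at `b`. -/
def suppZero (A : ι → ι → Prop) (b : ι) : Set (Matrix ι ι (ZMod 2)) :=
  {M | M ∈ suppSet A ∧ ∀ j, M b j = 0}

open Classical in
/-- The rank generating function of a set of matrices. -/
noncomputable def rankSum [Fintype ι] (S : Set (Matrix ι ι (ZMod 2))) : ℤ[X] :=
  ∑ M : S, X ^ M.1.rank

theorem rankSum_def [Fintype ι] (S : Set (Matrix ι ι (ZMod 2))) [Fintype S] :
    rankSum S = ∑ M : S, X ^ M.1.rank := by
  rw [rankSum]
  congr!

theorem rankSum_eq_sum [Fintype ι] {α : Type*} [Fintype α] (S : Set (Matrix ι ι (ZMod 2)))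
    (e : α ≃ S) : rankSum S = ∑ x, X ^ (e x).1.rank := by
  classical
  rw [rankSum]
  exact (Fintype.sum_equiv e _ _ fun _ => rfl).symm

theorem rankSum_reindex [Fintype ι] [Fintype κ] (e : ι ≃ κ) (S : Set (Matrix ι ι (ZMod 2)))
    (T : Set (Matrix κ κ (ZMod 2))) (h : ∀ M : Matrix κ κ (ZMod 2), M ∈ T ↔ M.submatrix e e ∈ S) :
    rankSum S = rankSum T := by
  classical
  symm
  rw [rankSum, rankSum]
  refine Fintype.sum_equiv ((Matrix.reindex e.symm e.symm).subtypeEquiv fun M => ?_) _ _ fun M => ?_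
  · rw [h]; rfl
  · simp

/-- One new vertex, joined to `t` and `b`. -/
def extAdj (A : ι → ι → Prop) (t b : ι) : Option ι → Option ι → Prop
  | none, none => False
  | none, some j => j = t ∨ j = b
  | some i, none => i = t ∨ i = b
  | some i, some j => A i j

variable [DecidableEq ι]

/-- A matrix supported on the extended graph is given by three new entries. -/
def suppExtEquiv (A : ι → ι → Prop) (t b : ι) (htb : t ≠ b) :
    ZMod 2 × ZMod 2 × ZMod 2 × suppSet A ≃ suppSet (extAdj A t b) where
  toFun x := ⟨bord x.1 (Pi.single t x.2.1 + Pi.single b x.2.2.1) x.2.2.2.1, by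
    obtain ⟨d, s, q, M, h1, h2⟩ := x
    refine ⟨?_, ?_⟩
    · ext i j
      cases i <;> cases j <;> simp [bord]
      exact h1.apply _ _
    · rintro (_ | i) (_ | j) hij hA
      · exact absurd rfl hij
      · simp only [extAdj, not_or] at hA
        simp [bord, hA.1, hA.2]
      · simp only [extAdj, not_or] at hA
        simp [bord, hA.1, hA.2]
      · exact h2 i j (fun h => hij (congrArg some h)) hA⟩
  invFun M := ⟨M.1 none none, M.1 none (some t), M.1 none (some b),
    fun i j => M.1 (some i) (some j), by
      refine ⟨?_, fun i j hij hA => ?_⟩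
      · ext i j
        exact M.2.1.apply _ _
      · exact M.2.2 _ _ (by simpa using hij) hA⟩
  left_inv := by
    rintro ⟨d, s, q, M⟩
    simp [bord, htb, htb.symm]
  right_inv := by
    rintro ⟨M, h1, h2⟩
    have key (j : ι) : (Pi.single t (M none (some t)) + Pi.single b (M none (some b)) :
        ι → ZMod 2) j = M none (some j) := by
      by_cases ht : j = t
      · subst ht; simp [htb]
      · by_cases hb : j = b
        · subst hb; simp [htb.symm]
        · simp only [Pi.add_apply, Pi.single_eq_of_ne ht, Pi.single_eq_of_ne hb, add_zero]
          exact (h2 _ _ (by simp) (by simp [extAdj, ht, hb])).symm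
    apply Subtype.ext
    ext i j
    rcases i with _ | i <;> rcases j with _ | j
    · rfl
    · exact key j
    · exact (key i).trans (h1.apply _ _)
    · rfl

open Classical in
theorem rankSum_ext [Fintype ι] (A : ι → ι → Prop) (t b : ι) (htb : t ≠ b) :
    rankSum (suppSet (extAdj A t b)) = ∑ d : ZMod 2, ∑ s : ZMod 2, ∑ q : ZMod 2,
      ∑ M : suppSet A, X ^ (bord d (Pi.single t s + Pi.single b q) M.1).rank := by
  rw [rankSum_eq_sum _ (suppExtEquiv A t b htb), Fintype.sum_prod_type]
  refine Finset.sum_congr rfl fun d _ => ?_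
  rw [Fintype.sum_prod_type]
  refine Finset.sum_congr rfl fun s _ => ?_
  rw [Fintype.sum_prod_type]
  rfl

/-- Adding a fixed supported symmetric matrix permutes the supported symmetric matrices. -/
def suppAdd (A : ι → ι → Prop) (N : Matrix ι ι (ZMod 2)) (hN : N ∈ suppSet A) :
    suppSet A ≃ suppSet A where
  toFun M := ⟨M.1 + N, M.2.1.add hN.1, fun i j hij hA => by
    simp [M.2.2 i j hij hA, hN.2 i j hij hA]⟩
  invFun M := ⟨M.1 + N, M.2.1.add hN.1, fun i j hij hA => by
    simp [M.2.2 i j hij hA, hN.2 i j hij hA]⟩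
  left_inv M := by
    apply Subtype.ext; ext i j; simp [add_assoc, zmod2_add_self]
  right_inv M := by
    apply Subtype.ext; ext i j; simp [add_assoc, zmod2_add_self]

-- Translation by `N` permutes the supported matrices, so the correction terms left by pivoting
-- disappear from the sum.
open Classical in
theorem sum_add_rank [Fintype ι] (A : ι → ι → Prop) (N : Matrix ι ι (ZMod 2))
    (hN : N ∈ suppSet A) (c : ℕ) :
    ∑ M : suppSet A, (X : ℤ[X]) ^ ((M.1 + N).rank + c) = X ^ c * rankSum (suppSet A) := by
  rw [rankSum_def, Finset.mul_sum, 
    ← (suppAdd A N hN).sum_comp (fun M => X ^ c * X ^ M.1.rank)]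
  refine Finset.sum_congr rfl fun M _ => ?_
  rw [pow_add, mul_comm]
  rfl

/-- A supported symmetric matrix is given by its row at `b` and the remaining entries. -/
def suppRowEquiv (A : ι → ι → Prop) [DecidableRel A] (hA : ∀ i j, A i j → A j i) (b : ι) :
    ({j : ι // j = b ∨ A b j} → ZMod 2) × suppZero A b ≃ suppSet A where
  toFun x := ⟨fun i j => if i = b then (if h : j = b ∨ A b j then x.1 ⟨j, h⟩ else 0) else
      if j = b then (if h : i = b ∨ A b i then x.1 ⟨i, h⟩ else 0) else x.2.1 i j, by
    obtain ⟨v, M, hM, hM0⟩ := x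
    refine ⟨Matrix.IsSymm.ext fun i j => ?_, fun i j hij h => ?_⟩
    · by_cases hi : i = b
      · by_cases hj : j = b
        · rw [hi, hj]
        · simp [hi, hj]
      · by_cases hj : j = b
        · simp [hi, hj]
        · simpa [hi, hj] using hM.1.apply i j
    · by_cases hi : i = b
      · subst hi
        simp [h, hij.symm]
      · by_cases hj : j = b
        · subst hj
          have : ¬ A j i := fun h' => h (hA _ _ h')
          simp [this, hi]
        · simpa [hi, hj] using hM.2 i j hij h⟩
  invFun M := ⟨fun j => M.1 b j.1, fun i j => if i = b ∨ j = b then 0 else M.1 i j, by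
    refine ⟨⟨Matrix.IsSymm.ext fun i j => ?_, fun i j hij h => ?_⟩, fun j => by simp⟩
    · by_cases hi : i = b
      · simp [hi]
      · by_cases hj : j = b
        · simp [hj]
        · simpa [hi, hj] using M.2.1.apply i j
    · simp only [ite_eq_left_iff]
      exact fun _ => M.2.2 i j hij h⟩
  left_inv := by
    rintro ⟨v, M, hM, hM0⟩
    refine Prod.ext (funext fun j => ?_) (Subtype.ext ?_)
    · simp [j.2]
    · ext i j
      by_cases hi : i = b
      · subst hi; simp [hM0]
      · by_cases hj : j = b
        · subst hj
          simpa [hM0] using hM.1.apply i j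
        · simp [hi, hj]
  right_inv := by
    rintro ⟨M, h1, h2⟩
    have h3 (j : ι) (h : ¬ (j = b ∨ A b j)) : M b j = 0 := by
      rw [not_or] at h
      exact h2 b j (fun h' => h.1 h'.symm) h.2
    apply Subtype.ext
    ext i j
    by_cases hi : i = b
    · subst hi
      by_cases h : j = i ∨ A i j
      · simp [h]
      · simp [h, h3 j h]
    · by_cases hj : j = b
      · subst hj
        by_cases h : A j i
        · simpa [hi, h] using h1.apply i j
        · simpa [hi, h] using (h2 i j hi fun h' => h (hA _ _ h')).symm
      · simp [hi, hj]

-- The map `zeroAt b` forgets the row of `b`, whose free entries sit at `b` and its neighbours, so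
-- all its fibres have the same size.
open Classical in
theorem sum_zeroAt [Fintype ι] (A : ι → ι → Prop) (hA : ∀ i j, A i j → A j i) (b : ι) (c : ℕ) :
    ∑ M : suppSet A, (X : ℤ[X]) ^ ((zeroAt b M.1).rank + c) =
      2 ^ Fintype.card {j : ι // j = b ∨ A b j} * X ^ c * rankSum (suppZero A b) := by
  rw [← (suppRowEquiv A hA b).sum_comp, Fintype.sum_prod_type]
  have (v : {j : ι // j = b ∨ A b j} → ZMod 2) (M : suppZero A b) :
      zeroAt b (suppRowEquiv A hA b (v, M)).1 = M.1 := by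
    have h := congrArg (fun x => x.2.1) ((suppRowEquiv A hA b).symm_apply_apply (v, M))
    exact h
  simp only [this]
  rw [Finset.sum_const, Finset.card_univ, Fintype.card_fun, ZMod.card, rankSum_def]
  simp only [pow_add, ← Finset.sum_mul]
  rw [nsmul_eq_mul]
  push_cast
  rw [mul_assoc, mul_comm (X ^ c)]

/-- Adjacency of `t` and `b` is what keeps the Schur complement inside the support. -/
theorem vecMulVec_mem_suppSet_ext (A : ι → ι → Prop) (t b : ι) (hA : A t b) (hA' : A b t)
    (s q : ZMod 2) : Matrix.vecMulVec (Pi.single t s + Pi.single b q)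
      (Pi.single t s + Pi.single b q) ∈ suppSet A := by
  refine ⟨?_, fun i j hij h => ?_⟩
  · ext i j
    simp only [Matrix.transpose_apply, Matrix.vecMulVec_apply, mul_comm]
  · rw [Matrix.vecMulVec_apply]
    by_cases hi : i = t
    · subst hi
      have hj : j ≠ b := by rintro rfl; exact h hA
      simp [hij.symm, hj]
    · by_cases hb : i = b
      · subst hb
        have hj : j ≠ t := by rintro rfl; exact h hA'
        simp [hij.symm, hj]
      · simp [hi, hb]

open Classical in
/-- Adding two vertices, both joined to `b`, to a graph. -/
theorem rankSum_ext_ext [Fintype ι] (A : ι → ι → Prop) (hsymm : ∀ i j, A i j → A j i)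
    (t b : ι) (htb : t ≠ b) (hA : A t b) :
    rankSum (suppSet (extAdj (extAdj A t b) none (some b))) =
      (1 + 4 * X) * rankSum (suppSet (extAdj A t b)) + 16 * X ^ 2 * rankSum (suppSet A) +
      2 ^ Fintype.card {j : Option ι // j = some b ∨ extAdj A t b (some b) j} * X ^ 2 *
        rankSum (suppZero (extAdj A t b) (some b)) := by
  have hext : ∀ i j, extAdj A t b i j → extAdj A t b j i := by
    rintro (_ | i) (_ | j) h
    · exact h
    · exact h
    · exact h
    · exact hsymm _ _ h
  -- Diagonal entry `1`: the Schur complement only translates `M`, for each of the four pairs `s`,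
  -- `q`.
  have h1 (s q : ZMod 2) : ∑ M : suppSet (extAdj A t b),
      (X : ℤ[X]) ^ (bord 1 (Pi.single none s + Pi.single (some b) q) M.1).rank =
        X * rankSum (suppSet (extAdj A t b)) := by
    have hN := vecMulVec_mem_suppSet_ext (extAdj A t b) none (some b) (Or.inr rfl) (Or.inr rfl) s q
    have h := sum_add_rank _ _ hN 1
    rw [pow_one] at h
    rw [← h]
    exact Finset.sum_congr rfl fun M _ => by rw [rank_bord_one]
  have h2 : ∑ M : suppSet (extAdj A t b),
      (X : ℤ[X]) ^ (bord 0 (Pi.single none 0 + Pi.single (some b) 0) M.1).rank =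
        rankSum (suppSet (extAdj A t b)) := by
    rw [rankSum_def]
    refine Finset.sum_congr rfl fun M _ => ?_
    rw [Pi.single_zero, Pi.single_zero, add_zero, rank_bord_zero]
  -- The pivot eliminates both new vertices. The `8` counts the entries `d, s, p` in the row of the
  -- first one, which survive only in a translation of `M`.
  have h3 (q : ZMod 2) : ∑ M : suppSet (extAdj A t b),
      (X : ℤ[X]) ^ (bord 0 (Pi.single none 1 + Pi.single (some b) q) M.1).rank =
        8 * X ^ 2 * rankSum (suppSet A) := by
    rw [← (suppExtEquiv A t b htb).sum_comp, Fintype.sum_prod_type]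
    simp only [Fintype.sum_prod_type (γ := ℤ[X]) (α₁ := ZMod 2)]
    have (d s p : ZMod 2) : ∑ M : suppSet A, (X : ℤ[X]) ^
        (bord 0 (Pi.single none 1 + Pi.single (some b) q)
          (suppExtEquiv A t b htb (d, s, p, M)).1).rank = X ^ 2 * rankSum (suppSet A) := by
      -- Brings the border vector into the form required by `rank_bord_bord`.
      have hv : (Pi.single none 1 + Pi.single (some b) q : Option ι → ZMod 2) =
          fun o => o.elim 1 (Pi.single b q : ι → ZMod 2) := by
        funext o
        cases o with
        | none => simp
        | some i => simp [Pi.single_apply]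
      -- This matrix has entries only at `(b, b)`, `(b, t)` and `(t, b)`, all allowed because `t`
      -- and `b` are adjacent.
      have hN : d • Matrix.vecMulVec (Pi.single b q) (Pi.single b q) +
          (Matrix.vecMulVec (Pi.single b q) (Pi.single t s + Pi.single b p) +
          Matrix.vecMulVec (Pi.single t s + Pi.single b p) (Pi.single b q)) ∈ suppSet A := by
        refine ⟨?_, fun i j hij h => ?_⟩
        · ext i j
          simp only [Matrix.transpose_apply, Matrix.add_apply, Matrix.smul_apply,
            Matrix.vecMulVec_apply, smul_eq_mul]
          ring
        · simp only [Matrix.add_apply, Matrix.smul_apply,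
            Matrix.vecMulVec_apply, smul_eq_mul]
          by_cases hi : i = b
          · subst hi
            have hj : j ≠ t := by rintro rfl; exact h (hsymm _ _ hA)
            simp [hij.symm, hj]
          · by_cases hj : j = b
            · subst hj
              have hi' : i ≠ t := by rintro rfl; exact h hA
              simp [hij, hi']
            · simp [hi, hj]
      have hr (M : suppSet A) : (bord 0 (Pi.single none 1 + Pi.single (some b) q)
          (suppExtEquiv A t b htb (d, s, p, M)).1).rank =
          (M.1 + (d • Matrix.vecMulVec (Pi.single b q) (Pi.single b q) +
          (Matrix.vecMulVec (Pi.single b q) (Pi.single t s + Pi.single b p) +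
          Matrix.vecMulVec (Pi.single t s + Pi.single b p) (Pi.single b q)))).rank + 2 := by
        rw [hv]
        refine (rank_bord_bord d _ _ M.1).trans ?_
        rw [add_assoc, add_assoc]
      simp only [hr]
      rw [sum_add_rank _ _ hN]
    simp only [this, sum_zmod2]
    ring
  have h4 : ∑ M : suppSet (extAdj A t b),
      (X : ℤ[X]) ^ (bord 0 (Pi.single none 0 + Pi.single (some b) 1) M.1).rank =
      2 ^ Fintype.card {j : Option ι // j = some b ∨ extAdj A t b (some b) j} * X ^ 2 *
        rankSum (suppZero (extAdj A t b) (some b)) := by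
    rw [← sum_zeroAt _ hext]
    refine Finset.sum_congr rfl fun M _ => ?_
    rw [← rank_bord_single, Pi.single_zero, zero_add]
  rw [rankSum_ext _ _ _ (by simp)]
  rw [sum_zmod2, sum_zmod2, sum_zmod2, sum_zmod2, sum_zmod2, sum_zmod2, sum_zmod2]
  rw [h1, h1, h1, h1, h2, h3, h3, h4]
  ring

end RankSum

/-! ### Strip triangulations

A sequence of sides describes a triangulated strip: position `n` is joined to the last position
before `n` on either side. -/

section Strip

/-- The last position before `n` on the side `s`. -/
def lastOn (side : ℕ → Bool) (s : Bool) : ℕ → ℕ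
  -- The default `0` is also the value when no earlier position is on the side `s`.
  | 0 => 0
  | n + 1 => if side n = s then n else lastOn side s n

theorem lastOn_spec {side : ℕ → Bool} {s : Bool} {n : ℕ} (h : ∃ c < n, side c = s) :
    lastOn side s n < n ∧ side (lastOn side s n) = s ∧
      ∀ c, lastOn side s n < c → c < n → side c ≠ s := by
  induction n with
  | zero => simp at h
  | succ n ih =>
    by_cases hn : side n = s
    · simp only [lastOn, hn, if_true]
      exact ⟨by omega, trivial, fun c h1 h2 => by omega⟩
    · obtain ⟨c, hc, hcs⟩ := h
      have hcn : c ≠ n := by rintro rfl; exact hn hcs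
      obtain ⟨h1, h2, h3⟩ := ih ⟨c, by omega, hcs⟩
      simp only [lastOn, hn, if_false]
      refine ⟨by omega, h2, fun c' h4 h5 => ?_⟩
      rcases Nat.lt_succ_iff_lt_or_eq.1 h5 with h6 | rfl
      · exact h3 c' h4 h6
      · exact hn

theorem lastOn_eq {side : ℕ → Bool} {s : Bool} {n f : ℕ} (h1 : f < n) (h2 : side f = s)
    (h3 : ∀ c, f < c → c < n → side c ≠ s) : lastOn side s n = f := by
  obtain ⟨h4, h5, h6⟩ := lastOn_spec ⟨f, h1, h2⟩
  rcases lt_trichotomy (lastOn side s n) f with h | h | h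
  · exact absurd h2 (h6 f h h1)
  · exact h
  · exact absurd h5 (h3 _ h h4)

/-- The first two positions are on the two sides. -/
structure Starts (side : ℕ → Bool) : Prop where
  zero : side 0 = false
  one : side 1 = true

variable {side : ℕ → Bool}

theorem Starts.exists_lt (h : Starts side) (s : Bool) {n : ℕ} (hn : 2 ≤ n) :
    ∃ c < n, side c = s := by
  cases s
  · exact ⟨0, by omega, h.zero⟩
  · exact ⟨1, by omega, h.one⟩

theorem Starts.lastOn_lt (h : Starts side) (s : Bool) {n : ℕ} (hn : 2 ≤ n) :
    lastOn side s n < n := (lastOn_spec (h.exists_lt s hn)).1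

theorem Starts.side_lastOn (h : Starts side) (s : Bool) {n : ℕ} (hn : 2 ≤ n) :
    side (lastOn side s n) = s := (lastOn_spec (h.exists_lt s hn)).2.1

theorem Starts.side_ne (h : Starts side) {s : Bool} {n : ℕ} (hn : 2 ≤ n) {c : ℕ}
    (h1 : lastOn side s n < c) (h2 : c < n) : side c ≠ s :=
  (lastOn_spec (h.exists_lt s hn)).2.2 c h1 h2

/-- Adjacency in the strip. -/
def stripAdj (side : ℕ → Bool) (i j : ℕ) : Prop :=
  (i < j ∧ lastOn side (side i) j = i) ∨ (j < i ∧ lastOn side (side j) i = j)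

theorem stripAdj_symm {i j : ℕ} (h : stripAdj side i j) : stripAdj side j i := Or.symm h

theorem stripAdj_of_lt {i j : ℕ} (h : i < j) :
    stripAdj side i j ↔ lastOn side (side i) j = i := by
  simp [stripAdj, h, not_lt_of_gt h]

theorem stripAdj_iff_forall {i j : ℕ} (h : i < j) :
    stripAdj side i j ↔ ∀ c, i < c → c < j → side c ≠ side i := by
  rw [stripAdj_of_lt h]
  refine ⟨fun h1 => ?_, lastOn_eq h rfl⟩
  have := (lastOn_spec ⟨i, h, rfl⟩ : _ ∧ _ ∧ ∀ c, lastOn side (side i) j < c → _).2.2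
  rwa [h1] at this

theorem stripAdj_last_iff (h : Starts side) {i n : ℕ} (hn : 2 ≤ n) (hi : i < n) (s : Bool) :
    stripAdj side i n ↔ i = lastOn side s n ∨ i = lastOn side (!s) n := by
  rw [stripAdj_of_lt hi]
  constructor
  · intro h1
    by_cases hs : side i = s
    · left; rw [← hs, h1]
    · right; rw [← Bool.eq_not.2 hs, h1]
  · rintro (h1 | h1)
    · have := h.side_lastOn s hn
      rw [← h1] at this
      rw [this, ← h1]
    · have := h.side_lastOn (!s) hn
      rw [← h1] at this
      rw [this, ← h1]

/-- The matrices supported on the strip with `n` positions. -/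
def stripSet (side : ℕ → Bool) (n : ℕ) : Set (Matrix (Fin n) (Fin n) (ZMod 2)) :=
  suppSet fun i j => stripAdj side i j

theorem mem_suppSet_submatrix {ι κ : Type*} (e : ι ≃ κ) {A : ι → ι → Prop} {B : κ → κ → Prop}
    (h : ∀ i j, i ≠ j → (A i j ↔ B (e i) (e j))) (M : Matrix κ κ (ZMod 2)) :
    M ∈ suppSet B ↔ M.submatrix e e ∈ suppSet A := by
  constructor
  · rintro ⟨h1, h2⟩
    refine ⟨h1.submatrix e, fun i j hij hA => ?_⟩
    rw [h i j hij] at hA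
    exact h2 _ _ (by simpa using hij) hA
  · rintro ⟨h1, h2⟩
    refine ⟨Matrix.IsSymm.ext fun i j => ?_, fun i j hij hA => ?_⟩
    · simpa using h1.apply (e.symm i) (e.symm j)
    · simpa using h2 (e.symm i) (e.symm j) (by simpa using hij)
        (by rw [h _ _ (by simpa using hij)]; simpa using hA)

theorem rankSum_suppSet_congr {ι κ : Type*} [Fintype ι] [Fintype κ] (e : ι ≃ κ)
    {A : ι → ι → Prop} {B : κ → κ → Prop} (h : ∀ i j, i ≠ j → (A i j ↔ B (e i) (e j))) :
    rankSum (suppSet A) = rankSum (suppSet B) :=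
  rankSum_reindex e _ _ (mem_suppSet_submatrix e h)

theorem rankSum_suppZero_congr {ι κ : Type*} [Fintype ι] [Fintype κ] (e : ι ≃ κ)
    {A : ι → ι → Prop} {B : κ → κ → Prop} (h : ∀ i j, i ≠ j → (A i j ↔ B (e i) (e j))) (b : ι) :
    rankSum (suppZero A b) = rankSum (suppZero B (e b)) := by
  refine rankSum_reindex e _ _ fun M => ?_
  refine and_congr (mem_suppSet_submatrix e h M) ?_
  exact e.forall_congr_right.symm

/-- The last position is joined to the last earlier one on either side, whatever its own side is. -/
theorem stripSet_last (side' : ℕ → Bool) (n : ℕ) (h : ∀ i < n, side i = side' i) :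
    stripSet side (n + 1) = stripSet side' (n + 1) := by
  have hl (s : Bool) (k : ℕ) (hk : k ≤ n) : lastOn side s k = lastOn side' s k := by
    induction k with
    | zero => rfl
    | succ k ih => rw [lastOn, lastOn, ih (by omega), h k (by omega)]
  have hadj (i j : ℕ) (hi : i < n + 1) (hj : j < n + 1) :
      stripAdj side i j ↔ stripAdj side' i j := by
    refine or_congr (and_congr_right fun hij => ?_) (and_congr_right fun hij => ?_)
    · rw [hl _ _ (by omega), h i (by omega)]
    · rw [hl _ _ (by omega), h j (by omega)]
  unfold stripSet suppSet
  ext M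
  simp only [Set.mem_ofPred_eq, hadj _ _ (Fin.is_lt _) (Fin.is_lt _)]

open Classical in
/-- The recurrence of the rank generating functions of strips. -/
theorem rankSum_stripSet (h : Starts side) {n : ℕ} (hn : 2 ≤ n) (b : Fin (n + 1))
    (hb : b.val = lastOn side (!side n) n) :
    rankSum (stripSet side (n + 2)) = (1 + 4 * X) * rankSum (stripSet side (n + 1)) +
      16 * X ^ 2 * rankSum (stripSet side n) +
      2 ^ Fintype.card {j : Fin (n + 1) // j = b ∨ stripAdj side b j} * X ^ 2 *
        rankSum (suppZero (fun i j : Fin (n + 1) => stripAdj side i j) b) := by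
  set A : Fin n → Fin n → Prop := fun i j => stripAdj side i j with hA
  obtain ⟨b, rfl⟩ : ∃ b' : Fin n, b = b'.castSucc :=
    ⟨⟨b, by rw [hb]; exact h.lastOn_lt _ hn⟩, by ext; rfl⟩
  rw [Fin.val_castSucc] at hb
  let t : Fin n := ⟨lastOn side (side n) n, h.lastOn_lt _ hn⟩
  have hst : side t = side n := h.side_lastOn _ hn
  have hsb : side b = !side n := by rw [hb]; exact h.side_lastOn _ hn
  have htb : t ≠ b := by
    intro h'
    rw [← h', hst] at hsb
    simp at hsb
  -- Both are last on their sides before `n`, so nothing between them is on the side of the earlier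
  -- one.
  have hadj : A t b := by
    rcases lt_or_gt_of_ne (fun h' => htb (Fin.ext h') : t.val ≠ b.val) with h1 | h1
    · refine (stripAdj_iff_forall h1).2 fun c hc hc' => ?_
      rw [hst]
      exact h.side_ne hn hc (hc'.trans b.2)
    · refine stripAdj_symm ((stripAdj_iff_forall h1).2 fun c hc hc' => ?_)
      rw [hsb]
      exact h.side_ne hn (hb ▸ hc) (hc'.trans t.2)
  have hlast (i : Fin n) : stripAdj side i n ↔ i = t ∨ i = b := by
    rw [stripAdj_last_iff h hn i.2 (side n), ← hb, Fin.ext_iff, Fin.ext_iff]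
  have h1 : ∀ i j, i ≠ j → (extAdj A t b i j ↔
      stripAdj side (finSuccEquivLast.symm i : Fin (n + 1)) (finSuccEquivLast.symm j : Fin (n + 1))) := by
    rintro (_ | i) (_ | j) hij
    · exact absurd rfl hij
    · simp only [extAdj, finSuccEquivLast_symm_none, finSuccEquivLast_symm_some, Fin.val_last,
        Fin.val_castSucc]
      rw [← hlast]
      exact ⟨stripAdj_symm, stripAdj_symm⟩
    · simp only [extAdj, finSuccEquivLast_symm_none, finSuccEquivLast_symm_some, Fin.val_last,
        Fin.val_castSucc]
      rw [hlast]
    · simp [extAdj, finSuccEquivLast_symm_some, hA]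
  -- Position `n` is now the last on its own side, and `b` is still the last on the other.
  have hlast' (i : Option (Fin n)) : stripAdj side (finSuccEquivLast.symm i : Fin (n + 1)) (n + 1) ↔
      i = none ∨ i = some b := by
    rw [stripAdj_last_iff h (by omega) (Fin.is_lt _) (side n)]
    have e1 : lastOn side (side n) (n + 1) = n := by simp [lastOn]
    have e2 : lastOn side (!side n) (n + 1) = b := by simp [lastOn, hb]
    rw [e1, e2]
    cases i with
    | none => simp [finSuccEquivLast_symm_none, b.2.ne']
    | some i => simp [finSuccEquivLast_symm_some, i.2.ne, Fin.ext_iff]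
  have h2 : ∀ i j, i ≠ j → (extAdj (extAdj A t b) none (some b) i j ↔
      stripAdj side
        (finSuccEquivLast.symm (finSuccEquivLast.symm.optionCongr i) : Fin (n + 2))
        (finSuccEquivLast.symm (finSuccEquivLast.symm.optionCongr j) : Fin (n + 2))) := by
    rintro (_ | i) (_ | j) hij
    · exact absurd rfl hij
    · simp only [extAdj, Equiv.optionCongr_apply, Option.map_none, Option.map_some,
        finSuccEquivLast_symm_none, finSuccEquivLast_symm_some, Fin.val_last, Fin.val_castSucc]
      rw [← hlast']
      exact ⟨stripAdj_symm, stripAdj_symm⟩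
    · simp only [extAdj, Equiv.optionCongr_apply, Option.map_none, Option.map_some,
        finSuccEquivLast_symm_none, finSuccEquivLast_symm_some, Fin.val_last, Fin.val_castSucc]
      rw [hlast']
    · simp only [extAdj, Equiv.optionCongr_apply, Option.map_some,
        finSuccEquivLast_symm_some, Fin.val_castSucc]
      exact h1 i j fun h' => hij (congrArg some h')
  have key := rankSum_ext_ext A (fun i j => stripAdj_symm) t b htb hadj
  have e0 := rankSum_suppSet_congr (B := fun i j : Fin (n + 1) => stripAdj side i j)
    finSuccEquivLast.symm h1
  have e1 := rankSum_suppSet_congr (B := fun i j : Fin (n + 2) => stripAdj side i j)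
    (finSuccEquivLast.symm.optionCongr.trans finSuccEquivLast.symm) h2
  have e2 := rankSum_suppZero_congr (B := fun i j : Fin (n + 1) => stripAdj side i j)
    finSuccEquivLast.symm h1 (some b)
  have e3 : Fintype.card {j : Option (Fin n) // j = some b ∨ extAdj A t b (some b) j} =
      Fintype.card {j : Fin (n + 1) // j = b.castSucc ∨ stripAdj side b.castSucc j} := by
    refine Fintype.card_congr (finSuccEquivLast.symm.subtypeEquiv fun j => ?_)
    by_cases hj : j = some b
    · subst hj; simp
    · have hj' : finSuccEquivLast.symm j ≠ b.castSucc := by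
        rw [← finSuccEquivLast_symm_some]
        exact fun h' => hj (finSuccEquivLast.symm.injective h')
      simp only [hj, hj', false_or]
      rw [h1 _ _ (Ne.symm hj), finSuccEquivLast_symm_some]
  rw [finSuccEquivLast_symm_some] at e2
  rw [e0, e1, e2, e3] at key
  exact key

end Strip

/-! ### Rotation systems of cubic graphs -/

section Cubic

/-- The clockwise or counterclockwise step around a vertex of degree three. -/
def turnStep (x : ZMod 2) : ZMod 3 := if x = 0 then 1 else 2

/-- The position, relative to a dart, of the dart opposite to the corner on a given side. -/
def flank (x : ZMod 2) : ZMod 3 := if x = 0 then 2 else 1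

/-- A description of a cubic graph: the darts at a vertex are numbered by `ZMod 3`, the edges are
indexed by `E` and the two ends of an edge are numbered by `ZMod 2`. -/
structure CubicModel {V : Type*} (G : SimpleGraph V) (E : Type*) where
  slot : V × ZMod 3 ≃ E × ZMod 2
  adj_iff : ∀ v w, G.Adj v w ↔ ∃ i, (slot.symm ((slot (v, i)).1, (slot (v, i)).2 + 1)).1 = w
  simple : ∀ v i j, (slot.symm ((slot (v, i)).1, (slot (v, i)).2 + 1)).1 =
    (slot.symm ((slot (v, j)).1, (slot (v, j)).2 + 1)).1 → i = j

theorem rotationSystem_ext {V : Type*} {G : SimpleGraph V} {R S : RotationSystem G}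
    (h1 : R.rot = S.rot) (h2 : R.twist = S.twist) : R = S := by
  obtain ⟨⟨_, _, _⟩, _⟩ := R
  obtain ⟨⟨_, _, _⟩, _⟩ := S
  simp only at h1 h2
  subst h1 h2
  rfl

namespace CubicModel

variable {V : Type*} {G : SimpleGraph V} {E : Type*} (C : CubicModel G E)

/-- The other end of an edge. -/
def opp (p : V × ZMod 3) : V × ZMod 3 := C.slot.symm ((C.slot p).1, (C.slot p).2 + 1)

theorem slot_opp (p : V × ZMod 3) : C.slot (C.opp p) = ((C.slot p).1, (C.slot p).2 + 1) := by
  simp [opp]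

theorem opp_opp (p : V × ZMod 3) : C.opp (C.opp p) = p := by
  apply C.slot.injective
  rw [slot_opp, slot_opp, add_assoc, zmod2_add_self, add_zero]

/-- The dart with a given number. -/
def dart (p : V × ZMod 3) : G.Dart := ⟨(p.1, (C.opp p).1), (C.adj_iff _ _).2 ⟨p.2, rfl⟩⟩

theorem dart_bijective : Function.Bijective C.dart := by
  constructor
  · rintro ⟨v, i⟩ ⟨w, j⟩ h
    have h1 : v = w := congrArg (fun d : G.Dart => d.fst) h
    subst h1
    have h2 := congrArg (fun d : G.Dart => d.snd) h
    rw [C.simple v i j h2]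
  · rintro ⟨⟨v, w⟩, h⟩
    obtain ⟨i, hi⟩ := (C.adj_iff v w).1 h
    refine ⟨(v, i), ?_⟩
    ext
    · rfl
    · exact hi

/-- The numbering of the darts. -/
noncomputable def dartEquiv : V × ZMod 3 ≃ G.Dart := Equiv.ofBijective _ C.dart_bijective

theorem dart_symm (p : V × ZMod 3) : (C.dart p).symm = C.dart (C.opp p) := by
  ext
  · rfl
  · exact (congrArg Prod.fst (C.opp_opp p)).symm

/-- The edge with a given index. -/
def edge (e : E) : G.edgeSet :=
  ⟨(C.dart (C.slot.symm (e, 0))).edge, (C.dart _).edge_mem⟩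

theorem edge_slot (p : V × ZMod 3) :
    C.edge (C.slot p).1 = ⟨(C.dart p).edge, (C.dart p).edge_mem⟩ := by
  apply Subtype.ext
  change (C.dart _).edge = _
  rcases zmod2_cases (C.slot p).2 with h | h
  · rw [← h, Prod.mk.eta, Equiv.symm_apply_apply]
  · have : C.slot.symm ((C.slot p).1, 0) = C.opp p := by
      rw [opp, h]; rfl
    rw [this, ← dart_symm, SimpleGraph.Dart.edge_symm]

theorem edge_bijective : Function.Bijective C.edge := by
  constructor
  · intro e e' h
    have h1 := congrArg Subtype.val h
    change (C.dart _).edge = (C.dart _).edge at h1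
    rw [SimpleGraph.dart_edge_eq_iff, dart_symm] at h1
    rcases h1 with h1 | h1
    · have := C.slot.symm.injective (C.dart_bijective.1 h1)
      exact congrArg Prod.fst this
    · have := congrArg (fun p => (C.slot p).1) (C.dart_bijective.1 h1)
      simpa [slot_opp] using this
  · rintro ⟨e, he⟩
    induction e using Sym2.ind with
    | _ v w =>
      obtain ⟨p, hp⟩ := C.dart_bijective.2 ⟨(v, w), he⟩
      refine ⟨(C.slot p).1, ?_⟩
      rw [edge_slot]
      apply Subtype.ext
      simp only [hp]
      rfl

/-- The indexing of the edges. -/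
noncomputable def edgeEquiv : E ≃ G.edgeSet := Equiv.ofBijective _ C.edge_bijective

/-- A cyclic permutation of three darts is a nonzero translation of `ZMod 3`. For three elements it
is enough that no dart is fixed, which the single cycle guarantees. -/
theorem exists_turn (R : RotationSystem G) :
    ∃ r : V → ZMod 2, ∀ p, R.rot (C.dart p) = C.dart (p.1, p.2 + turnStep (r p.1)) := by
  have key : ∀ f : ZMod 3 → ZMod 3, Function.Injective f → (∀ i, f i ≠ i) →
      ∃ r : ZMod 2, ∀ i, f i = i + turnStep r := by
    decide
  have h (v : V) : ∃ r : ZMod 2, ∀ i, R.rot (C.dart (v, i)) = C.dart (v, i + turnStep r) := by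
    have h1 (i : ZMod 3) : ∃ j, R.rot (C.dart (v, i)) = C.dart (v, j) := by
      obtain ⟨⟨w, j⟩, hj⟩ := C.dart_bijective.2 (R.rot (C.dart (v, i)))
      have : w = v := by
        have h2 := R.fst_rot (C.dart (v, i))
        rw [← hj] at h2
        exact h2
      subst this
      exact ⟨j, hj.symm⟩
    choose f hf using h1
    obtain ⟨r, hr⟩ := key f
      (fun i j hij => by
        have := (hf i).trans ((congrArg (fun j => C.dart (v, j)) hij).trans (hf j).symm)
        have := C.dart_bijective.1 (R.rot.injective this)
        exact congrArg Prod.snd this)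
      (fun i hi => by
        obtain ⟨n, hn⟩ := R.sameCycle (C.dart (v, i)) (C.dart (v, i + 1)) rfl
        have hfix : R.rot (C.dart (v, i)) = C.dart (v, i) := by rw [hf, hi]
        rw [Equiv.Perm.zpow_apply_eq_self_of_apply_eq_self hfix] at hn
        have := congrArg Prod.snd (C.dart_bijective.1 hn)
        simp at this)
    exact ⟨r, fun i => by rw [hf, hr]⟩
  choose r hr using h
  exact ⟨r, fun p => hr p.1 p.2⟩

/-- The orientations of the rotations at the vertices. -/
noncomputable def turn (R : RotationSystem G) : V → ZMod 2 := (C.exists_turn R).choose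

theorem rot_dart (R : RotationSystem G) (p : V × ZMod 3) :
    R.rot (C.dart p) = C.dart (p.1, p.2 + turnStep (C.turn R p.1)) :=
  (C.exists_turn R).choose_spec p

/-- The labels of the edges. -/
def label (R : RotationSystem G) (e : E) : ZMod 2 := R.twist (C.edge e)

theorem dartTwist_dart (R : RotationSystem G) (p : V × ZMod 3) :
    R.dartTwist (C.dart p) = C.label R (C.slot p).1 := by
  rw [label, edge_slot]
  rfl

/-- The permutation of the numbers of the darts for given orientations. -/
def turnPerm (r : V → ZMod 2) : Equiv.Perm (V × ZMod 3) where
  toFun p := (p.1, p.2 + turnStep (r p.1))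
  invFun p := (p.1, p.2 - turnStep (r p.1))
  left_inv p := by simp
  right_inv p := by simp

theorem turnPerm_pow (r : V → ZMod 2) (p : V × ZMod 3) (n : ℕ) :
    (turnPerm r ^ n) p = (p.1, p.2 + n * turnStep (r p.1)) := by
  induction n with
  | zero => simp
  | succ n ih =>
    rw [pow_succ', Equiv.Perm.mul_apply, ih]
    simp only [turnPerm, Equiv.coe_fn_mk]
    push_cast
    ring_nf

/-- The rotation system with given orientations and labels. -/
noncomputable def ofTurn (r : V → ZMod 2) (t : E → ZMod 2) : RotationSystem G where
  rot := C.dartEquiv.permCongr (turnPerm r)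
  fst_rot d := by
    obtain ⟨p, rfl⟩ := C.dartEquiv.surjective d
    simp only [Equiv.permCongr_apply, Equiv.symm_apply_apply]
    rfl
  sameCycle d d' h := by
    obtain ⟨⟨v, i⟩, rfl⟩ := C.dartEquiv.surjective d
    obtain ⟨⟨w, j⟩, rfl⟩ := C.dartEquiv.surjective d'
    obtain rfl : v = w := h
    have key : ∀ (r : ZMod 2) (i j : ZMod 3), ∃ n < 3, j = i + (n : ℕ) * turnStep r := by decide
    obtain ⟨n, -, hn⟩ := key (r v) i j
    refine ⟨(n : ℤ), ?_⟩
    have h2 : (C.dartEquiv.permCongr (turnPerm r)) ^ n =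
        C.dartEquiv.permCongr (turnPerm r ^ n) := by
      rw [← Equiv.permCongrHom_coe, map_pow]
    rw [zpow_natCast, h2, Equiv.permCongr_apply, Equiv.symm_apply_apply, turnPerm_pow, hn]
  twist e := t (C.edgeEquiv.symm e)

/-- The rotation systems of a cubic graph. -/
noncomputable def rotationEquiv :
    RotationSystem G ≃ (V → ZMod 2) × (E → ZMod 2) where
  toFun R := (C.turn R, C.label R)
  invFun x := C.ofTurn x.1 x.2
  left_inv R := by
    have h1 : (C.ofTurn (C.turn R) (C.label R)).rot = R.rot := by
      ext1 d
      obtain ⟨p, rfl⟩ := C.dartEquiv.surjective d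
      simp only [ofTurn, Equiv.permCongr_apply, Equiv.symm_apply_apply]
      exact (C.rot_dart R p).symm
    have h2 : (C.ofTurn (C.turn R) (C.label R)).twist = R.twist := by
      funext e
      obtain ⟨e, rfl⟩ := C.edgeEquiv.surjective e
      simp only [ofTurn, Equiv.symm_apply_apply]
      rfl
    exact rotationSystem_ext h1 h2
  right_inv := by
    rintro ⟨r, t⟩
    refine Prod.ext (funext fun v => ?_) (funext fun e => ?_)
    · have h1 := C.rot_dart (C.ofTurn r t) (v, 0)
      have h2 : (C.ofTurn r t).rot (C.dart (v, 0)) = C.dart (v, 0 + turnStep (r v)) := by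
        change C.dartEquiv.permCongr (turnPerm r) (C.dartEquiv (v, 0)) = _
        rw [Equiv.permCongr_apply, Equiv.symm_apply_apply]
        rfl
      rw [h2] at h1
      have h3 := congrArg Prod.snd (C.dart_bijective.1 h1)
      simp only [zero_add] at h3
      have key : ∀ x y : ZMod 2, turnStep x = turnStep y → y = x := by decide
      exact key _ _ h3
    · change t (C.edgeEquiv.symm (C.edgeEquiv e)) = t e
      rw [Equiv.symm_apply_apply]

/-- A function on the corners (numbered by the opposite darts) which is constant on faces, where
`τ` tells which edges are twisted once all rotations are turned to the standard one. -/
def CornerInvariant (τ : V × ZMod 3 → ZMod 2) (k : V × ZMod 3 → ZMod 2) : Prop :=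
  ∀ p s, k (p.1, p.2 + flank s) = k ((C.opp p).1, (C.opp p).2 + flank (s + τ p))

/-- The twist of an edge relative to the standard rotations at its ends. -/
noncomputable def relTwist (R : RotationSystem G) (p : V × ZMod 3) : ZMod 2 :=
  -- The summand `1`: an untwisted edge between equally turned vertices exchanges the sides `0` and
  -- `1`.
  1 + C.label R (C.slot p).1 + C.turn R p.1 + C.turn R (C.opp p).1

/-- Functions on the set of faces. -/
def faceFunEquiv (R : RotationSystem G) : (R.Face → ZMod 2) ≃
    {f : G.Dart × ZMod 2 → ZMod 2 // ∀ x y, R.FaceStep x y → f x = f y} where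
  toFun f := ⟨fun x => f (Quot.mk _ x), fun _ _ h => congrArg f (Quot.sound h)⟩
  invFun f := Quot.lift f.1 f.2
  left_inv f := by
    funext x
    induction x using Quot.ind
    rfl
  right_inv _ := rfl

/-- Functions on the set of faces as functions on corners. -/
noncomputable def faceFunCornerEquiv (R : RotationSystem G) :
    {f : G.Dart × ZMod 2 → ZMod 2 // ∀ x y, R.FaceStep x y → f x = f y} ≃
      {k : V × ZMod 3 → ZMod 2 // C.CornerInvariant (C.relTwist R) k} where
  -- The corner opposite to `p` lies between the darts `p.2 + 1` and `p.2 + 2`. Seen from the former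
  -- it is on side `0` for the standard rotation and on side `1` for the reversed one, so the side
  -- equals `turn`.
  toFun f := ⟨fun p => f.1 (C.dart (p.1, p.2 + 1), C.turn R p.1), by
    obtain ⟨f, hf⟩ := f
    have hc (v : V) (i : ZMod 3) :
        f (C.dart (v, i), 0) = f (C.dart (v, i + turnStep (C.turn R v)), 1) := by
      have := hf _ _ (RotationSystem.FaceStep.corner (C.dart (v, i)))
      rwa [rot_dart] at this
    have key (p : V × ZMod 3) (s : ZMod 2) :
        f (C.dart (p.1, p.2 + flank s + 1), C.turn R p.1) = f (C.dart p, s + C.turn R p.1) := by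
      obtain ⟨v, i⟩ := p
      have h0 := hc v i
      have h2 := hc v (i + 2)
      have e1 : i + 2 + 1 = i := by rw [add_assoc]; exact add_zero i
      have e2 : i + 1 + 1 = i + 2 := by rw [add_assoc]; rfl
      rcases zmod2_cases s with rfl | rfl <;> rcases zmod2_cases (C.turn R v) with h | h <;>
        simp only [h, flank, turnStep, if_true, one_ne_zero, if_false, e1, e2, add_zero, zero_add]
          at *
      · exact h2
      · exact h0.symm
    intro p s
    simp only [key]
    rw [hf _ _ (RotationSystem.FaceStep.edge _ _), dart_symm, dartTwist_dart, relTwist]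
    congr 2
    generalize C.turn R p.1 = a
    generalize C.turn R (C.opp p).1 = b
    generalize C.label R (C.slot p).1 = c
    revert s a b c
    decide⟩
  invFun k := ⟨fun x => k.1 ((C.dartEquiv.symm x.1).1,
      (C.dartEquiv.symm x.1).2 + flank (x.2 + C.turn R (C.dartEquiv.symm x.1).1)), by
    obtain ⟨k, hk⟩ := k
    have hd (p) : C.dartEquiv.symm (C.dart p) = p := C.dartEquiv.symm_apply_apply p
    rintro x y (⟨d, s⟩ | d)
    · obtain ⟨p, rfl⟩ := C.dart_bijective.2 d
      simp only [dart_symm, dartTwist_dart, hd]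
      rw [hk]
      congr 3
      rw [relTwist]
      generalize C.turn R p.1 = a
      generalize C.turn R (C.opp p).1 = b
      generalize C.label R (C.slot p).1 = c
      revert s a b c
      decide
    · obtain ⟨⟨v, i⟩, rfl⟩ := C.dart_bijective.2 d
      simp only [rot_dart, hd]
      generalize C.turn R v = a
      have : ∀ (i : ZMod 3) (a : ZMod 2), i + flank (0 + a) = i + turnStep a + flank (1 + a) := by
        decide
      rw [this]⟩
  left_inv f := by
    obtain ⟨f, hf⟩ := f
    have hc (v : V) (i : ZMod 3) :
        f (C.dart (v, i), 0) = f (C.dart (v, i + turnStep (C.turn R v)), 1) := by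
      have := hf _ _ (RotationSystem.FaceStep.corner (C.dart (v, i)))
      rwa [rot_dart] at this
    apply Subtype.ext
    funext ⟨d, s⟩
    obtain ⟨⟨v, i⟩, rfl⟩ := C.dart_bijective.2 d
    have hd (p) : C.dartEquiv.symm (C.dart p) = p := C.dartEquiv.symm_apply_apply p
    simp only [hd]
    have h0 := hc v i
    have h2 := hc v (i + 2)
    have e1 : i + 2 + 1 = i := by rw [add_assoc]; exact add_zero i
    have e2 : i + 1 + 1 = i + 2 := by rw [add_assoc]; rfl
    rcases zmod2_cases s with rfl | rfl <;> rcases zmod2_cases (C.turn R v) with h | h <;>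
      simp only [h, flank, turnStep, if_true, one_ne_zero, if_false, e1, e2, add_zero, zero_add,
        zmod2_add_self] at *
    · exact h0.symm
    · exact h2
  right_inv k := by
    apply Subtype.ext
    funext ⟨v, i⟩
    have hd (p) : C.dartEquiv.symm (C.dart p) = p := C.dartEquiv.symm_apply_apply p
    simp only [hd, zmod2_add_self]
    have : ∀ i : ZMod 3, i + 1 + flank 0 = i := by decide
    rw [this]

/-- Counting `ZMod 2`-valued functions on the faces turns the number of faces into a problem of
linear algebra. -/
theorem two_pow_card_face [Finite V] (R : RotationSystem G) :
    2 ^ Nat.card R.Face =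
      Nat.card {k : V × ZMod 3 → ZMod 2 // C.CornerInvariant (C.relTwist R) k} := by
  have : Finite G.Dart := Finite.of_equiv _ C.dartEquiv
  have : Finite R.Face := by unfold RotationSystem.Face; infer_instance
  rw [← Nat.card_congr ((faceFunEquiv R).trans (C.faceFunCornerEquiv R)), Nat.card_fun,
    Nat.card_zmod]

end CubicModel

end Cubic

/-! ### Plane cubic graphs with a spanning tree -/

section PlaneTree

/-- The values of a function on the bounded faces, extended by zero to the unbounded face. -/
def extFace {F : Type*} (a : F → ZMod 2) (o : Option F) : ZMod 2 := o.elim 0 a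

/-- The two faces at an edge. A co-tree edge is indexed by the bounded face next to it. -/
def edgeFace {T F : Type*} (sides : T → F × F) : T ⊕ F → ZMod 2 → Option F
  | .inl t, s => some (if s = 0 then (sides t).1 else (sides t).2)
  | .inr f, s => if s = 0 then some f else none

/-- The data of a plane drawing of a cubic graph in which every co-tree edge is on the boundary of
the unbounded face and of one bounded face. -/
structure PlaneTree {V : Type*} {G : SimpleGraph V} {T F : Type*} (C : CubicModel G (T ⊕ F)) where
  corner : V × ZMod 3 → Option F
  sides : T → F × F
  corner_flank : ∀ p, ∃ o, ∀ s,
    corner (p.1, p.2 + flank s) = edgeFace sides (C.slot p).1 (s + o)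
  root : V
  integrate : ∀ (c₀ : ZMod 2) (y : T → ZMod 2), ∃! c : V → ZMod 2, c root = c₀ ∧
    ∀ t, c (C.slot.symm (.inl t, 0)).1 + c (C.slot.symm (.inl t, 1)).1 = y t

/-! ### Coboundaries and their orthogonality to even edge sets -/

namespace CubicModel

variable {V : Type*} {G : SimpleGraph V} {E : Type*} (C : CubicModel G E)

/-- The coboundary of a function on the vertices. -/
def cobound (c : V → ZMod 2) (e : E) : ZMod 2 :=
  c (C.slot.symm (e, 0)).1 + c (C.slot.symm (e, 1)).1

theorem cobound_slot (c : V → ZMod 2) (p : V × ZMod 3) :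
    C.cobound c (C.slot p).1 = c p.1 + c (C.opp p).1 := by
  rcases zmod2_cases (C.slot p).2 with h | h
  · have e1 : C.slot.symm ((C.slot p).1, 0) = p := by
      rw [← h, Prod.mk.eta, Equiv.symm_apply_apply]
    have e2 : C.slot.symm ((C.slot p).1, 1) = C.opp p := by
      rw [opp, h]; rfl
    rw [cobound, e1, e2]
  · have e1 : C.slot.symm ((C.slot p).1, 1) = p := by
      rw [← h, Prod.mk.eta, Equiv.symm_apply_apply]
    have e2 : C.slot.symm ((C.slot p).1, 0) = C.opp p := by
      rw [opp, h]; rfl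
    rw [cobound, e1, e2, add_comm]

/-- Summation by parts: regrouped by vertices, `c v` is multiplied by the degree of `x` at `v`,
which is even. -/
theorem sum_mul_cobound [Fintype V] [Fintype E] (x : E → ZMod 2)
    (hx : ∀ v, ∑ i, x (C.slot (v, i)).1 = 0) (c : V → ZMod 2) :
    ∑ e, x e * C.cobound c e = 0 := by
  have h1 : ∑ e, x e * C.cobound c e = ∑ q : E × ZMod 2, x q.1 * c (C.slot.symm q).1 := by
    rw [Fintype.sum_prod_type]
    refine Finset.sum_congr rfl fun e _ => ?_
    rw [sum_zmod2, cobound, mul_add]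
  rw [h1, ← C.slot.sum_comp, Fintype.sum_prod_type]
  refine Finset.sum_eq_zero fun v _ => ?_
  simp only [Equiv.symm_apply_apply]
  rw [← Finset.sum_mul, hx, zero_mul]

end CubicModel

/-! ### Faces of an embedding and the kernel of the intersection matrix -/

namespace PlaneTree

variable {V : Type*} {G : SimpleGraph V} {T F : Type*} {C : CubicModel G (T ⊕ F)}
  (D : PlaneTree C)

/-- The order of the faces at an edge, seen from one of its ends. -/
noncomputable def off (p : V × ZMod 3) : ZMod 2 := (D.corner_flank p).choose

theorem corner_eq (p : V × ZMod 3) (s : ZMod 2) :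
    D.corner (p.1, p.2 + flank (s + D.off p)) = edgeFace D.sides (C.slot p).1 s := by
  rw [(D.corner_flank p).choose_spec]
  change edgeFace _ _ (s + D.off p + D.off p) = _
  rw [add_assoc, zmod2_add_self, add_zero]

/-- The difference of the values on the two sides of an edge. -/
def jump (a : F → ZMod 2) (e : T ⊕ F) : ZMod 2 :=
  extFace a (edgeFace D.sides e 0) + extFace a (edgeFace D.sides e 1)

theorem jump_inl (a : F → ZMod 2) (t : T) :
    D.jump a (.inl t) = a (D.sides t).1 + a (D.sides t).2 := by
  simp [jump, edgeFace, extFace]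

theorem jump_inr (a : F → ZMod 2) (f : F) : D.jump a (.inr f) = a f := by
  simp [jump, edgeFace, extFace]

theorem flank_sum (h : ZMod 3 → ZMod 2) (o : ZMod 2) :
    h (flank (0 + o)) + h (flank (1 + o)) = h 1 + h 2 := by
  rcases zmod2_cases o with rfl | rfl
  · exact add_comm _ _
  · rfl

theorem jump_slot (a : F → ZMod 2) (p : V × ZMod 3) :
    D.jump a (C.slot p).1 =
      extFace a (D.corner (p.1, p.2 + 1)) + extFace a (D.corner (p.1, p.2 + 2)) := by
  rw [jump, ← D.corner_eq, ← D.corner_eq]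
  exact flank_sum (fun i => extFace a (D.corner (p.1, p.2 + i))) _

theorem sum_rotate (h : ZMod 3 → ZMod 2) : ∑ i, (h (i + 1) + h (i + 2)) = 0 := by
  have : ∑ i, (h (i + 1) + h (i + 2)) = (h 1 + h 2) + (h 2 + h 0) + (h 0 + h 1) :=
    Fin.sum_univ_three _
  rw [this]
  generalize h 0 = x
  generalize h 1 = y
  generalize h 2 = z
  revert x y z
  decide

/-- Around a vertex every corner is counted twice. -/
theorem jump_even (a : F → ZMod 2) (v : V) : ∑ i, D.jump a (C.slot (v, i)).1 = 0 := by
  simp only [jump_slot]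
  exact sum_rotate fun i => extFace a (D.corner (v, i))

/-- An even set of tree edges is empty. -/
theorem eq_zero_of_even (D : PlaneTree C) [Fintype V] [Fintype T] [Fintype F] (x : T ⊕ F → ZMod 2)
    (hx : ∀ v, ∑ i, x (C.slot (v, i)).1 = 0) (h0 : ∀ f, x (.inr f) = 0) (e : T ⊕ F) : x e = 0 := by
  classical
  rcases e with t | f
  -- A vertex function whose coboundary on the tree is the single edge `t` detects the value of `x`
  -- at `t`.
  · obtain ⟨c, ⟨-, hc⟩, -⟩ := D.integrate 0 (Pi.single t 1)
    have h1 := C.sum_mul_cobound x hx c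
    rw [Fintype.sum_sum_type] at h1
    simp only [h0, zero_mul, Finset.sum_const_zero, add_zero] at h1
    have h2 (t' : T) : C.cobound c (.inl t') = (Pi.single t 1 : T → ZMod 2) t' := hc t'
    simpa [h2, Pi.single_apply] using h1
  · exact h0 f

/-- Potentials on faces and vertices. -/
def Potential (θ : T ⊕ F → ZMod 2) (x : (F → ZMod 2) × (V → ZMod 2)) : Prop :=
  ∀ e, C.cobound x.2 e = θ e * D.jump x.1 e

/-- An invariant corner function has the same difference across an edge at both of its ends, and
these differences form an even edge set. By `eq_zero_of_even` this set is the jump of its own values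
`a` on the co-tree edges. After subtracting `a`, the function is constant around each vertex, and
invariance across an edge becomes the equation of a potential. -/
theorem card_cornerInvariant [Fintype V] [Fintype T] [Fintype F] (τ : V × ZMod 3 → ZMod 2)
    (θ : T ⊕ F → ZMod 2) (hθ : ∀ p, τ p = θ (C.slot p).1 + D.off p + D.off (C.opp p)) :
    Nat.card {k // C.CornerInvariant τ k} = Nat.card {x // D.Potential θ x} := by
  have hinv (k : V × ZMod 3 → ZMod 2) : C.CornerInvariant τ k ↔
      ∀ p s, k (p.1, p.2 + flank (s + D.off p)) =
        k ((C.opp p).1, (C.opp p).2 + flank (s + θ (C.slot p).1 + D.off (C.opp p))) := by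
    have key : ∀ s a b c : ZMod 2, s + a + (c + a + b) = s + c + b := by decide
    have key' : ∀ s a b c : ZMod 2, s + a + c + b = s + (c + a + b) := by decide
    refine forall_congr' fun p => ⟨fun h s => ?_, fun h s => ?_⟩
    · rw [h, hθ, key]
    · have := h (s + D.off p)
      rw [add_assoc s, zmod2_add_self, add_zero] at this
      rw [this, hθ, key']
  have hedge (a : F → ZMod 2) (e : T ⊕ F) (x y z : ZMod 2) :
      (∀ s, extFace a (edgeFace D.sides e s) + x = extFace a (edgeFace D.sides e (s + z)) + y) ↔
        x + y = z * D.jump a e := by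
    rw [jump]
    generalize hh : (fun s => extFace a (edgeFace D.sides e s)) = h
    have hh' (s) : extFace a (edgeFace D.sides e s) = h s := congrFun hh s
    simp only [hh']
    clear hh hh'
    revert h x y z
    decide
  have hpot (k : V × ZMod 3 → ZMod 2) (a : F → ZMod 2) (c : V → ZMod 2)
      (hk : ∀ p, k p = extFace a (D.corner p) + c p.1) :
      C.CornerInvariant τ k ↔ D.Potential θ (a, c) := by
    rw [hinv]
    have h1 (p : V × ZMod 3) : (∀ s, k (p.1, p.2 + flank (s + D.off p)) =
        k ((C.opp p).1, (C.opp p).2 + flank (s + θ (C.slot p).1 + D.off (C.opp p)))) ↔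
        C.cobound c (C.slot p).1 = θ (C.slot p).1 * D.jump a (C.slot p).1 := by
      rw [C.cobound_slot, ← hedge]
      simp only [hk, corner_eq, C.slot_opp]
    simp only [h1, Potential]
    refine ⟨fun h e => ?_, fun h p => h _⟩
    simpa using h (C.slot.symm (e, 0))
  symm
  refine Nat.card_eq_of_bijective (fun x : {x // D.Potential θ x} =>
    (⟨fun p => extFace x.1.1 (D.corner p) + x.1.2 p.1, (hpot _ _ _ fun _ => rfl).2 x.2⟩ :
      {k // C.CornerInvariant τ k})) ⟨?_, ?_⟩
  · rintro ⟨⟨a, c⟩, hx⟩ ⟨⟨b, d⟩, hy⟩ h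
    have h1 (p : V × ZMod 3) :
        extFace a (D.corner p) + c p.1 = extFace b (D.corner p) + d p.1 :=
      congrFun (congrArg Subtype.val h) p
    have h2 : a = b := by
      funext f
      -- One flank of a co-tree edge is `f` and the other is the unbounded face with value `0`, so
      -- the difference of the two corner values is `a f`.
      set p := C.slot.symm (.inr f, 0) with hp
      have h3 := h1 (p.1, p.2 + flank (0 + D.off p))
      have h4 := h1 (p.1, p.2 + flank (1 + D.off p))
      rw [corner_eq] at h3 h4
      simp only [hp, Equiv.apply_symm_apply, edgeFace, extFace] at h3 h4
      simp only [if_true, one_ne_zero, if_false, Option.elim, zero_add] at h3 h4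
      rw [h4] at h3
      exact add_right_cancel h3
    subst h2
    have h3 : c = d := funext fun v => add_left_cancel (h1 (v, 0))
    subst h3
    rfl
  · rintro ⟨k, hk⟩
    let X (e : T ⊕ F) : ZMod 2 := k ((C.slot.symm (e, 0)).1, (C.slot.symm (e, 0)).2 + 1) +
      k ((C.slot.symm (e, 0)).1, (C.slot.symm (e, 0)).2 + 2)
    have hopp (p : V × ZMod 3) : k (p.1, p.2 + 1) + k (p.1, p.2 + 2) =
        k ((C.opp p).1, (C.opp p).2 + 1) + k ((C.opp p).1, (C.opp p).2 + 2) := by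
      have h0 := hk p 0
      have h1 := hk p 1
      have e1 := flank_sum (fun i => k (p.1, p.2 + i)) 0
      have e2 := flank_sum (fun i => k ((C.opp p).1, (C.opp p).2 + i)) (τ p)
      simp only [add_zero] at e1
      rw [← e1, ← e2, h0, h1]
    have hX (p : V × ZMod 3) : X (C.slot p).1 = k (p.1, p.2 + 1) + k (p.1, p.2 + 2) := by
      rcases zmod2_cases (C.slot p).2 with h | h
      · have e1 : C.slot.symm ((C.slot p).1, 0) = p := by
          rw [← h, Prod.mk.eta, Equiv.symm_apply_apply]
        simp only [X, e1]
      · have e1 : C.slot.symm ((C.slot p).1, 0) = C.opp p := by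
          rw [CubicModel.opp, h]; rfl
        simp only [X, e1]
        exact (hopp p).symm
    let a (f : F) : ZMod 2 := X (.inr f)
    have hXa (e : T ⊕ F) : X e = D.jump a e := by
      rw [← zmod2_add_eq_zero]
      refine D.eq_zero_of_even (fun e => X e + D.jump a e) (fun v => ?_) (fun f => ?_) e
      · rw [Finset.sum_add_distrib, D.jump_even, add_zero]
        simp only [hX]
        exact sum_rotate fun i => k (v, i)
      · rw [jump_inr, zmod2_add_self]
    have hconst (v : V) (i : ZMod 3) : k (v, i) + extFace a (D.corner (v, i)) =
        k (v, 0) + extFace a (D.corner (v, 0)) := by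
      have h1 (i : ZMod 3) := (hX (v, i)).symm.trans ((hXa _).trans (D.jump_slot a (v, i)))
      generalize (fun i => extFace a (D.corner (v, i))) = g
      have key : ∀ g h : ZMod 3 → ZMod 2, (∀ i, g (i + 1) + g (i + 2) = h (i + 1) + h (i + 2)) →
          ∀ i, g i + h i = g 0 + h 0 := by decide
      exact key (fun i => k (v, i)) (fun i => extFace a (D.corner (v, i))) h1 i
    have hk' (p : V × ZMod 3) : k p = extFace a (D.corner p) +
        (k (p.1, 0) + extFace a (D.corner (p.1, 0))) := by
      rw [← hconst p.1 p.2, ← add_assoc, add_comm _ (k _), add_assoc, zmod2_add_self, add_zero]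
    exact ⟨⟨(a, fun v => k (v, 0) + extFace a (D.corner (v, 0))), (hpot k _ _ hk').1 hk⟩,
      Subtype.ext (funext fun p => (hk' p).symm)⟩

/-- The relative twists of the edges with respect to the drawing. -/
noncomputable def edgeTwist (R : RotationSystem G) (e : T ⊕ F) : ZMod 2 :=
  C.relTwist R (C.slot.symm (e, 0)) + D.off (C.slot.symm (e, 0)) +
    D.off (C.opp (C.slot.symm (e, 0)))

theorem relTwist_eq (R : RotationSystem G) (p : V × ZMod 3) :
    C.relTwist R p = D.edgeTwist R (C.slot p).1 + D.off p + D.off (C.opp p) := by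
  have key : ∀ x y z : ZMod 2, x = x + y + z + y + z := by decide
  rcases zmod2_cases (C.slot p).2 with h | h
  · have e1 : C.slot.symm ((C.slot p).1, 0) = p := by
      rw [← h, Prod.mk.eta, Equiv.symm_apply_apply]
    rw [edgeTwist, e1]
    exact key _ _ _
  · have e1 : C.slot.symm ((C.slot p).1, 0) = C.opp p := by
      rw [CubicModel.opp, h]; rfl
    have e2 : C.relTwist R (C.opp p) = C.relTwist R p := by
      rw [CubicModel.relTwist, CubicModel.relTwist, C.slot_opp, C.opp_opp]
      ring
    rw [edgeTwist, e1, C.opp_opp, e2, add_right_comm (C.relTwist R p)]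
    exact key _ _ _

/-- Labels vanish on the tree, so the twists there prescribe the coboundary of the turns.
Integrating from the root recovers the turns, and the other twists then recover the co-tree labels.
-/
theorem edgeTwist_bijective (S : SimpleGraph V)
    (hS : ∀ e, (C.edge e).1 ∈ S.edgeSet ↔ e.isLeft = true) :
    Function.Bijective fun R : TRotationSystem G S =>
      (C.turn R.1 D.root, D.edgeTwist R.1) := by
  have hlab (R : RotationSystem G) : (∀ e : G.edgeSet, e.1 ∈ S.edgeSet → R.twist e = 0) ↔
      ∀ t, C.label R (.inl t) = 0 := by
    constructor
    · exact fun h t => h _ ((hS _).2 rfl)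
    · intro h e he
      obtain ⟨e, rfl⟩ := C.edge_bijective.2 e
      have := (hS e).1 he
      rcases e with t | f
      · exact h t
      · simp at this
  let o (e : T ⊕ F) : ZMod 2 :=
    1 + (D.off (C.slot.symm (e, 0)) + D.off (C.opp (C.slot.symm (e, 0))))
  have htw (R : RotationSystem G) (e : T ⊕ F) :
      D.edgeTwist R e = C.label R e + (C.cobound (C.turn R) e + o e) := by
    have := C.cobound_slot (C.turn R) (C.slot.symm (e, 0))
    rw [Equiv.apply_symm_apply] at this
    rw [edgeTwist, CubicModel.relTwist, this, Equiv.apply_symm_apply]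
    ring
  constructor
  · rintro ⟨R, hR⟩ ⟨R', hR'⟩ h
    have h1 : C.turn R D.root = C.turn R' D.root := congrArg Prod.fst h
    have h2 (e) : D.edgeTwist R e = D.edgeTwist R' e := congrFun (congrArg Prod.snd h) e
    simp only [htw] at h2
    rw [hlab] at hR hR'
    have h3 : C.turn R = C.turn R' :=
      (D.integrate (C.turn R' D.root) fun t => C.cobound (C.turn R') (.inl t)).unique
        ⟨h1, fun t => by
          have := h2 (.inl t)
          rw [hR, hR', zero_add, zero_add] at this
          exact add_right_cancel this⟩ ⟨rfl, fun t => rfl⟩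
    have h4 : C.label R = C.label R' := funext fun e => by
      have := h2 e
      rw [h3] at this
      exact add_right_cancel this
    exact Subtype.ext (C.rotationEquiv.injective (Prod.ext h3 h4))
  · rintro ⟨c₀, θ⟩
    obtain ⟨c, ⟨hc0, hc⟩, -⟩ := D.integrate c₀ fun t => θ (.inl t) + o (.inl t)
    let R := C.rotationEquiv.symm (c, fun e => θ e + (C.cobound c e + o e))
    have h1 := C.rotationEquiv.apply_symm_apply (c, fun e => θ e + (C.cobound c e + o e))
    have h2 : C.turn R = c := congrArg Prod.fst h1
    have h3 : C.label R = fun e => θ e + (C.cobound c e + o e) := congrArg Prod.snd h1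
    refine ⟨⟨R, (hlab R).2 fun t => ?_⟩, ?_⟩
    · have h4 : C.cobound c (.inl t) = θ (.inl t) + o (.inl t) := hc t
      rw [h3]
      simp only [h4, add_assoc, zmod2_add_self, add_zero]
    · refine Prod.ext (by simp [h2, hc0]) (funext fun e => ?_)
      simp only [htw, h2, h3]
      rw [add_assoc, zmod2_add_self, add_zero]

/-- Unique integrability makes a vertex function the same as a root value and an arbitrary function
on the tree edges. -/
theorem card_vertices (D : PlaneTree C) [Fintype V] [Fintype T] : Fintype.card V = Fintype.card T + 1 := by
  have h : Nat.card (V → ZMod 2) = Nat.card (ZMod 2 × (T → ZMod 2)) := by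
    refine Nat.card_eq_of_bijective (fun c => (c D.root, fun t => C.cobound c (.inl t))) ⟨?_, ?_⟩
    · intro c d h
      have h1 := congrArg Prod.fst h
      have h2 := congrArg Prod.snd h
      exact (D.integrate (d D.root) fun t => C.cobound d (.inl t)).unique
        ⟨h1, fun t => congrFun h2 t⟩ ⟨rfl, fun t => rfl⟩
    · rintro ⟨c₀, y⟩
      obtain ⟨c, ⟨h1, h2⟩, -⟩ := D.integrate c₀ y
      exact ⟨c, Prod.ext h1 (funext h2)⟩
  rw [Nat.card_prod, Nat.card_fun, Nat.card_fun, Nat.card_zmod, ← pow_succ',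
    Nat.card_eq_fintype_card, Nat.card_eq_fintype_card] at h
  exact Nat.pow_right_injective le_rfl h

variable [Fintype F] [DecidableEq F]

theorem jump_eq_sum (a : F → ZMod 2) (e : T ⊕ F) :
    D.jump a e = ∑ g, D.jump (Pi.single g 1) e * a g := by
  rcases e with t | f
  · simp [jump_inl, add_mul, Finset.sum_add_distrib, Pi.single_apply]
  · simp [jump_inr, Pi.single_apply]

variable [Fintype T]

/-- The intersection matrix on the bounded faces. -/
def matOf (θ : T ⊕ F → ZMod 2) : Matrix F F (ZMod 2) := fun f g =>
  ∑ e, θ e * (D.jump (Pi.single f 1) e * D.jump (Pi.single g 1) e)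

theorem matOf_mulVec (θ : T ⊕ F → ZMod 2) (a : F → ZMod 2) (f : F) :
    (D.matOf θ).mulVec a f = ∑ e, D.jump (Pi.single f 1) e * (θ e * D.jump a e) := by
  simp only [Matrix.mulVec, dotProduct, matOf, Finset.sum_mul]
  rw [Finset.sum_comm]
  refine Finset.sum_congr rfl fun e _ => ?_
  rw [jump_eq_sum D a e, Finset.mul_sum, Finset.mul_sum]
  refine Finset.sum_congr rfl fun g _ => ?_
  ring

/-- Given `a`, integrating `θ` times its jump along the tree yields `c`, unique up to the value at
the root. The equations on co-tree edges then say that `θ` times the jump is orthogonal to the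
boundary of each bounded face, which is `matOf θ` annihilating `a`. -/
theorem card_potential [Fintype V] (θ : T ⊕ F → ZMod 2) :
    Nat.card {x // D.Potential θ x} = 2 * kerCard (D.matOf θ) := by
  have h2 : 2 * kerCard (D.matOf θ) =
      Nat.card (ZMod 2 × {a : F → ZMod 2 // (D.matOf θ).mulVec a = 0}) := by
    rw [Nat.card_prod, Nat.card_zmod]; rfl
  rw [h2]
  refine Nat.card_eq_of_bijective (fun x : {x // D.Potential θ x} =>
    (x.1.2 D.root, (⟨x.1.1, ?_⟩ : {a : F → ZMod 2 // (D.matOf θ).mulVec a = 0}))) ⟨?_, ?_⟩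
  · funext f
    rw [matOf_mulVec]
    simp only [← x.2 _]
    exact C.sum_mul_cobound _ (D.jump_even _) _
  · rintro ⟨⟨a, c⟩, hx⟩ ⟨⟨b, d⟩, hy⟩ h
    obtain rfl : a = b := congrArg (fun z => z.2.1) h
    have h3 : c D.root = d D.root := congrArg (fun z => z.1) h
    obtain rfl : c = d := (D.integrate (d D.root) fun t => θ (.inl t) * D.jump a (.inl t)).unique
      ⟨h3, fun t => hx (.inl t)⟩ ⟨rfl, fun t => hy (.inl t)⟩
    rfl
  · rintro ⟨c₀, a, ha⟩
    obtain ⟨c, ⟨hc0, hc⟩, -⟩ := D.integrate c₀ fun t => θ (.inl t) * D.jump a (.inl t)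
    refine ⟨⟨(a, c), ?_⟩, ?_⟩
    · rintro (t | f)
      · exact hc t
      -- The boundary of `f` contains no co-tree edge except `inr f`. The tree terms of `h3` and
      -- `h4` cancel, leaving the equation at this edge.
      · have h3 := C.sum_mul_cobound _ (D.jump_even (Pi.single f 1)) c
        have h4 := congrFun ha f
        rw [matOf_mulVec] at h4
        have h5 := congrArg₂ (· + ·) h3 h4
        simp only [Pi.zero_apply, add_zero, ← Finset.sum_add_distrib, ← mul_add] at h5
        rw [Fintype.sum_sum_type] at h5
        have h6 (t : T) : C.cobound c (.inl t) = θ (.inl t) * D.jump a (.inl t) := hc t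
        simp only [h6, zmod2_add_self, mul_zero, Finset.sum_const_zero, zero_add, jump_inr] at h5
        rw [← zmod2_add_eq_zero]
        simpa [Pi.single_apply, jump_inr] using h5
    · simp [hc0]

theorem two_pow_card_face [Fintype V] (R : RotationSystem G) :
    2 ^ Nat.card R.Face = 2 * kerCard (D.matOf (D.edgeTwist R)) := by
  rw [C.two_pow_card_face, D.card_cornerInvariant _ _ (D.relTwist_eq R), card_potential]

/-- The faces of the embedding and the rank add up to `|F| + 1`, while `|V| - |E| = 1 - |F|` because
the tree spans. -/
theorem eulerGenus_eq [Fintype V] (R : RotationSystem G) :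
    R.eulerGenus = ((D.matOf (D.edgeTwist R)).rank : ℤ) := by
  have h1 := D.two_pow_card_face R
  have h2 := kerCard_mul (D.matOf (D.edgeTwist R))
  have h3 : Nat.card R.Face + (D.matOf (D.edgeTwist R)).rank = Fintype.card F + 1 := by
    apply Nat.pow_right_injective (le_refl 2)
    change 2 ^ _ = 2 ^ _
    rw [pow_add, h1, mul_assoc, h2, pow_succ']
  have h4 := D.card_vertices
  have h5 : Nat.card G.edgeSet = Fintype.card T + Fintype.card F := by
    rw [← Nat.card_congr C.edgeEquiv, Nat.card_sum, Nat.card_eq_fintype_card,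
      Nat.card_eq_fintype_card]
  rw [RotationSystem.eulerGenus, RotationSystem.eulerChar, Nat.card_eq_fintype_card, h4, h5]
  push_cast
  have h6 : (Nat.card R.Face : ℤ) + ((D.matOf (D.edgeTwist R)).rank : ℤ) = Fintype.card F + 1 :=
    mod_cast h3
  linarith

/-- The intersection matrices of the drawing are all symmetric matrices supported on the adjacency
of the bounded faces. -/
theorem matOf_bijective [LinearOrder F] (hlt : ∀ t, (D.sides t).2 < (D.sides t).1)
    (hinj : Function.Injective D.sides) (A : F → F → Prop)
    (hA : ∀ f g, g < f → (A f g ↔ ∃ t, D.sides t = (f, g))) (hA' : ∀ f g, A f g → A g f) :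
    (∀ θ, D.matOf θ ∈ suppSet A) ∧
      ∀ M ∈ suppSet A, ∃! θ, D.matOf θ = M := by
  have hsymm (θ) (f g : F) : D.matOf θ f g = D.matOf θ g f := by
    simp only [matOf, mul_comm]
  have hoff (θ) (f g : F) (hgf : g < f) : D.matOf θ f g =
      ∑ t, θ (.inl t) * if D.sides t = (f, g) then 1 else 0 := by
    rw [matOf, Fintype.sum_sum_type]
    -- No co-tree edge lies on two different bounded faces.
    have h0 : ∑ h, θ (.inr h) * (D.jump (Pi.single f 1) (.inr h) *
        D.jump (Pi.single g 1) (.inr h)) = 0 := by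
      refine Finset.sum_eq_zero fun h _ => ?_
      rw [jump_inr, jump_inr]
      by_cases hf : h = f
      · subst hf; simp [hgf.ne']
      · simp [hf]
    rw [h0, add_zero]
    refine Finset.sum_congr rfl fun t _ => ?_
    congr 1
    rw [jump_inl, jump_inl]
    have hl := hlt t
    rcases hs : D.sides t with ⟨x, y⟩
    rw [hs] at hl
    simp only at hl
    simp only [Pi.single_apply, Prod.mk.injEq]
    by_cases h1 : x = f
    · subst h1
      by_cases h2 : y = g
      · subst h2; simp [hl.ne, hl.ne']
      · simp [h2, hl.ne, hgf.ne']
    · by_cases h2 : y = f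
      · subst h2
        have h3 : x ≠ g := (hgf.trans hl).ne'
        simp [h1, h3, hgf.ne']
      · simp [h1, h2]
  -- By `hinj` two bounded faces share at most one tree edge.
  have hside (θ) (t : T) : D.matOf θ (D.sides t).1 (D.sides t).2 = θ (.inl t) := by
    rw [hoff _ _ _ (hlt t)]
    have (t' : T) : D.sides t' = ((D.sides t).1, (D.sides t).2) ↔ t' = t := by
      rw [Prod.mk.eta]; exact hinj.eq_iff
    classical
    simp [this]
  -- The constant function `1` jumps only at co-tree edges, since the unbounded face carries `0`.
  have hrow (θ) (f : F) : ∑ g, D.matOf θ f g = θ (.inr f) := by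
    have h1 := D.matOf_mulVec θ (fun _ => 1) f
    simp only [Matrix.mulVec, dotProduct, mul_one] at h1
    rw [h1, Fintype.sum_sum_type]
    simp [jump_inl, jump_inr, zmod2_add_self, Pi.single_apply]
  refine ⟨fun θ => ⟨Matrix.IsSymm.ext fun i j => hsymm _ _ _, fun i j hij h => ?_⟩,
    fun M hM => ?_⟩
  · have aux (i j : F) (hij : j < i) (h : ¬ A i j) : D.matOf θ i j = 0 := by
      rw [hoff _ _ _ hij]
      rw [hA _ _ hij, not_exists] at h
      simp [h]
    rcases lt_or_gt_of_ne hij with h1 | h1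
    · rw [hsymm]
      exact aux _ _ h1 fun h' => h (hA' _ _ h')
    · exact aux _ _ h1 h
  · let θ : T ⊕ F → ZMod 2 := Sum.elim (fun t => M (D.sides t).1 (D.sides t).2) fun f => ∑ g, M f g
    have hlow (f g : F) (hgf : g < f) : D.matOf θ f g = M f g := by
      by_cases h : A f g
      · obtain ⟨t, ht⟩ := (hA f g hgf).1 h
        have := hside θ t
        rw [ht] at this
        rw [this]
        simp [θ, ht]
      · rw [hM.2 f g hgf.ne' h, hoff _ _ _ hgf]
        rw [hA _ _ hgf, not_exists] at h
        simp [h]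
    have hne (f g : F) (hfg : f ≠ g) : D.matOf θ f g = M f g := by
      rcases lt_or_gt_of_ne hfg with h | h
      · rw [hsymm, hlow _ _ h]
        exact hM.1.apply _ _
      · exact hlow _ _ h
    refine ⟨θ, ?_, fun θ' h' => ?_⟩
    · ext f g
      by_cases hfg : f = g
      · subst hfg
        -- Diagonal entries agree because the row sums and all other entries do.
        have h1 : ∑ g, D.matOf θ f g = ∑ g, M f g := hrow θ f
        rw [← Finset.add_sum_erase _ _ (Finset.mem_univ f),
          ← Finset.add_sum_erase _ (fun g => M f g) (Finset.mem_univ f)] at h1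
        rw [Finset.sum_congr rfl fun g hg => hne f g (Finset.ne_of_mem_erase hg).symm] at h1
        exact add_right_cancel h1
      · exact hne f g hfg
    · funext e
      rcases e with t | f
      · rw [← hside θ', h']; rfl
      · rw [← hrow θ', h']; rfl

theorem eulerGenusPolynomial_eq_sum {V : Type*} [Finite V] (G S : SimpleGraph V) {α : Type*}
    [Fintype α] (f : α → ℕ) (e : TRotationSystem G S → α) (he : Function.Bijective e)
    (h : ∀ R, R.1.eulerGenus = (f (e R) : ℤ)) :
    eulerGenusPolynomial G S = ∑ x, X ^ f x := by
  ext i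
  rw [coeff_eulerGenusPolynomial, finsetSum_coeff]
  simp only [coeff_X_pow]
  rw [Finset.sum_boole, embeddingCount]
  congr 1
  rw [← Fintype.card_subtype, ← Nat.card_eq_fintype_card]
  refine Nat.card_congr ((Equiv.ofBijective e he).subtypeEquiv fun R => ?_)
  rw [h, Equiv.ofBijective_apply, Nat.cast_inj]
  exact eq_comm

/-- The factor two is the choice of the rotation at the root, on which the matrix does not depend.
-/
theorem eulerGenusPolynomial_eq [Fintype V] [LinearOrder F] (S : SimpleGraph V)
    (hS : ∀ e, (C.edge e).1 ∈ S.edgeSet ↔ e.isLeft = true)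
    (hlt : ∀ t, (D.sides t).2 < (D.sides t).1) (hinj : Function.Injective D.sides)
    (A : F → F → Prop) (hA : ∀ f g, g < f → (A f g ↔ ∃ t, D.sides t = (f, g)))
    (hA' : ∀ f g, A f g → A g f) :
    eulerGenusPolynomial G S = 2 * rankSum (suppSet A) := by
  classical
  obtain ⟨h1, h2⟩ := D.matOf_bijective hlt hinj A hA hA'
  have hb : Function.Bijective fun x : ZMod 2 × (T ⊕ F → ZMod 2) =>
      (x.1, (⟨D.matOf x.2, h1 x.2⟩ : suppSet A)) := by
    constructor
    · rintro ⟨c, θ⟩ ⟨c', θ'⟩ h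
      have h3 : c = c' := congrArg (fun z => z.1) h
      refine Prod.ext h3 ?_
      exact (h2 _ (h1 θ')).unique (congrArg (fun z => z.2.1) h) rfl
    · rintro ⟨c, M, hM⟩
      obtain ⟨θ, hθ, -⟩ := h2 M hM
      exact ⟨(c, θ), Prod.ext rfl (Subtype.ext hθ)⟩
  rw [eulerGenusPolynomial_eq_sum G S (fun x : ZMod 2 × suppSet A => x.2.1.rank) _
    (hb.comp (D.edgeTwist_bijective S hS)) fun R => D.eulerGenus_eq R.1, Fintype.sum_prod_type,
    sum_zmod2, rankSum_def, two_mul]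

end PlaneTree

end PlaneTree

/-! ### The drawing of a cubic caterpillar-Halin graph -/

section HalinModel

theorem lastOn_lt (side : ℕ → Bool) (s : Bool) {n : ℕ} (hn : 1 ≤ n) : lastOn side s n < n := by
  induction n with
  | zero => omega
  | succ n ih =>
    rw [lastOn]
    split_ifs
    · omega
    · rcases Nat.eq_zero_or_pos n with rfl | h
      · simp [lastOn]
      · have := ih h
        omega

/-- The last position before `n` on the side `s`, as a bounded face. -/
def lastFace (side : ℕ → Bool) (l : ℕ) (s : Bool) (n : ℕ) (h1 : 1 ≤ n) (h2 : n ≤ l + 2) :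
    Fin (l + 2) := ⟨lastOn side s n, (lastOn_lt side s h1).trans_le h2⟩

/-- Tree edges: `inl i` joins the `i`-th and the next vertex of the horizontal path, `inr i` is the
vertical edge at the spine vertex `i`. -/
abbrev TreeEdge (l : ℕ) : Type := Fin (l + 1) ⊕ Fin l

/-- A triple as a function on `ZMod 3`. -/
def pick3 {α : Type*} (a b c : α) (i : ZMod 3) : α := if i = 0 then a else if i = 1 then b else c

theorem pick3_zero {α : Type*} (a b c : α) : pick3 a b c 0 = a := rfl
theorem pick3_one {α : Type*} (a b c : α) : pick3 a b c 1 = b := rfl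
theorem pick3_two {α : Type*} (a b c : α) : pick3 a b c 2 = c := rfl

theorem zmod3_cases (x : ZMod 3) : x = 0 ∨ x = 1 ∨ x = 2 := by
  revert x; decide

/-- The `i`-th vertical edge ends in this leaf. -/
def midLeaf {l : ℕ} (i : Fin l) : Fin (l + 2) := ⟨i + 1, by omega⟩

theorem leaf_cases {l : ℕ} (j : Fin (l + 2)) : j = 0 ∨ j = Fin.last (l + 1) ∨
    ∃ i : Fin l, j = midLeaf i := by
  by_cases h0 : j.val = 0
  · exact Or.inl (Fin.ext h0)
  · by_cases h1 : j.val = l + 1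
    · exact Or.inr (Or.inl (Fin.ext h1))
    · exact Or.inr (Or.inr ⟨⟨j - 1, by omega⟩, Fin.ext (by simp only [midLeaf]; omega)⟩)

/-- A function on the leaves, given at the first, the last, and the other leaves. -/
def leafRec {l : ℕ} {α : Type*} (a b : α) (c : Fin l → α) (j : Fin (l + 2)) : α :=
  if h0 : j.val = 0 then a else if h1 : j.val = l + 1 then b else c ⟨j - 1, by omega⟩

theorem leafRec_zero {l : ℕ} {α : Type*} (a b : α) (c : Fin l → α) :
    leafRec a b c (0 : Fin (l + 2)) = a := by simp [leafRec]

theorem leafRec_last {l : ℕ} {α : Type*} (a b : α) (c : Fin l → α) :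
    leafRec a b c (Fin.last (l + 1)) = b := by simp [leafRec]

theorem leafRec_mid {l : ℕ} {α : Type*} (a b : α) (c : Fin l → α) (i : Fin l) :
    leafRec a b c (midLeaf i) = c i := by
  have : i.val + 1 ≠ l + 1 := by omega
  simp [leafRec, midLeaf, i.2.ne]

variable (side : ℕ → Bool) (l : ℕ)

/-- The darts at the vertices of the graph, as ends of edges. -/
def half : CatVertex l → ZMod 3 → (TreeEdge l ⊕ Fin (l + 2)) × ZMod 2
  | .inl i => pick3 (.inl (.inl i.castSucc), 1) (.inl (.inl i.succ), 0) (.inl (.inr i), 0)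
  | .inr j => leafRec
      (pick3 (.inl (.inl 0), 0) (.inr 0, 0) (.inr 1, 0))
      (pick3 (.inl (.inl (Fin.last l)), 1)
        (.inr (lastFace side l false (l + 2) (by omega) le_rfl), 1)
        (.inr (lastFace side l true (l + 2) (by omega) le_rfl), 1))
      (fun i => pick3 (.inl (.inr i), 1)
        (.inr (lastFace side l (side (i + 2)) (i + 2) (by omega) (by omega)), 1)
        (.inr ⟨i + 2, by omega⟩, 0)) j

theorem half_inl (i : Fin l) : half side l (.inl i) =
    pick3 (.inl (.inl i.castSucc), 1) (.inl (.inl i.succ), 0) (.inl (.inr i), 0) := rfl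

theorem half_zero : half side l (.inr 0) =
    pick3 (.inl (.inl 0), 0) (.inr 0, 0) (.inr 1, 0) := by
  simp only [half, leafRec_zero]

theorem half_last : half side l (.inr (Fin.last (l + 1))) =
    pick3 (.inl (.inl (Fin.last l)), 1)
      (.inr (lastFace side l false (l + 2) (by omega) le_rfl), 1)
      (.inr (lastFace side l true (l + 2) (by omega) le_rfl), 1) := by
  simp only [half, leafRec_last]

theorem half_mid (i : Fin l) : half side l (.inr (midLeaf i)) =
    pick3 (.inl (.inr i), 1)
      (.inr (lastFace side l (side (i + 2)) (i + 2) (by omega) (by omega)), 1)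
      (.inr ⟨i + 2, by omega⟩, 0) := by
  simp only [half, leafRec_mid]

variable {side l}

/-- The co-tree edge of the face `f` ends in the leaf `a`. -/
def IsEnd (side : ℕ → Bool) (l : ℕ) (f a : Fin (l + 2)) : Prop :=
  a.val ≠ 0 ∧ lastOn side (side f) (a + 1) = f ∧ (a.val = l + 1 ∨ side (a + 1) = side f)

/-- The leaf `a` opens the face `a + 1`, so the edge of `f` ends where the next face on the same
side opens, or at the last leaf if there is none. -/
theorem exists_isEnd (hs : Starts side) (hl : 1 ≤ l) (f : Fin (l + 2)) : ∃ a, IsEnd side l f a := by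
  classical
  have hex : ∃ n, f.val < n ∧ 2 ≤ n ∧ (l + 2 ≤ n ∨ side n = side f) :=
    ⟨l + 2, f.2, by omega, Or.inl le_rfl⟩
  obtain ⟨h1, h2, h3⟩ := Nat.find_spec hex
  have hmin := fun m => Nat.find_min (m := m) hex
  set n := Nat.find hex
  have hn : n ≤ l + 2 := Nat.find_min' hex ⟨f.2, by omega, Or.inl le_rfl⟩
  refine ⟨⟨n - 1, by omega⟩, by simp only; omega, ?_, ?_⟩
  · have e : n - 1 + 1 = n := by omega
    simp only [e]
    refine lastOn_eq h1 rfl fun c hc1 hc2 hc3 => ?_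
    by_cases hc : 2 ≤ c
    · exact hmin c hc2 ⟨hc1, hc, Or.inr hc3⟩
    · have e1 : c = 1 := by omega
      have e2 : f.val = 0 := by omega
      rw [e1, e2, hs.zero, hs.one] at hc3
      exact absurd hc3 (by decide)
  · have e : n - 1 + 1 = n := by omega
    simp only [e]
    rcases h3 with h3 | h3
    · left; omega
    · right; exact h3

theorem exists_half_of_isEnd {f a : Fin (l + 2)} (h : IsEnd side l f a) :
    ∃ i, half side l (.inr a) i = (.inr f, 1) := by
  obtain ⟨h1, h2, h3⟩ := h
  rcases leaf_cases a with rfl | rfl | ⟨i, rfl⟩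
  · simp at h1
  · rw [Fin.val_last] at h2
    rcases hf : side f with _ | _
    · refine ⟨1, ?_⟩
      rw [half_last, pick3_one, lastFace]
      rw [hf] at h2
      simp [h2]
    · refine ⟨2, ?_⟩
      rw [half_last, pick3_two, lastFace]
      rw [hf] at h2
      simp [h2]
  · refine ⟨1, ?_⟩
    have h4 : side (i + 2) = side f := by
      rcases h3 with h3 | h3
      · simp only [midLeaf] at h3; omega
      · exact h3
    rw [half_mid, pick3_one, lastFace]
    simp only [midLeaf] at h2
    simp only [h4]
    simp only [Prod.mk.injEq, and_true, Sum.inr.injEq, ← Fin.val_inj]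
    exact h2

theorem half_surjective (hs : Starts side) (hl : 1 ≤ l) :
    Function.Surjective fun p : CatVertex l × ZMod 3 => half side l p.1 p.2 := by
  rintro ⟨(i | i) | f, b⟩
  · rcases zmod2_cases b with rfl | rfl
    · rcases Fin.eq_zero_or_eq_succ i with rfl | ⟨j, rfl⟩
      · exact ⟨(.inr 0, 0), by simp only [half_zero, pick3_zero]⟩
      · exact ⟨(.inl j, 1), rfl⟩
    · rcases Fin.eq_castSucc_or_eq_last i with ⟨j, rfl⟩ | rfl
      · exact ⟨(.inl j, 0), rfl⟩
      · exact ⟨(.inr (Fin.last _), 0), by simp only [half_last, pick3_zero]⟩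
  · rcases zmod2_cases b with rfl | rfl
    · exact ⟨(.inl i, 2), rfl⟩
    · exact ⟨(.inr (midLeaf i), 0), by simp only [half_mid, pick3_zero]⟩
  · rcases zmod2_cases b with rfl | rfl
    · by_cases h0 : f.val = 0
      · obtain rfl : f = 0 := Fin.ext h0
        exact ⟨(.inr 0, 1), by simp only [half_zero, pick3_one]⟩
      · by_cases h1 : f.val = 1
        · obtain rfl : f = 1 := Fin.ext h1
          exact ⟨(.inr 0, 2), by simp only [half_zero, pick3_two]⟩
        · refine ⟨(.inr (midLeaf ⟨f - 2, by omega⟩), 2), ?_⟩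
          simp only [half_mid, pick3_two, Prod.mk.injEq, and_true, Sum.inr.injEq, ← Fin.val_inj]
          omega
    · obtain ⟨a, ha⟩ := exists_isEnd hs hl f
      obtain ⟨i, hi⟩ := exists_half_of_isEnd ha
      exact ⟨(.inr a, i), hi⟩

/-- The numbering of the darts of the graph. -/
noncomputable def halinSlot (hs : Starts side) (hl : 1 ≤ l) :
    CatVertex l × ZMod 3 ≃ (TreeEdge l ⊕ Fin (l + 2)) × ZMod 2 :=
  Equiv.ofBijective (fun p => half side l p.1 p.2) <|
    -- Both sides have `6 (l + 1)` elements, so surjectivity suffices.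
    (Fintype.bijective_iff_surjective_and_card _).2 ⟨half_surjective hs hl, by
      simp only [Fintype.card_prod, Fintype.card_sum, Fintype.card_fin, ZMod.card]
      ring⟩

theorem halinSlot_apply (hs : Starts side) (hl : 1 ≤ l) (v : CatVertex l) (i : ZMod 3) :
    halinSlot hs hl (v, i) = half side l v i := rfl

/-- The end `b` of an edge. -/
noncomputable def edgeEnd (hs : Starts side) (hl : 1 ≤ l) (e : TreeEdge l ⊕ Fin (l + 2))
    (b : ZMod 2) : CatVertex l := ((halinSlot hs hl).symm (e, b)).1

theorem edgeEnd_eq (hs : Starts side) (hl : 1 ≤ l) {v : CatVertex l} {i : ZMod 3}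
    {e : TreeEdge l ⊕ Fin (l + 2)} {b : ZMod 2} (h : half side l v i = (e, b)) :
    edgeEnd hs hl e b = v := by
  rw [edgeEnd, ← h, ← halinSlot_apply hs hl, Equiv.symm_apply_apply]

theorem exists_half_edgeEnd (hs : Starts side) (hl : 1 ≤ l) (e : TreeEdge l ⊕ Fin (l + 2))
    (b : ZMod 2) : ∃ i, half side l (edgeEnd hs hl e b) i = (e, b) :=
  ⟨((halinSlot hs hl).symm (e, b)).2, (halinSlot hs hl).apply_symm_apply (e, b)⟩

/-- The vertices of the horizontal path. -/
def pathVertex (l k : ℕ) : CatVertex l :=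
  if k = 0 then .inr 0 else if h : k - 1 < l then .inl ⟨k - 1, h⟩ else .inr (Fin.last (l + 1))

theorem pathVertex_zero : pathVertex l 0 = .inr 0 := rfl

theorem pathVertex_succ (i : Fin l) : pathVertex l (i + 1) = .inl i := by
  simp [pathVertex]

theorem pathVertex_last : pathVertex l (l + 1) = .inr (Fin.last (l + 1)) := by
  simp [pathVertex]

theorem pathVertex_inj {a b : ℕ} (ha : a ≤ l + 1) (hb : b ≤ l + 1)
    (h : pathVertex l a = pathVertex l b) : a = b := by
  unfold pathVertex at h
  split_ifs at h <;> simp [← Fin.val_inj] at h <;> omega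

theorem pathVertex_ne_midLeaf (a : ℕ) (i : Fin l) : pathVertex l a ≠ .inr (midLeaf i) := by
  have := i.2.ne
  unfold pathVertex
  split_ifs <;> simp [← Fin.val_inj, midLeaf]
  omega

variable (hs : Starts side) (hl : 1 ≤ l)

theorem edgeEnd_path_zero (i : Fin (l + 1)) :
    edgeEnd hs hl (.inl (.inl i)) 0 = pathVertex l i := by
  rcases Fin.eq_zero_or_eq_succ i with rfl | ⟨j, rfl⟩
  · exact edgeEnd_eq hs hl (i := 0) (by simp only [half_zero, pick3_zero, Fin.val_zero, pathVertex_zero])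
  · rw [Fin.val_succ, pathVertex_succ]
    exact edgeEnd_eq hs hl (i := 1) rfl

theorem edgeEnd_path_one (i : Fin (l + 1)) :
    edgeEnd hs hl (.inl (.inl i)) 1 = pathVertex l (i + 1) := by
  rcases Fin.eq_castSucc_or_eq_last i with ⟨j, rfl⟩ | rfl
  · rw [Fin.val_castSucc, pathVertex_succ]
    exact edgeEnd_eq hs hl (i := 0) rfl
  · rw [Fin.val_last, pathVertex_last]
    exact edgeEnd_eq hs hl (i := 0) (by simp only [half_last, pick3_zero])

theorem edgeEnd_vertical_zero (i : Fin l) : edgeEnd hs hl (.inl (.inr i)) 0 = .inl i :=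
  edgeEnd_eq hs hl (i := 2) rfl

theorem edgeEnd_vertical_one (i : Fin l) :
    edgeEnd hs hl (.inl (.inr i)) 1 = .inr (midLeaf i) :=
  edgeEnd_eq hs hl (i := 0) (by simp only [half_mid, pick3_zero])

theorem edgeEnd_leaf_zero (f : Fin (l + 2)) :
    edgeEnd hs hl (.inr f) 0 = .inr ⟨f - 1, by omega⟩ := by
  by_cases h0 : f.val = 0
  · obtain rfl : f = 0 := Fin.ext h0
    exact edgeEnd_eq hs hl (i := 1) (by
      change half side l (.inr 0) 1 = _
      simp only [half_zero, pick3_one])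
  · by_cases h1 : f.val = 1
    · obtain rfl : f = 1 := Fin.ext h1
      exact edgeEnd_eq hs hl (i := 2) (by
        change half side l (.inr 0) 2 = _
        simp only [half_zero, pick3_two])
    · have h2 : (⟨f - 1, by omega⟩ : Fin (l + 2)) = midLeaf ⟨f - 2, by omega⟩ :=
        Fin.ext (by simp only [midLeaf]; omega)
      rw [h2]
      refine edgeEnd_eq hs hl (i := 2) ?_
      simp only [half_mid, pick3_two, Prod.mk.injEq, and_true, Sum.inr.injEq, ← Fin.val_inj]
      omega

theorem edgeEnd_leaf_one (f : Fin (l + 2)) :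
    ∃ a, edgeEnd hs hl (.inr f) 1 = .inr a ∧ IsEnd side l f a := by
  obtain ⟨a, ha⟩ := exists_isEnd hs hl f
  obtain ⟨i, hi⟩ := exists_half_of_isEnd ha
  exact ⟨a, edgeEnd_eq hs hl hi, ha⟩

theorem edgeEnd_leaf_one_iff (f a : Fin (l + 2)) :
    edgeEnd hs hl (.inr f) 1 = .inr a ↔ IsEnd side l f a := by
  constructor
  · intro h
    obtain ⟨b, h1, h2⟩ := edgeEnd_leaf_one hs hl f
    rw [h1] at h
    cases h
    exact h2
  · intro h
    obtain ⟨i, hi⟩ := exists_half_of_isEnd h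
    exact edgeEnd_eq hs hl hi

/-- The two ends of an edge. -/
def Joins (e : TreeEdge l ⊕ Fin (l + 2)) (v w : CatVertex l) : Prop :=
  ∃ b, edgeEnd hs hl e b = v ∧ edgeEnd hs hl e (b + 1) = w

theorem joins_iff (e : TreeEdge l ⊕ Fin (l + 2)) (v w : CatVertex l) : Joins hs hl e v w ↔
    (edgeEnd hs hl e 0 = v ∧ edgeEnd hs hl e 1 = w) ∨
    (edgeEnd hs hl e 0 = w ∧ edgeEnd hs hl e 1 = v) := by
  constructor
  · rintro ⟨b, h1, h2⟩
    rcases zmod2_cases b with rfl | rfl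
    · exact Or.inl ⟨h1, h2⟩
    · exact Or.inr ⟨h2, h1⟩
  · rintro (⟨h1, h2⟩ | ⟨h1, h2⟩)
    · exact ⟨0, h1, h2⟩
    · exact ⟨1, h2, h1⟩

theorem treeRel_iff (v w : CatVertex l) : treeRel l v w ∨ treeRel l w v ↔
    ∃ t, Joins hs hl (.inl t) v w := by
  have h1 (v w : CatVertex l) (h : treeRel l v w) : ∃ t, Joins hs hl (.inl t) v w := by
    rcases v with i | i
    · rcases w with j | j
      · have h : i.val + 1 = j.val := h
        refine ⟨.inl i.succ, 0, ?_, ?_⟩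
        · rw [edgeEnd_path_zero, Fin.val_succ, pathVertex_succ]
        · rw [zero_add, edgeEnd_path_one, Fin.val_succ, h, pathVertex_succ]
      · rcases h with h | ⟨h, h'⟩ | ⟨h, h'⟩
        · refine ⟨.inr i, 0, edgeEnd_vertical_zero _ _ _, ?_⟩
          rw [zero_add, edgeEnd_vertical_one]
          exact congrArg Sum.inr (Fin.ext h.symm)
        · refine ⟨.inl 0, 1, ?_, ?_⟩
          · have := pathVertex_succ i
            rw [h] at this
            rw [edgeEnd_path_one]
            exact this
          · obtain rfl : j = 0 := Fin.ext h'
            exact edgeEnd_path_zero _ _ _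
        · obtain rfl : j = Fin.last _ := Fin.ext h'
          refine ⟨.inl (Fin.last l), 0, ?_, ?_⟩
          · rw [edgeEnd_path_zero, Fin.val_last, ← pathVertex_succ, h]
          · rw [zero_add, edgeEnd_path_one, Fin.val_last, pathVertex_last]
    · exact h.elim
  constructor
  · rintro (h | h)
    · exact h1 _ _ h
    · obtain ⟨t, ht⟩ := h1 _ _ h
      exact ⟨t, by rw [joins_iff] at ht ⊢; exact ht.symm⟩
  · have h2 (t : TreeEdge l) : treeRel l (edgeEnd hs hl (.inl t) 0) (edgeEnd hs hl (.inl t) 1) ∨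
        treeRel l (edgeEnd hs hl (.inl t) 1) (edgeEnd hs hl (.inl t) 0) := by
      rcases t with i | i
      · rw [edgeEnd_path_zero, edgeEnd_path_one]
        rcases Fin.eq_zero_or_eq_succ i with rfl | ⟨j, rfl⟩
        · right
          have := pathVertex_succ (⟨0, hl⟩ : Fin l)
          simp only at this
          rw [Fin.val_zero, this]
          exact Or.inr (Or.inl ⟨rfl, rfl⟩)
        · left
          rw [Fin.val_succ, pathVertex_succ]
          by_cases hj : j.val + 1 = l
          · rw [hj, pathVertex_last]
            exact Or.inr (Or.inr ⟨hj, rfl⟩)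
          · have := pathVertex_succ (⟨j + 1, by omega⟩ : Fin l)
            simp only at this
            rw [this]
            rfl
      · rw [edgeEnd_vertical_zero, edgeEnd_vertical_one]
        exact Or.inl (Or.inl rfl)
    rintro ⟨t, ht⟩
    rw [joins_iff] at ht
    rcases ht with ⟨rfl, rfl⟩ | ⟨rfl, rfl⟩
    · exact h2 t
    · exact (h2 t).symm

theorem caterpillar_adj_iff (v w : CatVertex l) :
    (caterpillar l).Adj v w ↔ ∃ t, Joins hs hl (.inl t) v w := by
  rw [caterpillar, SimpleGraph.fromRel_adj, treeRel_iff hs hl]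
  refine ⟨fun h => h.2, fun h => ⟨?_, h⟩⟩
  rintro rfl
  rw [← treeRel_iff, or_self] at h
  rcases v with i | i
  · exact absurd h (Nat.succ_ne_self _)
  · exact h

/-- Position `2` lies on one of the two sides and closes that initial face at the first vertical
edge, while the other one extends further. This excludes a double edge at `u₀`. -/
theorem no_common_end (hs : Starts side) (hl : 1 ≤ l) (f g : Fin (l + 2)) (hf : f.val = 0) (hg : g.val = 1) (a : Fin (l + 2))
    (h1 : IsEnd side l f a) (h2 : IsEnd side l g a) : False := by
  have e1 := h1.2.1
  have e2 := h2.2.1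
  rcases h1.2.2 with h | h
  · have n1 := hs.side_ne (s := side f) (n := a + 1) (by omega) (c := 2) (by omega) (by omega)
    have n2 := hs.side_ne (s := side g) (n := a + 1) (by omega) (c := 2) (by omega) (by omega)
    rw [hf, hs.zero] at n1
    rw [hg, hs.one] at n2
    cases h4 : side 2
    · exact n1 h4
    · exact n2 h4
  · rcases h2.2.2 with h' | h'
    · have n1 := hs.side_ne (s := side f) (n := a + 1) (by omega) (c := 2) (by omega) (by omega)
      have n2 := hs.side_ne (s := side g) (n := a + 1) (by omega) (c := 2) (by omega) (by omega)
      rw [hf, hs.zero] at n1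
      rw [hg, hs.one] at n2
      cases h4 : side 2
      · exact n1 h4
      · exact n2 h4
    · rw [h', hf, hg, hs.zero, hs.one] at h
      exact absurd h (by decide)

/-- The delicate pairs are the two boundary edges at an extreme leaf, which are separated by
position `2`. At a middle leaf one boundary neighbour is to the left and the other to the right. -/
theorem halin_simple (v : CatVertex l) (i j : ZMod 3)
    (h : edgeEnd hs hl (half side l v i).1 ((half side l v i).2 + 1) =
      edgeEnd hs hl (half side l v j).1 ((half side l v j).2 + 1)) : i = j := by
  have e11 : (1 + 1 : ZMod 2) = 0 := rfl
  have key : ∀ a b c : CatVertex l, a ≠ b → a ≠ c → b ≠ c →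
      pick3 a b c i = pick3 a b c j → i = j := by
    intro a b c h1 h2 h3 h4
    rcases zmod3_cases i with rfl | rfl | rfl <;> rcases zmod3_cases j with rfl | rfl | rfl <;>
      simp_all [pick3_zero, pick3_one, pick3_two, eq_comm]
  have red (x y z : (TreeEdge l ⊕ Fin (l + 2)) × ZMod 2) (k : ZMod 3) :
      edgeEnd hs hl (pick3 x y z k).1 ((pick3 x y z k).2 + 1) =
        pick3 (edgeEnd hs hl x.1 (x.2 + 1)) (edgeEnd hs hl y.1 (y.2 + 1))
          (edgeEnd hs hl z.1 (z.2 + 1)) k := by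
    rcases zmod3_cases k with rfl | rfl | rfl <;> rfl
  have hone : pathVertex l 1 = .inl ⟨0, hl⟩ := pathVertex_succ (⟨0, hl⟩ : Fin l)
  have hlast : pathVertex l l = .inl ⟨l - 1, by omega⟩ := by
    have := pathVertex_succ (⟨l - 1, by omega⟩ : Fin l)
    simp only at this
    rwa [Nat.sub_add_cancel hl] at this
  have hst := hs.side_lastOn
  rcases v with v | v
  · rw [half_inl, red, red] at h
    refine key _ _ _ ?_ ?_ ?_ h
    · rw [e11, zero_add, edgeEnd_path_zero, edgeEnd_path_one, Fin.val_castSucc, Fin.val_succ]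
      intro h'
      have := pathVertex_inj (by omega) (by omega) h'
      omega
    · rw [e11, zero_add, edgeEnd_path_zero, edgeEnd_vertical_one]
      exact pathVertex_ne_midLeaf _ _
    · rw [zero_add, edgeEnd_path_one, edgeEnd_vertical_one]
      exact pathVertex_ne_midLeaf _ _
  · rcases leaf_cases v with rfl | rfl | ⟨k, rfl⟩
    · rw [half_zero, red, red] at h
      obtain ⟨a, ha, ha'⟩ := edgeEnd_leaf_one hs hl 0
      obtain ⟨b, hb, hb'⟩ := edgeEnd_leaf_one hs hl 1
      refine key _ _ _ ?_ ?_ ?_ h <;> simp only [zero_add, edgeEnd_path_one, ha, hb, Fin.val_zero,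
        hone]
      · simp
      · simp
      · intro h'
        cases h'
        exact no_common_end hs hl 0 1 rfl rfl a ha' hb'
    · rw [half_last, red, red] at h
      refine key _ _ _ ?_ ?_ ?_ h <;> simp only [e11, edgeEnd_path_zero, edgeEnd_leaf_zero,
        Fin.val_last, hlast]
      · simp
      · simp
      · intro h'
        have h3 := congrArg Fin.val (Sum.inr.inj h')
        simp only [lastFace] at h3
        have s0 := hst false (n := l + 2) (by omega)
        have s1 := hst true (n := l + 2) (by omega)
        have n0 := fun hc => hs.side_ne (s := false) (n := l + 2) (by omega) (c := 2) hc (by omega)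
        have n1 := fun hc => hs.side_ne (s := true) (n := l + 2) (by omega) (c := 2) hc (by omega)
        generalize lastOn side false (l + 2) = x at *
        generalize lastOn side true (l + 2) = y at *
        by_cases hx : x = y
        · rw [hx, s1] at s0
          exact absurd s0 (by decide)
        · have := n0 (by omega)
          have := n1 (by omega)
          cases h4 : side 2 <;> simp_all
    · rw [half_mid, red, red] at h
      obtain ⟨a, ha, ha'⟩ := edgeEnd_leaf_one hs hl ⟨k + 2, by omega⟩
      refine key _ _ _ ?_ ?_ ?_ h <;> simp only [e11, zero_add, edgeEnd_vertical_zero,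
        edgeEnd_leaf_zero, ha]
      · simp
      · simp
      · intro h'
        have h3 := congrArg Fin.val (Sum.inr.inj h')
        simp only [lastFace] at h3
        have h4 := lastOn_lt side (side (k + 2)) (n := k + 2) (by omega)
        have h5 := lastOn_lt side (side (k + 2)) (n := a + 1) (by omega)
        have h6 := ha'.2.1
        simp only at h6
        omega

end HalinModel

/-! ### The boundary cycle and the faces of the plane drawing -/

section HalinDrawing

/-- The sides of the positions: the first two positions, then the letters of the word. -/
def sideOf (w : List Bool) : ℕ → Bool
  | 0 => false
  | 1 => true
  | i + 2 => w.getD i false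

theorem starts_sideOf (w : List Bool) : Starts (sideOf w) := ⟨rfl, rfl⟩

theorem onSide_iff (w : List Bool) (s : Bool) (a : Fin (w.length + 2)) :
    OnSide w s a ↔ a.val = 0 ∨ a.val = w.length + 1 ∨ sideOf w (a + 1) = s := by
  have key (i : ℕ) (hi : i < w.length) : sideOf w (i + 2) = w.get ⟨i, hi⟩ := by
    simp [sideOf, hi]
  constructor
  · rintro (h | h | ⟨i, h, h'⟩)
    · exact Or.inl h
    · exact Or.inr (Or.inl h)
    · refine Or.inr (Or.inr ?_)
      rw [h, key _ i.2]
      exact h'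
  · rintro (h | h | h)
    · exact Or.inl h
    · exact Or.inr (Or.inl h)
    · rcases leaf_cases a with rfl | rfl | ⟨i, rfl⟩
      · exact Or.inl rfl
      · exact Or.inr (Or.inl rfl)
      · refine Or.inr (Or.inr ⟨i, rfl, ?_⟩)
        rw [← key _ i.2]
        exact h

/-- A boundary edge is traced from the leaf that opens its bounded face to the leaf that closes it.
The truncated `f - 1` sends both initial faces to `u₀`. -/
theorem leafRel_inr_iff (w : List Bool) (a b : Fin (w.length + 2)) :
    leafRel w (.inr a) (.inr b) ↔
      ∃ f : Fin (w.length + 2), f.val - 1 = a ∧ IsEnd (sideOf w) w.length f b := by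
  have hs := starts_sideOf w
  change (a < b ∧ ∃ s, OnSide w s a ∧ OnSide w s b ∧ ∀ c, a < c → c < b → ¬ OnSide w s c) ↔ _
  simp only [onSide_iff]
  constructor
  · rintro ⟨hab, s, ha, hb, hc⟩
    have hab' : a.val < b.val := hab
    -- At `u₀` the side decides between the faces `0` and `1`; `hf3` ensures that position `1` does
    -- not close face `0`.
    obtain ⟨f, hf1, hf2, hf3⟩ : ∃ f : Fin (w.length + 2), f.val - 1 = a ∧ sideOf w f = s ∧
        (f.val = 0 → s = false) := by
      by_cases h0 : a.val = 0
      · cases s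
        · exact ⟨0, h0.symm, rfl, fun _ => rfl⟩
        · exact ⟨1, by simp [h0], rfl, by simp⟩
      · refine ⟨⟨a + 1, by omega⟩, rfl, ?_, by simp⟩
        rcases ha with h | h | h
        · exact absurd h h0
        · omega
        · exact h
    refine ⟨f, hf1, by omega, lastOn_eq (by omega) rfl fun c hc1 hc2 hc3 => ?_, ?_⟩
    · by_cases hc0 : c = 1
      · have := hf3 (by omega)
        rw [hc0, hs.one, hf2, this] at hc3
        exact absurd hc3 (by decide)
      · refine hc ⟨c - 1, by omega⟩ ?_ ?_ (Or.inr (Or.inr ?_))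
        · change a.val < c - 1
          omega
        · change c - 1 < b.val
          omega
        · have e : c - 1 + 1 = c := by omega
          simp only [e]
          rw [hc3, hf2]
    · rcases hb with h | h | h
      · omega
      · exact Or.inl h
      · exact Or.inr (h.trans hf2.symm)
  · rintro ⟨f, hf, hb0, hb1, hb2⟩
    have hfb : f.val < b.val + 1 := by
      rw [← hb1]
      exact lastOn_lt _ _ (by omega)
    refine ⟨?_, sideOf w f, ?_, ?_, fun c hac hcb => ?_⟩
    · change a.val < b.val
      omega
    · by_cases h0 : a.val = 0
      · exact Or.inl h0
      · right; right
        have e : a.val + 1 = f.val := by omega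
        rw [e]
    · exact Or.inr hb2
    · have hac' : a.val < c.val := hac
      have hcb' : c.val < b.val := hcb
      rintro (h | h | h)
      · omega
      · omega
      · exact hs.side_ne (s := sideOf w f) (n := b + 1) (by omega) (c := c + 1) (by omega)
          (by omega) h

section Model

variable (w : List Bool) (hl : 1 ≤ w.length)

theorem leafCycle_adj_iff (v v' : CatVertex w.length) :
    (leafCycle w).Adj v v' ↔ ∃ f, Joins (starts_sideOf w) hl (.inr f) v v' := by
  have h1 (v v' : CatVertex w.length) : leafRel w v v' ↔
      ∃ f, edgeEnd (starts_sideOf w) hl (.inr f) 0 = v ∧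
        edgeEnd (starts_sideOf w) hl (.inr f) 1 = v' := by
    constructor
    · intro h
      rcases v with v | a
      · exact h.elim
      rcases v' with v' | b
      · exact h.elim
      obtain ⟨f, h1, h2⟩ := (leafRel_inr_iff w a b).1 h
      refine ⟨f, ?_, (edgeEnd_leaf_one_iff _ _ _ _).2 h2⟩
      rw [edgeEnd_leaf_zero]
      exact congrArg Sum.inr (Fin.ext h1)
    · rintro ⟨f, rfl, rfl⟩
      obtain ⟨b, hb, hb'⟩ := edgeEnd_leaf_one (starts_sideOf w) hl f
      rw [edgeEnd_leaf_zero, hb]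
      exact (leafRel_inr_iff w _ _).2 ⟨f, rfl, hb'⟩
  rw [leafCycle, SimpleGraph.fromRel_adj, h1, h1]
  simp only [joins_iff, exists_or]
  constructor
  · rintro ⟨-, h | ⟨f, h, h'⟩⟩
    · exact Or.inl h
    · exact Or.inr ⟨f, h, h'⟩
  · intro h
    refine ⟨?_, h⟩
    rintro rfl
    rw [or_self, ← h1] at h
    rcases v with v | a
    · exact h
    · exact lt_irrefl _ h.1

theorem halin_adj_iff (v v' : CatVertex w.length) :
    (halin w).Adj v v' ↔ ∃ e, Joins (starts_sideOf w) hl e v v' := by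
  rw [halin, SimpleGraph.sup_adj, caterpillar_adj_iff (starts_sideOf w) hl,
    leafCycle_adj_iff w hl]
  exact (Sum.exists (p := fun e => Joins (starts_sideOf w) hl e v v')).symm

/-- The numbering of the darts of a cubic caterpillar-Halin graph. -/
noncomputable def halinModel : CubicModel (halin w) (TreeEdge w.length ⊕ Fin (w.length + 2)) where
  slot := halinSlot (starts_sideOf w) hl
  adj_iff v v' := by
    rw [halin_adj_iff w hl]
    constructor
    · rintro ⟨e, b, rfl, rfl⟩
      obtain ⟨i, hi⟩ := exists_half_edgeEnd (starts_sideOf w) hl e b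
      refine ⟨i, ?_⟩
      rw [halinSlot_apply, hi]
      rfl
    · rintro ⟨i, rfl⟩
      exact ⟨_, (halinSlot (starts_sideOf w) hl (v, i)).2,
        edgeEnd_eq (starts_sideOf w) hl (i := i) rfl, rfl⟩
  simple v i j h := halin_simple (starts_sideOf w) hl v i j h

theorem halinModel_edge_mem (e : TreeEdge w.length ⊕ Fin (w.length + 2)) :
    ((halinModel w hl).edge e).1 ∈ (caterpillar w.length).edgeSet ↔ e.isLeft = true := by
  have h0 : ((halinModel w hl).edge e).1 ∈ (caterpillar w.length).edgeSet ↔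
      (caterpillar w.length).Adj (edgeEnd (starts_sideOf w) hl e 0)
        (edgeEnd (starts_sideOf w) hl e 1) := by
    change (caterpillar w.length).Adj ((halinModel w hl).slot.symm (e, 0)).1
      ((halinModel w hl).opp ((halinModel w hl).slot.symm (e, 0))).1 ↔ _
    have : (halinModel w hl).opp ((halinModel w hl).slot.symm (e, 0)) =
        (halinModel w hl).slot.symm (e, 1) := by
      rw [CubicModel.opp, Equiv.apply_symm_apply]
      rfl
    rw [this]
    rfl
  rw [h0]
  rcases e with t | f
  · simp only [Sum.isLeft_inl, iff_true]
    exact (caterpillar_adj_iff (starts_sideOf w) hl _ _).2 ⟨t, 0, rfl, rfl⟩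
  · simp only [Sum.isLeft_inr, Bool.false_eq_true, iff_false]
    obtain ⟨b, hb, -⟩ := edgeEnd_leaf_one (starts_sideOf w) hl f
    rw [edgeEnd_leaf_zero, hb, caterpillar, SimpleGraph.fromRel_adj]
    rintro ⟨-, h | h⟩ <;> exact h

end Model

variable (side : ℕ → Bool) (l : ℕ)

/-- The faces at the corners, which are numbered by the opposite darts. -/
def cornerFace : CatVertex l → ZMod 3 → Option (Fin (l + 2))
  | .inl i => pick3 (some ⟨i + 2, by omega⟩)
      (some (lastFace side l (side (i + 2)) (i + 2) (by omega) (by omega)))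
      (some (lastFace side l (!side (i + 2)) (i + 2) (by omega) (by omega)))
  | .inr j => leafRec (pick3 none (some 1) (some 0))
      (pick3 none (some (lastFace side l true (l + 2) (by omega) le_rfl))
        (some (lastFace side l false (l + 2) (by omega) le_rfl)))
      (fun i => pick3 none (some ⟨i + 2, by omega⟩)
        (some (lastFace side l (side (i + 2)) (i + 2) (by omega) (by omega)))) j

/-- The two faces at a tree edge, the later one first. -/
def treeSides : TreeEdge l → Fin (l + 2) × Fin (l + 2)
  | .inl i => (⟨i + 1, by omega⟩, lastFace side l (!side (i + 1)) (i + 1) (by omega) (by omega))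
  | .inr i => (⟨i + 2, by omega⟩, lastFace side l (side (i + 2)) (i + 2) (by omega) (by omega))

theorem exists_shift {α : Type*} {f g : ZMod 2 → α}
    (h : (f 0 = g 0 ∧ f 1 = g 1) ∨ (f 0 = g 1 ∧ f 1 = g 0)) : ∃ o, ∀ s, f s = g (s + o) := by
  rcases h with ⟨h1, h2⟩ | ⟨h1, h2⟩
  · refine ⟨0, fun s => ?_⟩
    rcases zmod2_cases s with rfl | rfl
    · exact h1
    · exact h2
  · refine ⟨1, fun s => ?_⟩
    rcases zmod2_cases s with rfl | rfl
    · exact h1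
    · exact h2

variable {side l}

/-- At the right end of a horizontal edge its two faces appear as the last ones on either side; this
matches them with the pair recorded in `treeSides`. -/
theorem lastFace_succ_pair (s : Bool) (n : ℕ) (h1 : 1 ≤ n) (h2 : n + 1 ≤ l + 2) :
    (lastFace side l s (n + 1) (by omega) h2 = ⟨n, by omega⟩ ∧
      lastFace side l (!s) (n + 1) (by omega) h2 =
        lastFace side l (!side n) n h1 (by omega)) ∨
    (lastFace side l s (n + 1) (by omega) h2 = lastFace side l (!side n) n h1 (by omega) ∧
      lastFace side l (!s) (n + 1) (by omega) h2 = ⟨n, by omega⟩) := by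
  simp only [lastFace, lastOn, Fin.mk.injEq]
  by_cases h : side n = s
  · subst h; simp
  · have : side n = !s := Bool.eq_not.2 h
    simp [this]

/-- Checked at each kind of vertex. Only the unordered pair of faces matters; the order is absorbed
by the shift `o`. -/
theorem cornerFace_flank (p : CatVertex l × ZMod 3) : ∃ o, ∀ s : ZMod 2,
    cornerFace side l p.1 (p.2 + flank s) =
      edgeFace (treeSides side l) (half side l p.1 p.2).1 (s + o) := by
  obtain ⟨v, i⟩ := p
  refine exists_shift ?_
  have f0 : flank 0 = 2 := rfl
  have f1 : flank 1 = 1 := rfl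
  have e0 : (0 : ZMod 3) + 2 = 2 := rfl
  have e1 : (0 : ZMod 3) + 1 = 1 := rfl
  have e2 : (1 : ZMod 3) + 2 = 0 := rfl
  have e3 : (1 : ZMod 3) + 1 = 2 := rfl
  have e4 : (2 : ZMod 3) + 2 = 1 := rfl
  have e5 : (2 : ZMod 3) + 1 = 0 := rfl
  rcases v with v | v
  · have hv : cornerFace side l (.inl v) = pick3 (some ⟨v + 2, by omega⟩)
      (some (lastFace side l (side (v + 2)) (v + 2) (by omega) (by omega)))
      (some (lastFace side l (!side (v + 2)) (v + 2) (by omega) (by omega))) := rfl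
    rcases zmod3_cases i with rfl | rfl | rfl <;>
      simp only [f0, f1, e0, e1, e2, e3, e4, e5, hv, half_inl, pick3_zero, pick3_one, pick3_two,
        edgeFace, treeSides, if_true, one_ne_zero, if_false, Fin.val_castSucc, Fin.val_succ,
        Option.some.injEq]
    · rcases lastFace_succ_pair (side := side) (l := l) (side (v + 2)) (v + 1) (by omega)
        (by omega) with ⟨h1, h2⟩ | ⟨h1, h2⟩
      · exact Or.inr ⟨h2, h1⟩
      · exact Or.inl ⟨h2, h1⟩
    · simp
    · simp
  · rcases leaf_cases v with rfl | rfl | ⟨k, rfl⟩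
    · have hv : cornerFace side l (.inr 0) = pick3 none (some 1) (some 0) := by
        simp only [cornerFace, leafRec_zero]
      have hlast : lastFace side l (!side (0 + 1)) (0 + 1) (by omega) (by omega) = 0 := by
        apply Fin.ext
        simp [lastFace, lastOn]
      have h1 : (⟨0 + 1, by omega⟩ : Fin (l + 2)) = 1 := rfl
      rcases zmod3_cases i with rfl | rfl | rfl <;>
        simp only [f0, f1, e0, e1, e2, e3, e4, e5, hv, half_zero, pick3_zero, pick3_one,
          pick3_two, edgeFace, treeSides, if_true, one_ne_zero, if_false, Fin.val_zero,
          hlast, h1] <;> simp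
    · have hv : cornerFace side l (.inr (Fin.last (l + 1))) =
        pick3 none (some (lastFace side l true (l + 2) (by omega) le_rfl))
          (some (lastFace side l false (l + 2) (by omega) le_rfl)) := by
          simp only [cornerFace, leafRec_last]
      rcases zmod3_cases i with rfl | rfl | rfl <;>
        simp only [f0, f1, e0, e1, e2, e3, e4, e5, hv, half_last, pick3_zero, pick3_one,
          pick3_two, edgeFace, treeSides, if_true, one_ne_zero, if_false, Fin.val_last,
          Option.some.injEq]
      · exact lastFace_succ_pair (side := side) (l := l) false (l + 1) (by omega) (by omega)
      · simp
      · simp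
    · have hv : cornerFace side l (.inr (midLeaf k)) = pick3 none (some ⟨k + 2, by omega⟩)
        (some (lastFace side l (side (k + 2)) (k + 2) (by omega) (by omega))) := by
          simp only [cornerFace, leafRec_mid]
      rcases zmod3_cases i with rfl | rfl | rfl <;>
        simp only [f0, f1, e0, e1, e2, e3, e4, e5, hv, half_mid, pick3_zero, pick3_one,
          pick3_two, edgeFace, treeSides, if_true, one_ne_zero, if_false] <;> simp

/-- Partial sums of `y` along the horizontal path from `u₀` give the values there, and each vertical
edge then gives the value at its leaf. -/
theorem tree_integrate (hs : Starts side) (hl : 1 ≤ l) (c₀ : ZMod 2) (y : TreeEdge l → ZMod 2) :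
    ∃! c : CatVertex l → ZMod 2, c (.inr 0) = c₀ ∧
      ∀ t, c (edgeEnd hs hl (.inl t) 0) + c (edgeEnd hs hl (.inl t) 1) = y t := by
  let z (j : ℕ) : ZMod 2 := if h : j < l + 1 then y (.inl ⟨j, h⟩) else 0
  let σ (k : ℕ) : ZMod 2 := c₀ + ∑ j ∈ Finset.range k, z j
  let c : CatVertex l → ZMod 2 := Sum.elim (fun i => σ (i + 1))
    (leafRec c₀ (σ (l + 1)) fun i => σ (i + 1) + y (.inr i))
  have hc0 : c (.inr 0) = c₀ := by simp only [c, Sum.elim_inr, leafRec_zero]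
  have hc1 : c (.inr (Fin.last _)) = σ (l + 1) := by simp only [c, Sum.elim_inr, leafRec_last]
  have hc2 (i : Fin l) : c (.inr (midLeaf i)) = σ (i + 1) + y (.inr i) := by
    simp only [c, Sum.elim_inr, leafRec_mid]
  have hpath (k : ℕ) (hk : k ≤ l + 1) : c (pathVertex l k) = σ k := by
    by_cases h0 : k = 0
    · subst h0
      rw [pathVertex_zero, hc0]
      simp [σ]
    · by_cases h1 : k = l + 1
      · subst h1
        rw [pathVertex_last, hc1]
      · obtain ⟨j, rfl⟩ := Nat.exists_eq_succ_of_ne_zero h0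
        rw [show j.succ = (⟨j, by omega⟩ : Fin l).val + 1 from rfl, pathVertex_succ]
        rfl
  refine ⟨c, ⟨hc0, ?_⟩, ?_⟩
  · rintro (i | i)
    · rw [edgeEnd_path_zero, edgeEnd_path_one, hpath _ (by omega), hpath _ (by omega)]
      have h2 : σ (i + 1) = σ i + y (.inl i) := by
        simp only [σ, Finset.sum_range_succ, z, dif_pos i.2, add_assoc]
      rw [h2, ← add_assoc, zmod2_add_self, zero_add]
    · rw [edgeEnd_vertical_zero, edgeEnd_vertical_one, hc2]
      change σ (i + 1) + _ = _
      rw [← add_assoc, zmod2_add_self, zero_add]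
  · rintro d ⟨hd0, hd⟩
    have hdpath (k : ℕ) (hk : k ≤ l + 1) : d (pathVertex l k) = σ k := by
      induction k with
      | zero => rw [pathVertex_zero, hd0]; simp [σ]
      | succ k ih =>
        have h1 := hd (.inl ⟨k, by omega⟩)
        rw [edgeEnd_path_zero, edgeEnd_path_one] at h1
        simp only at h1
        rw [ih (by omega)] at h1
        have h2 : σ (k + 1) = σ k + y (.inl ⟨k, by omega⟩) := by
          simp only [σ, Finset.sum_range_succ, z, dif_pos (show k < l + 1 by omega), add_assoc]
        rw [h2, ← h1, ← add_assoc, zmod2_add_self, zero_add]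
    have hspine (i : Fin l) : d (.inl i) = σ (i + 1) := by
      rw [← pathVertex_succ, hdpath _ (by omega)]
    funext v
    rcases v with i | j
    · exact hspine i
    · rcases leaf_cases j with rfl | rfl | ⟨i, rfl⟩
      · rw [hd0, hc0]
      · rw [← pathVertex_last, hdpath _ le_rfl, hpath _ le_rfl]
      · have h1 := hd (.inr i)
        rw [edgeEnd_vertical_zero, edgeEnd_vertical_one, hspine] at h1
        rw [hc2, ← h1, ← add_assoc, zmod2_add_self, zero_add]

/-- The plane drawing of a cubic caterpillar-Halin graph. -/
noncomputable def halinPlane (w : List Bool) (hl : 1 ≤ w.length) : PlaneTree (halinModel w hl) where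
  corner p := cornerFace (sideOf w) w.length p.1 p.2
  sides := treeSides (sideOf w) w.length
  corner_flank p := cornerFace_flank p
  root := .inr 0
  integrate := tree_integrate (starts_sideOf w) hl

theorem treeSides_lt (t : TreeEdge l) : (treeSides side l t).2 < (treeSides side l t).1 := by
  rcases t with i | i <;> exact lastOn_lt _ _ (by omega)

/-- The later face determines the index of the edge. A horizontal edge has its faces on opposite
sides, a vertical edge on the same side. -/
theorem treeSides_injective (hs : Starts side) : Function.Injective (treeSides side l) := by
  have h1 (i : Fin (l + 1)) (j : Fin l) (h : treeSides side l (.inl i) = treeSides side l (.inr j)) :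
      False := by
    simp only [treeSides, lastFace, Prod.mk.injEq, Fin.mk.injEq] at h
    obtain ⟨h1, h2⟩ := h
    rw [h1] at h2
    have h3 := congrArg side h2
    rw [hs.side_lastOn _ (by omega), hs.side_lastOn _ (by omega)] at h3
    simp at h3
  rintro (i | i) (j | j) h
  · simp only [treeSides, lastFace, Prod.mk.injEq, Fin.mk.injEq] at h
    exact congrArg Sum.inl (Fin.ext (by omega))
  · exact (h1 _ _ h).elim
  · exact (h1 _ _ h.symm).elim
  · simp only [treeSides, lastFace, Prod.mk.injEq, Fin.mk.injEq] at h
    exact congrArg Sum.inr (Fin.ext (by omega))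

/-- The earlier neighbour of `f` on its own side lies across the vertical edge that opens `f`, the
one on the other side across a horizontal edge. Face `1` has only the latter. -/
theorem stripAdj_iff_treeSides (hs : Starts side) (f g : Fin (l + 2)) (hgf : g < f) :
    stripAdj side f g ↔ ∃ t, treeSides side l t = (f, g) := by
  have hgf' : g.val < f.val := hgf
  have h0 : stripAdj side f g ↔ stripAdj side g f := ⟨stripAdj_symm, stripAdj_symm⟩
  rw [h0, stripAdj_of_lt hgf']
  constructor
  · intro h
    by_cases hside : side g = side f
    · have hf : 2 ≤ f.val := by
        by_contra hf
        have h1 : f.val = 1 := by omega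
        have h2 : g.val = 0 := by omega
        rw [h1, h2, hs.zero, hs.one] at hside
        exact absurd hside (by decide)
      refine ⟨.inr ⟨f - 2, by omega⟩, ?_⟩
      have e : f.val - 2 + 2 = f := by omega
      simp only [treeSides, lastFace, e]
      refine Prod.ext rfl (Fin.ext ?_)
      simp only
      rw [← hside, h]
    · refine ⟨.inl ⟨f - 1, by omega⟩, ?_⟩
      have e : f.val - 1 + 1 = f := by omega
      simp only [treeSides, lastFace, e]
      refine Prod.ext rfl (Fin.ext ?_)
      simp only
      rw [← Bool.eq_not.2 hside, h]
  · rintro ⟨i | i, h⟩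
    · simp only [treeSides, lastFace, Prod.mk.injEq, ← Fin.val_inj] at h
      obtain ⟨h1, h2⟩ := h
      rw [h1] at h2
      have h3 : side g = !side f := by
        by_cases hf : 2 ≤ f.val
        · rw [← h2, hs.side_lastOn _ hf]
        · have h1 : f.val = 1 := by omega
          have h2 : g.val = 0 := by omega
          rw [h1, h2, hs.zero, hs.one]
          rfl
      rw [h3, h2]
    · simp only [treeSides, lastFace, Prod.mk.injEq, ← Fin.val_inj] at h
      obtain ⟨h1, h2⟩ := h
      rw [h1] at h2
      have h3 : side g = side f := by
        rw [← h2, hs.side_lastOn _ (by omega)]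
      rw [h3, h2]

/-- The Euler-genus polynomial of a cubic caterpillar-Halin graph counts the symmetric matrices
supported on a strip by rank. -/
theorem eulerGenusPolynomial_halin (w : List Bool) (hl : 1 ≤ w.length) :
    eulerGenusPolynomial (halin w) (caterpillar w.length) =
      2 * rankSum (stripSet (sideOf w) (w.length + 2)) :=
  (halinPlane w hl).eulerGenusPolynomial_eq _ (halinModel_edge_mem w hl) treeSides_lt
    (treeSides_injective (starts_sideOf w)) _ (stripAdj_iff_treeSides (starts_sideOf w))
    fun _ _ => stripAdj_symm

end HalinDrawing

/-! ### The matrices of the form `Λ` -/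

section Delta

/-- The position of `e_{i+1}`, when the rows and columns are listed in the order
`e₁, e_{1,1}, …, e_{1,m₁}, e₂, e_{2,1}, …`. -/
def blockStart : List ℕ → ℕ → ℕ
  | _, 0 => 0
  | [], _ + 1 => 0
  | a :: t, i + 1 => a + 1 + blockStart t i

theorem blockStart_zero (m : List ℕ) : blockStart m 0 = 0 := by
  cases m <;> rfl

theorem blockStart_succ (m : List ℕ) (i : ℕ) (hi : i < m.length) :
    blockStart m (i + 1) = blockStart m i + m[i] + 1 := by
  induction m generalizing i with
  | nil => simp at hi
  | cons a t ih =>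
    cases i with
    | zero => simp [blockStart, blockStart_zero]
    | succ i =>
      have := ih i (by simpa using hi)
      rw [blockStart, this, blockStart]
      simp only [List.getElem_cons_succ]
      omega

theorem blockStart_length (m : List ℕ) : blockStart m m.length = m.length + m.sum := by
  induction m with
  | nil => rfl
  | cons a t ih =>
    rw [List.length_cons, blockStart, ih, List.sum_cons]
    omega

theorem blockStart_mono (m : List ℕ) {i j : ℕ} (hij : i ≤ j) (hj : j ≤ m.length) :
    blockStart m i ≤ blockStart m j := by
  induction j, hij using Nat.le_induction with
  | base => exact le_rfl
  | succ j hij ih =>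
    rw [blockStart_succ m j (by omega)]
    have := ih (by omega)
    omega

theorem blockStart_append (m : List ℕ) (a i : ℕ) (hi : i ≤ m.length) :
    blockStart (m ++ [a]) i = blockStart m i := by
  induction m generalizing i with
  | nil =>
    obtain rfl : i = 0 := by simpa using hi
    rfl
  | cons b t ih =>
    cases i with
    | zero => rfl
    | succ i =>
      rw [List.cons_append, blockStart, blockStart, ih i (by simpa using hi)]

/-- The position of a row or column. -/
def matPos (m : List ℕ) : MatIndex m → ℕ
  | .inl i => blockStart m i
  | .inr p => blockStart m p.1 + 1 + p.2

/-- The sides of the positions in the blocks: the first position of a block is on one side, the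
other positions are on the other side, which alternates. -/
structure BlockSides (m : List ℕ) (side : ℕ → Bool) : Prop where
  start_ne : ∀ (i : ℕ) (hi : i < m.length) (r : ℕ), 1 ≤ r → r ≤ m[i] →
    side (blockStart m i + r) = !side (blockStart m i)
  next_start : ∀ i, i + 1 < m.length → side (blockStart m (i + 1)) = !side (blockStart m i)

variable {m : List ℕ} {side : ℕ → Bool}

/-- All positions from the one after `e_i` through the next block start are opposite to `e_i`. The
first return to its side is the inner position after that start, which exists as the blocks have
inner positions. -/
theorem BlockSides.adj_start (h : BlockSides m side) (hm : ∀ a ∈ m, 1 ≤ a) (i : ℕ)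
    (hi : i < m.length) (q : ℕ) (hq : blockStart m i < q) (hq' : q < blockStart m m.length) :
    stripAdj side (blockStart m i) q ↔ q ≤ blockStart m (i + 1) + 1 := by
  have h1 := blockStart_succ m i hi
  have hnext (hlt : blockStart m (i + 1) < q) : i + 1 < m.length := by
    by_contra hc
    have : i + 1 = m.length := by omega
    rw [this] at hlt
    omega
  rw [stripAdj_iff_forall hq]
  constructor
  · intro h2
    by_contra hc
    have h3 := hnext (by omega)
    refine h2 (blockStart m (i + 1) + 1) (by omega) (by omega) ?_
    rw [h.start_ne (i + 1) h3 1 le_rfl (hm _ (List.getElem_mem h3)), h.next_start i h3,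
      Bool.not_not]
  · intro h2 c hc1 hc2
    by_cases hc : c = blockStart m (i + 1)
    · rw [hc, h.next_start i (hnext (by omega))]
      simp
    · have := h.start_ne i hi (c - blockStart m i) (by omega) (by omega)
      rw [Nat.add_sub_cancel' hc1.le] at this
      rw [this]
      simp

/-- The next position, inner or the start of the next block, is on the same side and hides
everything later. -/
theorem BlockSides.adj_inner (h : BlockSides m side) (i : ℕ)
    (hi : i < m.length) (a : ℕ) (ha : a < m[i]) (q : ℕ) (hq : blockStart m i + 1 + a < q)
    (hq' : q < blockStart m m.length) :
    stripAdj side (blockStart m i + 1 + a) q ↔ q = blockStart m i + 1 + a + 1 := by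
  have h1 := blockStart_succ m i hi
  have hside : side (blockStart m i + 1 + a) = !side (blockStart m i) := by
    rw [add_assoc]
    exact h.start_ne i hi _ (by omega) (by omega)
  rw [stripAdj_iff_forall hq]
  constructor
  · intro h2
    by_contra hc
    refine h2 (blockStart m i + 1 + a + 1) (by omega) (by omega) ?_
    rw [hside]
    by_cases ha' : a + 1 < m[i]
    · rw [add_assoc, add_assoc]
      exact h.start_ne i hi _ (by omega) (by omega)
    · have e : blockStart m i + 1 + a + 1 = blockStart m (i + 1) := by omega
      rw [e]
      refine h.next_start i ?_
      by_contra hc'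
      have : i + 1 = m.length := by omega
      rw [this] at e
      omega
  · intro h2 c hc1 hc2
    omega

theorem matPos_lt (p : MatIndex m) : matPos m p < blockStart m m.length := by
  rcases p with i | ⟨i, a⟩
  · have h1 := blockStart_succ m i i.2
    have h2 := blockStart_mono m (i := i + 1) (j := m.length) i.2 le_rfl
    simp only [matPos]
    omega
  · have h1 := blockStart_succ m i i.2
    have h2 := blockStart_mono m (i := i + 1) (j := m.length) i.2 le_rfl
    have h3 : a.val < m[i.val] := a.2
    simp only [matPos]
    omega

theorem matPos_injective : Function.Injective (matPos m) := by
  have lt (i j : Fin m.length) (hij : i < j) :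
      blockStart m i + m[i.val] + 1 ≤ blockStart m j := by
    rw [← blockStart_succ m i i.2]
    exact blockStart_mono m hij j.2.le
  have inner (p : Σ i : Fin m.length, Fin (m.get i)) : p.2.val < m[p.1.val] := p.2.2
  rintro (i | p) (j | q) h
  · simp only [matPos] at h
    rcases lt_trichotomy i j with hij | rfl | hij
    · have := lt i j hij; omega
    · rfl
    · have := lt j i hij; omega
  · simp only [matPos] at h
    have := inner q
    rcases lt_trichotomy i q.1 with hij | hij | hij
    · have := lt _ _ hij; omega
    · rw [hij] at h; omega
    · have := lt _ _ hij; omega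
  · simp only [matPos] at h
    have := inner p
    rcases lt_trichotomy p.1 j with hij | hij | hij
    · have := lt _ _ hij; omega
    · have : blockStart m p.1 = blockStart m j := by rw [hij]
      omega
    · have := lt _ _ hij; omega
  · simp only [matPos] at h
    have h1 := inner p
    have h2 := inner q
    obtain ⟨i, a⟩ := p
    obtain ⟨j, b⟩ := q
    simp only at h h1 h2
    rcases lt_trichotomy i j with hij | rfl | hij
    · have := lt _ _ hij; omega
    · have : a = b := Fin.ext (by omega)
      rw [this]
    · have := lt _ _ hij; omega

theorem card_matIndex (m : List ℕ) : Fintype.card (MatIndex m) = m.length + m.sum := by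
  rw [Fintype.card_sum, Fintype.card_sigma, Fintype.card_fin]
  simp only [Fintype.card_fin, List.get_eq_getElem]
  rw [Fin.sum_univ_getElem]

/-- The rows and columns in their order. -/
noncomputable def matPosEquiv (m : List ℕ) {n : ℕ} (hn : m.length + m.sum = n) :
    MatIndex m ≃ Fin n :=
  Equiv.ofBijective (fun p => ⟨matPos m p, by rw [← hn, ← blockStart_length]; exact matPos_lt p⟩) <|
    (Fintype.bijective_iff_injective_and_card _).2
      ⟨fun _ _ h => matPos_injective (congrArg Fin.val h), by
        rw [card_matIndex, Fintype.card_fin, hn]⟩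

theorem adj_inl_inl (h : BlockSides m side) (hm : ∀ a ∈ m, 1 ≤ a) (i j : Fin m.length)
    (hij : i < j) : stripAdj side (matPos m (.inl i)) (matPos m (.inl j)) ↔ i.val + 1 = j := by
  have h1 := blockStart_succ m i i.2
  have h2 := blockStart_mono m (i := i + 1) (j := j) hij j.2.le
  have hij' : i.val < j.val := hij
  change stripAdj side (blockStart m i) (blockStart m j) ↔ _
  rw [h.adj_start hm i i.2 (blockStart m j) (by omega) (matPos_lt (.inl j))]
  constructor
  · intro h3
    by_contra hc
    have h4 : blockStart m (i + 2) = _ := blockStart_succ m (i + 1) (by omega)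
    have h5 := blockStart_mono m (i := i + 2) (j := j) (by omega) j.2.le
    have h6 := hm _ (List.getElem_mem (show i.val + 1 < m.length by omega))
    omega
  · intro h3
    rw [← h3]
    omega

theorem adj_inl_inr (h : BlockSides m side) (hm : ∀ a ∈ m, 1 ≤ a) (j : Fin m.length)
    (p : Σ i : Fin m.length, Fin (m.get i)) :
    stripAdj side (matPos m (.inl j)) (matPos m (.inr p)) ↔
      j = p.1 ∨ (j.val = p.1.val + 1 ∧ p.2.val + 1 = m.get p.1) ∨
        (j.val + 1 = p.1.val ∧ p.2.val = 0) := by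
  obtain ⟨i, a⟩ := p
  have ha : a.val < m[i.val] := a.2
  have hget : m.get i = m[i.val] := rfl
  have h1 := blockStart_succ m i i.2
  have hj := blockStart_succ m j j.2
  have hp := matPos_lt (Sum.inr ⟨i, a⟩ : MatIndex m)
  have hpj := matPos_lt (Sum.inl j : MatIndex m)
  simp only [matPos, hget, ← Fin.val_inj] at hp hpj ⊢
  by_cases hji : j.val ≤ i.val
  · have h2 := blockStart_mono m hji i.2.le
    rw [h.adj_start hm j j.2 _ (by omega) hp]
    rcases Nat.lt_or_ge i.val (j.val + 2) with h3 | h3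
    · rcases Nat.lt_or_ge i.val (j.val + 1) with h4 | h4
      · have e : i.val = j.val := by omega
        have e' : blockStart m i = blockStart m j := by rw [e]
        have e2 : m[i.val] = m[j.val] := by simp only [e]
        constructor
        · intro h5; left; exact e.symm
        · intro h5; omega
      · have e : i.val = j.val + 1 := by omega
        have e' : blockStart m i = blockStart m (j + 1) := by rw [e]
        constructor
        · intro h5; right; right; omega
        · intro h5; omega
    · have h4 : blockStart m (j + 2) = _ := blockStart_succ m (j + 1) (by omega)
      have h5 := blockStart_mono m h3 i.2.le
      have h6 := hm _ (List.getElem_mem (show j.val + 1 < m.length by omega))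
      constructor
      · intro h7; omega
      · intro h7; omega
  · have h2 := blockStart_mono m (i := i + 1) (j := j) (by omega) j.2.le
    have hs : ∀ x y, stripAdj side x y ↔ stripAdj side y x :=
      fun x y => ⟨stripAdj_symm, stripAdj_symm⟩
    rw [hs, h.adj_inner i i.2 a ha _ (by omega) hpj]
    by_cases h3 : j.val = i.val + 1
    · rw [h3]
      constructor
      · intro h4; right; left; omega
      · intro h4; omega
    · have h4 : blockStart m (i + 2) = _ := blockStart_succ m (i + 1) (by omega)
      have h5 := blockStart_mono m (i := i + 2) (j := j) (by omega) j.2.le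
      constructor
      · intro h7; omega
      · intro h7; omega

theorem adj_inr_inr (h : BlockSides m side) (p q : Σ i : Fin m.length, Fin (m.get i))
    (hpq : matPos m (.inr p) < matPos m (.inr q)) :
    stripAdj side (matPos m (.inr p)) (matPos m (.inr q)) ↔
      p.1 = q.1 ∧ p.2.val + 1 = q.2.val := by
  have hp : p.2.val < m[p.1.val] := p.2.2
  have hq : q.2.val < m[q.1.val] := q.2.2
  have h1 := blockStart_succ m p.1 p.1.2
  have h2 := blockStart_succ m q.1 q.1.2
  have h3 := matPos_lt (Sum.inr q : MatIndex m)
  simp only [matPos, ← Fin.val_inj] at hpq h3 ⊢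
  rw [h.adj_inner p.1 p.1.2 p.2 hp _ hpq h3]
  rcases lt_trichotomy p.1.val q.1.val with hij | hij | hij
  · have h4 := blockStart_mono m (i := p.1 + 1) (j := q.1) hij q.1.2.le
    constructor
    · intro h7; omega
    · intro h7; omega
  · rw [hij]
    constructor
    · intro h7; omega
    · intro h7; omega
  · have h4 := blockStart_mono m (i := q.1 + 1) (j := p.1) hij p.1.2.le
    omega

theorem tridiag_comm (a b : ℕ → ZMod 2) (i j : ℕ) : tridiag a b i j = tridiag a b j i := by
  unfold tridiag
  split_ifs <;> first | rfl | omega | (subst_vars; rfl)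

theorem Delta_mem (h : BlockSides m side) (hm : ∀ a ∈ m, 1 ≤ a) (x₀ y₀ : ℕ → ZMod 2)
    (x y z : ℕ → ℕ → ZMod 2) :
    Delta m x₀ y₀ x y z ∈ suppSet fun p q => stripAdj side (matPos m p) (matPos m q) := by
  have hsymm : (Delta m x₀ y₀ x y z).IsSymm := by
    refine Matrix.IsSymm.ext fun p q => ?_
    rcases p with i | p <;> rcases q with j | q
    · exact tridiag_comm _ _ _ _
    · rfl
    · rfl
    · simp only [Delta]
      by_cases hpq : p.1 = q.1
      · have e1 : x q.1 = x p.1 := by rw [hpq]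
        have e2 : y q.1 = y p.1 := by rw [hpq]
        rw [if_pos hpq, if_pos hpq.symm, tridiag_comm, e1, e2]
      · rw [if_neg hpq, if_neg (Ne.symm hpq)]
  have key (p q : MatIndex m) (hpq : matPos m p < matPos m q)
      (hadj : ¬ stripAdj side (matPos m p) (matPos m q)) : Delta m x₀ y₀ x y z p q = 0 := by
    have hinr (j : Fin m.length) (p : Σ i : Fin m.length, Fin (m.get i))
        (hadj : ¬ stripAdj side (matPos m (.inl j)) (matPos m (.inr p))) : blockM m z p j = 0 := by
      rw [adj_inl_inr h hm, not_or, not_or] at hadj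
      rw [blockM, if_neg hadj.1, if_neg hadj.2.1, if_neg hadj.2.2]
    rcases p with i | p <;> rcases q with j | q
    · have hij : i < j := by
        by_contra hc
        have := blockStart_mono m (i := j) (j := i) (not_lt.1 hc) i.2.le
        simp only [matPos] at hpq
        omega
      rw [adj_inl_inl h hm i j hij] at hadj
      have : i.val < j.val := hij
      simp only [Delta, tridiag]
      rw [if_neg (by omega), if_neg (by omega), if_neg (by omega)]
    · exact hinr _ _ hadj
    · exact hinr _ _ fun h' => hadj (stripAdj_symm h')
    · rw [adj_inr_inr h p q hpq] at hadj
      simp only [Delta]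
      by_cases h1 : p.1 = q.1
      · rw [if_pos h1]
        simp only [matPos, h1] at hpq
        rw [not_and] at hadj
        have h2 := hadj h1
        rw [tridiag, if_neg (by omega), if_neg (by omega), if_neg (by omega)]
      · rw [if_neg h1]
  refine ⟨hsymm, fun p q hpq hadj => ?_⟩
  rcases lt_or_gt_of_ne (fun h' => hpq (matPos_injective h')) with h1 | h1
  · exact key p q h1 hadj
  · rw [← hsymm.apply]
    exact key q p h1 fun h' => hadj (stripAdj_symm h')

/-- Each adjacent pair of the strip and each diagonal place has its own parameter in `Delta`, so the
parameters are read off from `M` by position. -/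
theorem exists_Delta (h : BlockSides m side) (hm : ∀ a ∈ m, 1 ≤ a)
    (M : Matrix (MatIndex m) (MatIndex m) (ZMod 2))
    (hM : M ∈ suppSet fun p q => stripAdj side (matPos m p) (matPos m q)) :
    ∃ (x₀ y₀ : ℕ → ZMod 2) (x y z : ℕ → ℕ → ZMod 2), M = Delta m x₀ y₀ x y z := by
  classical
  obtain ⟨N, hN⟩ : ∃ N : ℕ → ℕ → ZMod 2, ∀ p q, M p q = N (matPos m p) (matPos m q) := by
    refine ⟨fun a b => if hab : (∃ p, matPos m p = a) ∧ ∃ q, matPos m q = b then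
      M hab.1.choose hab.2.choose else 0, fun p q => ?_⟩
    have hpq : (∃ p', matPos m p' = matPos m p) ∧ ∃ q', matPos m q' = matPos m q :=
      ⟨⟨p, rfl⟩, ⟨q, rfl⟩⟩
    beta_reduce
    rw [dif_pos hpq, matPos_injective hpq.1.choose_spec, matPos_injective hpq.2.choose_spec]
  -- Index `0` is the last inner position of the previous block, `1, …, m_j` are those of the own
  -- block, and `m_j + 1` is the first one of the next block. The value at `j = c = 0` is never
  -- used.
  let z (j c : ℕ) : ZMod 2 := if c = 0 then N (blockStart m j - 1) (blockStart m j) else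
    if blockStart m j + c < blockStart m (j + 1) then N (blockStart m j + c) (blockStart m j)
    else N (blockStart m (j + 1) + 1) (blockStart m j)
  refine ⟨fun i => N (blockStart m i) (blockStart m i),
    fun i => N (blockStart m i) (blockStart m (i + 1)),
    fun i a => N (blockStart m i + 1 + a) (blockStart m i + 1 + a),
    fun i a => N (blockStart m i + 1 + a) (blockStart m i + 1 + (a + 1)), z, ?_⟩
  have hsymm := hM.1.apply
  have hblock (p : Σ i : Fin m.length, Fin (m.get i)) (j : Fin m.length) :
      M (.inr p) (.inl j) = blockM m z p j := by
    have h1 := blockStart_succ m p.1 p.1.2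
    have hp : p.2.val < m[p.1.val] := p.2.2
    have h2 := blockStart_succ m j j.2
    have g1 : m.get p.1 = m[p.1.val] := rfl
    have g2 : m.get j = m[j.val] := rfl
    rw [blockM, hN]
    by_cases c1 : j = p.1
    · have e1 : blockStart m j = blockStart m p.1 := by rw [c1]
      rw [if_pos c1]
      simp only [z]
      rw [if_neg (Nat.succ_ne_zero _), if_pos (by omega)]
      exact congrArg₂ N (by simp only [matPos]; omega) (by simp only [matPos]; omega)
    · rw [if_neg c1]
      by_cases c2 : j.val = p.1.val + 1 ∧ p.2.val + 1 = m.get p.1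
      · have e1 : blockStart m j = blockStart m (p.1 + 1) := by rw [c2.1]
        rw [if_pos c2]
        simp only [z]
        rw [if_pos trivial]
        exact congrArg₂ N (by simp only [matPos]; omega) (by simp only [matPos])
      · rw [if_neg c2]
        by_cases c3 : j.val + 1 = p.1.val ∧ p.2.val = 0
        · have e1 : blockStart m p.1 = blockStart m (j + 1) := by rw [c3.1]
          rw [if_pos c3]
          simp only [z]
          rw [if_neg (Nat.succ_ne_zero _), if_neg (by omega)]
          exact congrArg₂ N (by simp only [matPos]; omega) (by simp only [matPos])
        · rw [if_neg c3, ← hN]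
          have hne : (Sum.inr p : MatIndex m) ≠ Sum.inl j := by simp
          refine hM.2 _ _ hne fun h' => ?_
          have := (adj_inl_inr h hm j p).1 (stripAdj_symm h')
          tauto
  ext p q
  rcases p with i | p <;> rcases q with j | q
  · simp only [Delta, tridiag]
    split_ifs with c1 c2 c3
    · rw [hN, matPos, matPos, c1]
    · rw [hN, matPos, matPos, c2]
    · rw [← hsymm, hN, matPos, matPos, c3]
    · rcases lt_or_gt_of_ne c1 with hij | hij
      · refine hM.2 _ _ (by simpa [← Fin.val_inj] using c1) fun h' => ?_
        exact c2 ((adj_inl_inl h hm i j hij).1 h')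
      · refine hM.2 _ _ (by simpa [← Fin.val_inj] using c1) fun h' => ?_
        exact c3 ((adj_inl_inl h hm j i hij).1 (stripAdj_symm h'))
  · rw [← hsymm, hblock]
    rfl
  · rw [hblock]
    rfl
  · simp only [Delta]
    by_cases hpq : p.1 = q.1
    · have e1 : blockStart m p.1 = blockStart m q.1 := by rw [hpq]
      rw [if_pos hpq, tridiag]
      split_ifs with c1 c2 c3
      · exact (hN _ _).trans
          (congrArg₂ N (by simp only [matPos]) (by simp only [matPos]; omega))
      · exact (hN _ _).trans
          (congrArg₂ N (by simp only [matPos]) (by simp only [matPos]; omega))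
      · rw [← hsymm]
        exact (hN _ _).trans
          (congrArg₂ N (by simp only [matPos]; omega) (by simp only [matPos]; omega))
      · have hne : (Sum.inr p : MatIndex m) ≠ Sum.inr q := by
          intro h'
          rw [Sum.inr.inj h'] at c1
          exact c1 rfl
        refine hM.2 _ _ hne fun h' => ?_
        rcases lt_or_gt_of_ne (fun h'' => hne (matPos_injective h'')) with h1 | h1
        · exact c2 ((adj_inr_inr h p q h1).1 h').2
        · exact c3 ((adj_inr_inr h q p h1).1 (stripAdj_symm h')).2
    · rw [if_neg hpq]
      have hne : (Sum.inr p : MatIndex m) ≠ Sum.inr q := by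
        intro h'
        rw [Sum.inr.inj h'] at hpq
        exact hpq rfl
      refine hM.2 _ _ hne fun h' => ?_
      rcases lt_or_gt_of_ne (fun h'' => hne (matPos_injective h'')) with h1 | h1
      · exact hpq ((adj_inr_inr h p q h1).1 h').1
      · exact hpq ((adj_inr_inr h q p h1).1 (stripAdj_symm h')).1.symm

/-- The summation range exhausts all ranks, as its bound is the size of the matrices. -/
theorem lambdaPoly_eq_rankSum (m : List ℕ) : lambdaPoly m = rankSum (LambdaSet m) := by
  classical
  have hr (M : Matrix (MatIndex m) (MatIndex m) (ZMod 2)) :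
      M.rank ∈ Finset.range (m.length + m.sum + 1) := by
    rw [Finset.mem_range, Nat.lt_succ_iff, ← card_matIndex]
    exact M.rank_le_card_height
  rw [lambdaPoly, rankSum_def,
    ← Finset.sum_fiberwise_of_maps_to (fun M _ => hr (M : LambdaSet m).1)]
  refine Finset.sum_congr rfl fun j _ => ?_
  rw [Finset.sum_congr rfl (g := fun _ => X ^ j) fun M hM => by rw [(Finset.mem_filter.1 hM).2],
    Finset.sum_const, nsmul_eq_mul]
  congr 1
  rw [← Fintype.card_subtype, ← Nat.card_eq_fintype_card]
  rw [map_natCast]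
  congr 1
  exact Nat.card_congr (Equiv.subtypeSubtypeEquivSubtypeInter _ _).symm

/-- The polynomial `λ` in terms of strips. -/
theorem lambdaPoly_eq (h : BlockSides m side) (hm : ∀ a ∈ m, 1 ≤ a) (hne : m ≠ []) {n : ℕ}
    (hn : m.length + m.sum = n) (b : Fin n) (hb : b.val = blockStart m (m.length - 1)) :
    lambdaPoly m = rankSum (suppZero (fun i j : Fin n => stripAdj side i j) b) := by
  have hpos : 0 < m.length := List.length_pos_iff.2 hne
  let last : Fin m.length := ⟨m.length - 1, by omega⟩
  have hlast : matPosEquiv m hn (.inl last) = b := Fin.ext hb.symm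
  rw [lambdaPoly_eq_rankSum, ← hlast, ← rankSum_suppZero_congr (matPosEquiv m hn)
    (A := fun p q => stripAdj side (matPos m p) (matPos m q)) fun _ _ _ => Iff.rfl]
  congr 1
  ext M
  constructor
  · rintro ⟨⟨x₀, y₀, x, y, z, rfl⟩, h2⟩
    exact ⟨Delta_mem h hm _ _ _ _ _, fun q => (h2 last (by simp only [last]; omega) q).1⟩
  · rintro ⟨h1, h2⟩
    refine ⟨exists_Delta h hm M h1, fun i hi q => ?_⟩
    obtain rfl : i = last := Fin.ext (by simp only [last]; omega)
    exact ⟨h2 q, by rw [← h1.1.apply]; exact h2 q⟩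

end Delta

/-! ### The words of the graphs -/

section Words

theorem laterRuns_concat (t : List ℕ) (k : ℕ) :
    laterRuns (t ++ [k]) = t.map (· + 1) ++ [k] := by
  induction t with
  | nil => rfl
  | cons a t ih =>
    cases t with
    | nil => rfl
    | cons b t =>
      change (a + 1) :: laterRuns ((b :: t) ++ [k]) = _
      rw [ih]
      rfl

/-- The side on which the next run is drawn. -/
def nextSide : Bool → List ℕ → Bool
  | s, [] => s
  | s, _ :: t => nextSide (!s) t

theorem runWord_concat (s : Bool) (u : List ℕ) (k : ℕ) :
    runWord s (u ++ [k]) = runWord s u ++ List.replicate k (nextSide s u) := by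
  induction u generalizing s with
  | nil => simp [runWord, nextSide]
  | cons a t ih => simp [runWord, nextSide, ih]

theorem length_runWord (s : Bool) (u : List ℕ) : (runWord s u).length = u.sum := by
  induction u generalizing s with
  | nil => rfl
  | cons a t ih => simp [runWord, ih]

theorem sum_map_succ (t : List ℕ) : (t.map (· + 1)).sum = t.length + t.sum := by
  induction t with
  | nil => rfl
  | cons a t ih => simp only [List.map_cons, List.sum_cons, ih, List.length_cons]; omega

/-- The runs before the last one. -/
def headRuns : List ℕ → List ℕ
  | [] => []
  | a :: t => a :: t.map (· + 1)

theorem runs_concat {m : List ℕ} (hm : m ≠ []) (k : ℕ) : runs (m ++ [k]) = headRuns m ++ [k] := by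
  cases m with
  | nil => exact absurd rfl hm
  | cons a t => exact congrArg (a :: ·) (laterRuns_concat t k)

theorem headRuns_concat {m : List ℕ} (hm : m ≠ []) (k : ℕ) :
    headRuns (m ++ [k]) = headRuns m ++ [k + 1] := by
  cases m with
  | nil => exact absurd rfl hm
  | cons a t => simp [headRuns]

theorem sum_headRuns {m : List ℕ} (hm : m ≠ []) :
    (headRuns m).sum + 1 = m.length + m.sum := by
  cases m with
  | nil => exact absurd rfl hm
  | cons a t => simp only [headRuns, List.sum_cons, sum_map_succ, List.length_cons]; omega

/-- The sides of the positions in the blocks of lengths `1 + m₁, …, 1 + m_k`. -/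
def stripWord : Bool → List ℕ → List Bool
  | _, [] => []
  | s, a :: t => (!s) :: (List.replicate a s ++ stripWord (!s) t)

/-- The start of the next block lies on the side of the inner positions before it and lengthens
their run by one: the source of the `+ 1` in `laterRuns`. -/
theorem stripWord_cons (s : Bool) (a : ℕ) (t : List ℕ) :
    stripWord s (a :: t) = (!s) :: runWord s (laterRuns (a :: t)) := by
  induction t generalizing s a with
  | nil => simp [stripWord, laterRuns, runWord]
  | cons b t ih =>
    rw [stripWord, ih, laterRuns, runWord, List.replicate_succ', Bool.not_not]
    simp

/-- Cutting off the two initial faces takes one letter from the first run, which therefore has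
length `m₁` and not `m₁ + 1`. -/
theorem stripWord_true {m : List ℕ} (hm : 2 ≤ m.length) :
    stripWord true m = false :: true :: runWord true (runs m) := by
  match m, hm with
  | a :: b :: t, _ => simp [stripWord_cons, laterRuns, runs, runWord, List.replicate_succ]

theorem blockSides_stripWord (s : Bool) (m : List ℕ) :
    BlockSides m fun i => (stripWord s m).getD i false := by
  induction m generalizing s with
  | nil => exact ⟨fun i hi => absurd hi (by simp), fun i hi => absurd hi (by simp)⟩
  | cons a t ih =>
    have hr (k : ℕ) : (stripWord s (a :: t)).getD (a + 1 + k) false =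
        (stripWord (!s) t).getD k false := by
      rw [show a + 1 + k = (a + k) + 1 by omega, stripWord, List.getD_cons_succ,
        List.getD_append_right _ _ _ _ (by simp)]
      simp
    constructor
    · intro i hi r hr1 hr2
      cases i with
      | zero =>
        obtain ⟨r, rfl⟩ : ∃ r', r = r' + 1 := ⟨r - 1, by omega⟩
        have hra : r < a := hr2
        simp only [blockStart, zero_add, stripWord, List.getD_cons_succ, List.getD_cons_zero,
          Bool.not_not]
        rw [List.getD_append _ _ _ _ (by simpa using hra), List.getD_replicate _ hra]
      | succ i =>
        simp only [blockStart, add_assoc _ (blockStart t i) r, hr]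
        exact (ih (!s)).start_ne i (by simpa using hi) r hr1 hr2
    · intro i hi
      cases i with
      | zero =>
        have h0 := hr 0
        match t, hi with
        | b :: t, _ =>
          simp only [blockStart]
          rw [h0]
          simp [stripWord]
      | succ i =>
        simp only [blockStart, hr]
        exact (ih (!s)).next_start i (by simpa using hi)

theorem BlockSides.of_concat {m : List ℕ} {side : ℕ → Bool} {a b : ℕ} (hab : a ≤ b)
    (h : BlockSides (m ++ [b]) side) : BlockSides (m ++ [a]) side := by
  constructor
  · intro i hi r h1 h2
    have hi' : i < m.length + 1 := by simpa using hi
    have h3 := h.start_ne i (by simpa using hi) r h1 (by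
      refine h2.trans ?_
      rcases Nat.lt_or_ge i m.length with h4 | h4
      · simp [List.getElem_append_left, h4]
      · obtain rfl : i = m.length := by omega
        simpa using hab)
    rwa [blockStart_append _ _ _ (by omega)] at h3 ⊢
  · intro i hi
    have hi' : i + 1 < m.length + 1 := by simpa using hi
    have h3 := h.next_start i (by simpa using hi)
    rwa [blockStart_append _ _ _ (by omega), blockStart_append _ _ _ (by omega)] at h3 ⊢

theorem sideOf_eq_getD (w : List Bool) : sideOf w = fun i => (false :: true :: w).getD i false := by
  funext i
  match i with
  | 0 => rfl
  | 1 => rfl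
  | i + 2 => simp [sideOf]

theorem blockSides_sideOf {m : List ℕ} (hm : m ≠ []) (k : ℕ) :
    BlockSides (m ++ [k]) (sideOf (runWord true (runs (m ++ [k])))) := by
  have h1 := List.length_pos_iff.2 hm
  rw [sideOf_eq_getD, ← stripWord_true (by simp; omega)]
  exact blockSides_stripWord true _

theorem eulerH_eq {m : List ℕ} {w : List Bool} (hw : runWord true (runs m) = w)
    (hl : 1 ≤ w.length) :
    eulerH m = 2 * rankSum (stripSet (sideOf w) (w.length + 2)) := by
  subst hw
  exact eulerGenusPolynomial_halin _ hl

theorem sideOf_append (u v : List Bool) {i : ℕ} (hi : i < u.length + 2) :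
    sideOf (u ++ v) i = sideOf u i := by
  match i with
  | 0 => rfl
  | 1 => rfl
  | i + 2 => exact List.getD_append _ _ _ _ (by omega)

theorem stripSet_sideOf_concat (u : List Bool) (s s' : Bool) :
    stripSet (sideOf (u ++ [s])) (u.length + 3) = stripSet (sideOf (u ++ [s'])) (u.length + 3) :=
  stripSet_last _ (u.length + 2) fun i hi => by rw [sideOf_append _ _ hi, sideOf_append _ _ hi]

/-- Flipping the last leaf changes the side of the last position only, which the strip does not see.
-/
theorem eulerH_congr {m m' : List ℕ} (u : List Bool) (s s' : Bool)
    (h : runWord true (runs m) = u ++ [s]) (h' : runWord true (runs m') = u ++ [s']) :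
    eulerH m = eulerH m' := by
  rw [eulerH_eq h (by simp), eulerH_eq h' (by simp), List.length_append, List.length_append]
  exact congrArg (2 * rankSum ·) (stripSet_sideOf_concat u s s')

end Words

/-! ### The recursion and the initial conditions -/

section Recursion

variable {side : ℕ → Bool}

open Classical in
/-- The degree of a position `b ≥ 2` after which all positions are on the other side. -/
theorem card_strip_neighbors (h : Starts side) {n : ℕ} (b : Fin (n + 1)) (hb : 2 ≤ b.val)
    (hside : ∀ c, b.val < c → c < n → side c ≠ side b) :
    Fintype.card {j : Fin (n + 1) // j = b ∨ stripAdj side b j} = n + 3 - b.val := by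
  have h1 := h.lastOn_lt true hb
  have h2 := h.lastOn_lt false hb
  have h3 : lastOn side true b ≠ lastOn side false b := fun h3 => by
    have h4 := h.side_lastOn true hb
    rw [h3, h.side_lastOn false hb] at h4
    exact absurd h4 (by decide)
  have hbn := b.2
  have hmap : (Finset.univ.filter fun j : Fin (n + 1) => j = b ∨ stripAdj side b j).map
      Fin.valEmbedding =
      insert (lastOn side true b) (insert (lastOn side false b) (Finset.Icc b.val n)) := by
    ext j
    simp only [Finset.mem_map, Finset.mem_filter, Finset.mem_univ, true_and, Fin.valEmbedding_apply,
      Finset.mem_insert, Finset.mem_Icc]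
    constructor
    · rintro ⟨j, hj, rfl⟩
      have hjn := j.2
      rcases lt_or_ge j.val b.val with hjb | hjb
      · rcases hj with rfl | hj
        · omega
        · rcases (stripAdj_last_iff h hb hjb true).1 (stripAdj_symm hj) with h4 | h4
          · exact Or.inl h4
          · exact Or.inr (Or.inl h4)
      · exact Or.inr (Or.inr ⟨hjb, by omega⟩)
    · rintro (h4 | h4 | ⟨h4, h5⟩)
      · exact ⟨⟨j, by omega⟩, Or.inr (stripAdj_symm
          ((stripAdj_last_iff h hb (h4 ▸ h1) true).2 (Or.inl h4))), rfl⟩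
      · exact ⟨⟨j, by omega⟩, Or.inr (stripAdj_symm
          ((stripAdj_last_iff h hb (h4 ▸ h2) true).2 (Or.inr h4))), rfl⟩
      · refine ⟨⟨j, by omega⟩, ?_, rfl⟩
        rcases Nat.eq_or_lt_of_le h4 with h6 | h6
        · exact Or.inl (Fin.ext h6.symm)
        · exact Or.inr ((stripAdj_iff_forall h6).2 fun c h7 h8 => hside c h7 (by omega))
  rw [Fintype.card_subtype, ← Finset.card_map Fin.valEmbedding, hmap, Finset.card_insert_of_notMem,
    Finset.card_insert_of_notMem, Nat.card_Icc]
  · omega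
  · rw [Finset.mem_Icc]; omega
  · rw [Finset.mem_insert, Finset.mem_Icc]; omega

/-- The words of the three graphs are prefixes of one another, so one strip, truncated at three
lengths, serves them all. Here `n` is `m_k - 1`, so the exponent `n + 4` is `m_k + 3`. -/
theorem eulerH_recursion {m : List ℕ} {n : ℕ} (hm : m ≠ []) (hpos : ∀ a ∈ m, 1 ≤ a)
    (hn : 1 ≤ n) :
    eulerH (m ++ [n + 1]) =
      (1 + 4 * X) * eulerH (m ++ [n]) + 16 * X ^ 2 * eulerH (m ++ [n - 1])
        + 2 ^ (n + 4) * X ^ 2 * lambdaPoly (m ++ [n]) := by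
  classical
  obtain ⟨k, rfl⟩ : ∃ k, n = k + 1 := ⟨n - 1, by omega⟩
  rw [Nat.add_sub_cancel]
  set u := runWord true (headRuns m) with hu
  set e := nextSide true (headRuns m)
  have hw (j : ℕ) : runWord true (runs (m ++ [j])) = u ++ List.replicate j e := by
    rw [runs_concat hm, runWord_concat]
  have hul : u.length + 1 = m.length + m.sum := by
    rw [hu, length_runWord, sum_headRuns hm]
  have hml := List.length_pos_iff.2 hm
  have hsum : 1 ≤ m.sum := by
    match m, hm with
    | a :: t, _ =>
      have := hpos a (by simp)
      rw [List.sum_cons]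
      omega
  have hlen (j : ℕ) : (u ++ List.replicate j e).length = u.length + j := by simp
  have hpre (j r : ℕ) {i : ℕ} (hi : i < u.length + j + 2) :
      sideOf (u ++ List.replicate (j + r) e) i = sideOf (u ++ List.replicate j e) i := by
    rw [List.replicate_add, ← List.append_assoc]
    exact sideOf_append _ _ (by simpa using hi)
  set side := sideOf (u ++ List.replicate (k + 2) e) with hside
  have hst : Starts side := starts_sideOf _
  have hbl : BlockSides (m ++ [k + 2]) side := by
    rw [hside, ← hw]
    exact blockSides_sideOf hm _
  have hbl' : BlockSides (m ++ [k + 1]) side := hbl.of_concat (by omega)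
  have hE (j r : ℕ) (hjr : j + r = k + 2) :
      eulerH (m ++ [j]) = 2 * rankSum (stripSet side (u.length + j + 2)) := by
    rw [eulerH_eq (hw j) (by rw [hlen]; omega), hlen, hside, ← hjr]
    congr 2
    exact (stripSet_last _ (u.length + j + 1) fun i hi => hpre j r (by omega)).symm
  have hbs (j : ℕ) : blockStart (m ++ [j]) m.length = u.length + 1 := by
    rw [blockStart_append _ _ _ le_rfl, blockStart_length, hul]
  have hafter (r : ℕ) (h1 : 1 ≤ r) (h2 : r ≤ k + 1) :
      side (u.length + 1 + r) = !side (u.length + 1) := by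
    have := hbl'.start_ne m.length (by simp) r h1 (by simpa using h2)
    rwa [hbs] at this
  -- This is the position of `e_k`; the faces opened by the last run, except possibly the very last
  -- one, lie on the other side.
  let b : Fin (u.length + k + 2 + 1) := ⟨u.length + 1, by omega⟩
  have hne : ∀ c, u.length + 1 < c → c < u.length + k + 2 → side c ≠ side (u.length + 1) := by
    intro c h1 h2
    obtain ⟨r, rfl⟩ := Nat.exists_eq_add_of_lt h1
    rw [add_assoc, hafter (r + 1) (by omega) (by omega)]
    cases side (u.length + 1) <;> decide
  have hN : side (u.length + k + 2) = !side (u.length + 1) := by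
    rw [← hafter (k + 1) (by omega) le_rfl]
    congr 1
    omega
  have hb : b.val = lastOn side (!side (u.length + k + 2)) (u.length + k + 2) := by
    rw [hN, Bool.not_not]
    exact (lastOn_eq (by omega) rfl hne).symm
  have hcard := card_strip_neighbors hst b (show 2 ≤ u.length + 1 by omega) hne
  have hl := lambdaPoly_eq hbl' (by
      intro a ha
      rcases List.mem_append.1 ha with ha | ha
      · exact hpos a ha
      · rw [List.mem_singleton.1 ha]; omega) (by simp)
    (n := u.length + k + 2 + 1) (by simp; omega) b (by simp [hbs, b])
  -- The closed neighbourhood of `b` has `k + 4` elements; the factor two in `eulerH` raises the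
  -- exponent to `k + 5`.
  rw [hE (k + 1 + 1) 0 rfl, hE (k + 1) 1 rfl, hE k 2 rfl, hl,
    show u.length + (k + 1 + 1) + 2 = u.length + k + 2 + 2 by omega,
    show u.length + (k + 1) + 2 = u.length + k + 2 + 1 by omega,
    rankSum_stripSet hst (by omega) b hb, hcard,
    show u.length + k + 2 + 3 - b.val = k + 4 by simp only [b]; omega]
  ring

/-- A run followed by another, even an empty one, is lengthened by one, so `a, 0` and a final `a +
1` give the same word. -/
theorem eulerH_concat_zero {m : List ℕ} {a : ℕ} (hm : m ≠ []) :
    eulerH (m ++ [a, 0]) = eulerH (m ++ [a + 1]) := by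
  have h : runWord true (runs (m ++ [a, 0])) = runWord true (runs (m ++ [a + 1])) := by
    rw [show m ++ [a, 0] = (m ++ [a]) ++ [0] by simp, runs_concat (by simp), runs_concat hm,
      headRuns_concat hm, runWord_concat, List.replicate_zero, List.append_nil]
  rw [eulerH, eulerH, h]

/-- The words end in runs `a + 1, 1` and `a + 2`, which differ only in the side of the last leaf. -/
theorem eulerH_concat_one {m : List ℕ} {a : ℕ} (hm : m ≠ []) :
    eulerH (m ++ [a, 1]) = eulerH (m ++ [a + 2]) := by
  refine eulerH_congr (runWord true (headRuns m ++ [a + 1])) (nextSide true (headRuns m ++ [a + 1]))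
    (nextSide true (headRuns m)) ?_ ?_
  · rw [show m ++ [a, 1] = (m ++ [a]) ++ [1] by simp, runs_concat (by simp), headRuns_concat hm,
      runWord_concat]
    rfl
  · rw [runs_concat hm, runWord_concat, runWord_concat, List.replicate_succ', List.append_assoc]

theorem eulerH_pair_zero (a : ℕ) : eulerH [a, 0] = eulerH [a] := by
  have h : runWord true (runs [a, 0]) = runWord true (runs [a]) := by
    simp [runs, laterRuns, runWord]
  rw [eulerH, eulerH, h]

/-- The first run is not lengthened by one, whence `a + 1` in place of `a + 2`. -/
theorem eulerH_pair_one (a : ℕ) : eulerH [a, 1] = eulerH [a + 1] := by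
  refine eulerH_congr (List.replicate a true) false true ?_ ?_
  · simp [runs, laterRuns, runWord]
  · simp [runs, laterRuns, runWord, List.replicate_succ']

end Recursion

end CatHalin

open Polynomial in
theorem mainTheorem1 :
    -- the recurrence for `H_{m₁,…,m_k}`, with `k ≥ 2`, `m = (m₁,…,m_{k-1})` and `n = m_k`
    (∀ (m : List ℕ) (n : ℕ), m ≠ [] → (∀ a ∈ m, 1 ≤ a) → 2 ≤ n →
      CatHalin.eulerH (m ++ [n]) =
        (1 + 4 * X) * CatHalin.eulerH (m ++ [n - 1])
          + 16 * X ^ 2 * CatHalin.eulerH (m ++ [n - 2])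
          + 2 ^ (n + 3) * X ^ 2 * CatHalin.lambdaPoly (m ++ [n - 1])) ∧
    -- the initial conditions for `k ≥ 3`, with `m = (m₁,…,m_{k-2})` and `a = m_{k-1}`
    (∀ (m : List ℕ) (a : ℕ), m ≠ [] → (∀ b ∈ m, 1 ≤ b) → 1 ≤ a →
      CatHalin.eulerH (m ++ [a, 0]) = CatHalin.eulerH (m ++ [a + 1]) ∧
      CatHalin.eulerH (m ++ [a, 1]) = CatHalin.eulerH (m ++ [a + 2])) ∧
    -- the initial conditions for `k = 2`, with `a = m₁`
    (∀ a : ℕ, 1 ≤ a →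
      CatHalin.eulerH [a, 0] = CatHalin.eulerH [a] ∧
      CatHalin.eulerH [a, 1] = CatHalin.eulerH [a + 1]) := by
  refine ⟨fun m n hm hpos hn => ?_, fun m a hm _ _ =>
    ⟨CatHalin.eulerH_concat_zero hm, CatHalin.eulerH_concat_one hm⟩,
    fun a _ => ⟨CatHalin.eulerH_pair_zero a, CatHalin.eulerH_pair_one a⟩⟩
  obtain ⟨n, rfl⟩ : ∃ n', n = n' + 1 := ⟨n - 1, by omega⟩
  exact CatHalin.eulerH_recursion hm hpos (by omega)
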